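/- Let $p,q\ge 2$ and let $G_{p,q}$ be the directed grid graph with vertices $v_{i,j}$ ($1\le i\le p$, $1\le j\le q$) and arcs $(v_{i,j},v_{i+1,j})$ and $(v_{i,j},v_{i,j+1})$; put $s=v_{1,1}$, $t=v_{p,q}$. An instance $\mathcal I=(G_{p,q},s,t,c,Q)$ of the quadratic shortest path problem (QSPP) consists of a nonnegative real vector $c$ indexed by the arcs and a nonnegative symmetric real matrix $Q=(q_{e,f})$ with zero diagonal indexed by the arcs; the cost of an $s$-$t$ path $P$ is $C(P,c,Q)=\sum_{e,f\in P}q_{e,f}+\sum_{e\in P}c_e$, and $C(P,c')=\sum_{e\in P}c'_e$. The instance is linearizable if there is a vector $c'\ge 0$ with $C(P,c,Q)=C(P,c')$ for every $s$-$t$ path $P$. A vector $c'$ is in reduced form if $c'_f=0$ whenever $f$ is the arc $(v_{i,j},v_{i,j+1})$ with $v_{i,j}\ne s$, $j\le q-1$, or the arc $(v_{i,j},v_{i+1,j})$ with $v_{i,j}\ne s$, $j=q$. The algorithm Linearize-grid-QSPP works as follows. For a target $v_{a,b}$ with $a\ge 2$, the critical paths are the path from $s$ along row $1$ to column $b$ and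 then down to row $a$, and, for $1\le r\le a-1$ and $1\le j\le b-1$, the path from $s$ down column $1$ to row $r$, along row $r$ to column $j$, down to row $r+1$, along row $r+1$ to column $b$, and down to row $a$. The pseudo-linearization vector $\widehat{pc}^{a,b}$ is the unique vector in reduced form on the subgrid $G_{a,b}$ whose cost on each critical path $P$ is $\sum_{e,f\in P}q_{e,f}$; it is computed by visiting the critical paths in an order in which consecutive ones differ in two arcs and updating the cost. Given a cost vector $d$ for the target $w$ and an arc $(v,w)$, the derived vector for the target $v$ is $d_e-2q_{(v,w),e}$, plus $d_{(v,w)}$ if $e$ leaves $s$. The reduced form of a vector is obtained by treating the vertices $v_{i,j}$ other than the source and the target in the order of decreasing $i+j$: the cost of the outgoing arc $f$ selected above is subtracted from all outgoing arcs and added to all incoming arcs. The algorithm puts $\widehat c^{p,q}=\widehat{pc}^{p,q}$. For $i=p-1,\dots,2$ it derives vectors for the targets $v_{i+1,q-1},\dots,v_{i+1,1}$ successively along row $i+1$ from $\widehat c^{i+1,q}$, derives from the vectors for $v_{i+1,j}$ vectors for the targets $v_{i,j}$ ($j=1,\dots,q$), and takes their reduced forms $\widehat c^{i,j}$; it rejects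 if $\widehat c^{i,j}\neq\widehat{pc}^{i,j}$ for some $j\le q-1$. Finally it rejects if $\widehat c^{2,q}\ne\widehat{pc}^{2,q}$, and otherwise accepts and returns the reduced form of $\widehat{pc}^{p,q}+c$ (which is $\widehat{pc}^{p,q}$ itself if $c=0$). **Theorem.** For every QSPP instance $\mathcal I$ on $G_{p,q}$, $p,q\ge2$, the algorithm Linearize-grid-QSPP accepts if $\mathcal I$ is linearizable and rejects if it is not. When it accepts, it returns a vector $c'$ in reduced form (possibly with negative entries) with $C(P,c,Q)=C(P,c')$ for every $s$-$t$ path $P$; when it rejects, there is no such real vector $c'$, of whatever signs. There is an absolute constant $K$ such that the algorithm makes at most $K(p^3q^2+p^2q^3)$ steps on a random access machine on which index operations and additions, subtractions, equality tests and memory accesses for real numbers have unit cost. -/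

import Mathlib

/-! ## The quadratic shortest path problem and linearizability -/

namespace QSPP

/-- The arcs of a directed graph: pairs (tail, head). -/
def Arc {V : Type} (G : Digraph V) : Type := {e : V × V // G.Adj e.1 e.2}

/-- Tail of an arc. -/
def Arc.tail {V : Type} {G : Digraph V} (e : Arc G) : V := e.1.1

/-- Head of an arc. -/
def Arc.head {V : Type} {G : Digraph V} (e : Arc G) : V := e.1.2

noncomputable instance {V : Type} [Finite V] (G : Digraph V) : Fintype (Arc G) :=
  @Fintype.ofFinite _ (inferInstanceAs (Finite {e : V × V // G.Adj e.1 e.2}))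

/-- An `s`-`t` path: a sequence of at least two vertices without repetition, starting in `s`,
ending in `t`, in which consecutive vertices are joined by arcs. -/
structure STPath {V : Type} (G : Digraph V) (s t : V) where
  verts : List V
  two_le : 2 ≤ verts.length
  chain : verts.IsChain G.Adj
  nodup : verts.Nodup
  head_eq : verts.head? = some s
  last_eq : verts.getLast? = some t

open Classical in
/-- The set of arcs of a path. -/
noncomputable def STPath.arcs {V : Type} [Finite V] {G : Digraph V} {s t : V}
    (P : STPath G s t) : Finset (Arc G) :=
  Finset.univ.filter fun e => (e.tail, e.head) ∈ P.verts.zip P.verts.tail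

/-- The linear cost `C(P, c)` of a path. -/
noncomputable def linCost {V : Type} [Finite V] {G : Digraph V} {s t : V}
    (P : STPath G s t) (c : Arc G → ℝ) : ℝ :=
  ∑ e ∈ P.arcs, c e

/-- The quadratic cost `C(P, c, Q)` of a path. -/
noncomputable def quadCost {V : Type} [Finite V] {G : Digraph V} {s t : V}
    (P : STPath G s t) (c : Arc G → ℝ) (Q : Arc G → Arc G → ℝ) : ℝ :=
  (∑ e ∈ P.arcs, ∑ f ∈ P.arcs, Q e f) + ∑ e ∈ P.arcs, c e

/-- An instance of the quadratic shortest path problem on `G` with source `s` and target `t`: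
a nonnegative cost vector and a nonnegative symmetric interaction matrix with zero diagonal. -/
structure Inst {V : Type} (G : Digraph V) (s t : V) where
  c : Arc G → ℝ
  Q : Arc G → Arc G → ℝ
  c_nonneg : ∀ e, 0 ≤ c e
  Q_nonneg : ∀ e f, 0 ≤ Q e f
  Q_symm : ∀ e f, Q e f = Q f e
  Q_diag : ∀ e, Q e e = 0

/-- `c'` reproduces the quadratic cost of every `s`-`t` path (no condition on signs). -/
def Inst.Linearizes {V : Type} [Finite V] {G : Digraph V} {s t : V}
    (I : Inst G s t) (c' : Arc G → ℝ) : Prop :=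
  ∀ P : STPath G s t, quadCost P I.c I.Q = linCost P c'

/-- The instance is linearizable: some nonnegative `c'` reproduces all path costs. -/
def Inst.Linearizable {V : Type} [Finite V] {G : Digraph V} {s t : V}
    (I : Inst G s t) : Prop :=
  ∃ c' : Arc G → ℝ, (∀ e, 0 ≤ c' e) ∧ I.Linearizes c'

/-! ## Directed grid graphs

Rows and columns are numbered from `0`, so that the vertex `v_{i,j}` of the usual numbering is
`(i - 1, j - 1)`. -/

/-- The directed grid graph `G_{p,q}`. -/
def grid (p q : ℕ) : Digraph (Fin p × Fin q) where
  Adj u v := (u.1.val + 1 = v.1.val ∧ u.2 = v.2) ∨ (u.1 = v.1 ∧ u.2.val + 1 = v.2.val)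

/-- The upper left vertex. -/
def gridSource {p q : ℕ} (hp : 2 ≤ p) (hq : 2 ≤ q) : Fin p × Fin q :=
  (⟨0, by omega⟩, ⟨0, by omega⟩)

/-- The lower right vertex. -/
def gridTarget {p q : ℕ} (hp : 2 ≤ p) (hq : 2 ≤ q) : Fin p × Fin q :=
  (⟨p - 1, by omega⟩, ⟨q - 1, by omega⟩)

/-- Instances on `G_{p,q}`, from the upper left to the lower right vertex. -/
abbrev GridInst {p q : ℕ} (hp : 2 ≤ p) (hq : 2 ≤ q) : Type :=
  Inst (grid p q) (gridSource hp hq) (gridTarget hp hq)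

/-- `e` is the selected outgoing arc of its tail `(i, j)`: the arc to `(i, j + 1)` unless `j` is
the last column, and the arc to `(i + 1, j)` if it is. -/
def IsSelected {p q : ℕ} (e : Arc (grid p q)) : Prop :=
  if e.tail.2.val + 1 < q
  then e.head.1.val = e.tail.1.val ∧ e.head.2.val = e.tail.2.val + 1
  else e.head.1.val = e.tail.1.val + 1 ∧ e.head.2.val = e.tail.2.val

/-- A cost vector on the grid is in reduced form: it vanishes on the selected outgoing arc of
every vertex other than the source and the target. -/
def IsReduced {p q : ℕ} (hp : 2 ≤ p) (hq : 2 ≤ q) (c : Arc (grid p q) → ℝ) : Prop :=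
  ∀ e : Arc (grid p q), e.tail ≠ gridSource hp hq → e.tail ≠ gridTarget hp hq →
    IsSelected e → c e = 0

set_option linter.constructorNameAsVariable false

/-! ## A unit-cost random access machine with real numbers

Natural number registers, arrays of numbers from `R` indexed by tuples of natural numbers, and a
structured programming language. Every operation symbol, constant, register access, array access,
assignment, test and loop iteration costs one step. -/

/-- Names of the natural number registers. -/
inductive Reg
  | p | q | ok | k | i | m | j | u | v | w | x | y
  deriving DecidableEq

/-- Names of the arrays. -/
inductive Arr
  | Q | c | pcHat | cur | chain | cHat | pc | out | cost | start | tmp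
  deriving DecidableEq

/-- Index expressions. -/
inductive NExp
  | lit (n : ℕ)
  | reg (x : Reg)
  | add (a b : NExp)
  | sub (a b : NExp)

/-- Expressions for numbers from `R`. -/
inductive RExp
  | zero
  | get (A : Arr) (idx : List NExp)
  | add (a b : RExp)
  | sub (a b : RExp)

/-- Tests. -/
inductive BExp
  | lt (a b : NExp)
  | eq (a b : NExp)
  | ne (a b : RExp)

/-- Programs. `loop x n b` runs `b` for `x = 0, …, n - 1`, with `n` evaluated once, on entry. -/
inductive Stmt
  | skip
  | setN (x : Reg) (a : NExp)
  | setR (A : Arr) (idx : List NExp) (a : RExp)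
  | seq (a b : Stmt)
  | cond (t : BExp) (a b : Stmt)
  | loop (x : Reg) (n : NExp) (b : Stmt)

/-- Memory contents. -/
structure State (R : Type) where
  reg : Reg → ℕ
  arr : Arr → List ℕ → R

/-- Subtraction is truncated. -/
def NExp.eval {R : Type} (σ : State R) : NExp → ℕ
  | .lit n => n
  | .reg x => σ.reg x
  | .add a b => a.eval σ + b.eval σ
  | .sub a b => a.eval σ - b.eval σ

def NExp.steps : NExp → ℕ
  | .lit _ => 1
  | .reg _ => 1
  | .add a b => a.steps + b.steps + 1
  | .sub a b => a.steps + b.steps + 1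

def RExp.eval {R : Type} [Ring R] (σ : State R) : RExp → R
  | .zero => 0
  | .get A idx => σ.arr A (idx.map (NExp.eval σ))
  | .add a b => a.eval σ + b.eval σ
  | .sub a b => a.eval σ - b.eval σ

def RExp.steps : RExp → ℕ
  | .zero => 1
  | .get _ idx => (idx.map NExp.steps).sum + 1
  | .add a b => a.steps + b.steps + 1
  | .sub a b => a.steps + b.steps + 1

def BExp.eval {R : Type} [Ring R] [DecidableEq R] (σ : State R) : BExp → Bool
  | .lt a b => decide (a.eval σ < b.eval σ)
  | .eq a b => decide (a.eval σ = b.eval σ)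
  | .ne a b => decide (a.eval σ ≠ b.eval σ)

def BExp.steps : BExp → ℕ
  | .lt a b => a.steps + b.steps + 1
  | .eq a b => a.steps + b.steps + 1
  | .ne a b => a.steps + b.steps + 1

def State.setReg {R : Type} (σ : State R) (x : Reg) (n : ℕ) : State R :=
  { σ with reg := Function.update σ.reg x n }

def State.setArr {R : Type} (σ : State R) (A : Arr) (l : List ℕ) (r : R) : State R :=
  { σ with arr := Function.update σ.arr A (Function.update (σ.arr A) l r) }

/-- `iter f n σ` runs `f 0, …, f (n - 1)` in this order, one extra step for each of them and one
for the final test. -/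
def iter {R : Type} (f : ℕ → State R → State R × ℕ) : ℕ → State R → State R × ℕ
  | 0, σ => (σ, 1)
  | n + 1, σ =>
    let r₁ := iter f n σ
    let r₂ := f n r₁.1
    (r₂.1, r₁.2 + r₂.2 + 1)

/-- Running a program: the final memory and the number of steps. -/
def Stmt.run {R : Type} [Ring R] [DecidableEq R] : Stmt → State R → State R × ℕ
  | .skip, σ => (σ, 1)
  | .setN x a, σ => (σ.setReg x (a.eval σ), a.steps + 1)
  | .setR A idx a, σ =>
    (σ.setArr A (idx.map (NExp.eval σ)) (a.eval σ), (idx.map NExp.steps).sum + a.steps + 1)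
  | .seq a b, σ =>
    let r₁ := a.run σ
    let r₂ := b.run r₁.1
    (r₂.1, r₁.2 + r₂.2)
  | .cond t a b, σ =>
    let r := if t.eval σ then a.run σ else b.run σ
    (r.1, t.steps + r.2 + 1)
  | .loop x n b, σ =>
    let r := iter (fun k τ => b.run (τ.setReg x k)) (n.eval σ) σ
    (r.1, n.steps + r.2)

/-! ## The algorithm Linearize-grid-QSPP

The arc from `(r, s)` to `(r, s + 1)` has the index tuple `(0, r, s)` and the arc from `(r, s)` to
`(r + 1, s)` has the index tuple `(1, r, s)`. The arguments `a b` of a subroutine are the row and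
the column of the target vertex `(a, b)`; it then works on the subgrid with corners `(0, 0)` and
`(a, b)`, which contains all paths from `(0, 0)` to `(a, b)`. -/

/-- Sequential composition of a list of programs. -/
def block (l : List Stmt) : Stmt := l.foldr Stmt.seq Stmt.skip

def right (r s : NExp) : List NExp := [.lit 0, r, s]

def down (r s : NExp) : List NExp := [.lit 1, r, s]

def one : NExp := .lit 1

/-- `if t then a`. -/
def when (t : BExp) (a : Stmt) : Stmt := .cond t a .skip

/-- `A[idx] := A[idx] + a`. -/
def incr (A : Arr) (idx : List NExp) (a : RExp) : Stmt := .setR A idx (.add (.get A idx) a)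

/-- `A[idx] := A[idx] - a`. -/
def decr (A : Arr) (idx : List NExp) (a : RExp) : Stmt := .setR A idx (.sub (.get A idx) a)

/-- The entry of the interaction matrix for two arcs. -/
def qEnt (e f : List NExp) : RExp := .get .Q (e ++ f)

/-- Run `body e` for all arcs `e` of the subgrid with target `(a, b)`; the tail of `e` is
`(x, y)`. -/
def forArcs (a b : NExp) (body : List NExp → Stmt) : Stmt :=
  .seq
    (.loop .x (.add a one) (.loop .y b (body (right (.reg .x) (.reg .y)))))
    (.loop .x a (.loop .y (.add b one) (body (down (.reg .x) (.reg .y)))))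

/-- A cost vector in memory: an array, with leading indices that are held fixed. -/
structure Vec where
  name : Arr
  pre : List NExp

def Vec.at (A : Vec) (e : List NExp) : RExp := .get A.name (A.pre ++ e)

def Vec.set (A : Vec) (e : List NExp) (a : RExp) : Stmt := .setR A.name (A.pre ++ e) a

/-- `B := A` on the subgrid. -/
def copy (A B : Vec) (a b : NExp) : Stmt := forArcs a b fun e => B.set e (A.at e)

/-- Run `body e` for all arcs `e` of the path that goes from `(0, 0)` right to column `b` and then
down to row `a`; `z` is the loop register. -/
def forBase (a b : NExp) (z : Reg) (body : List NExp → Stmt) : Stmt :=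
  .seq (.loop z b (body (right (.lit 0) (.reg z)))) (.loop z a (body (down (.reg z) b)))

/-- Let `P` be the path `(0,0), …, (r,0), …, (r,j+1), (r+1,j+1), …, (r+1,b), …, (a,b)`.
Replacing `(r,j+1)` by `(r+1,j)` exchanges two arcs; update the quadratic cost, stored in `cost`,
accordingly. -/
def flip (a b r j : NExp) : Stmt :=
  let e₁ := right r j
  let e₂ := down r (.add j one)
  let f₁ := down r j
  let f₂ := right (.add r one) j
  let upd (g : List NExp) : Stmt := block
    [ .setR .tmp [] (.sub (.sub (.add (qEnt f₁ g) (qEnt f₂ g)) (qEnt e₁ g)) (qEnt e₂ g)),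
      incr .cost [] (.add (.get .tmp []) (.get .tmp [])) ]
  block
    [ incr .cost [] (.sub (.add (qEnt f₁ f₂) (qEnt f₁ f₂)) (.add (qEnt e₁ e₂) (qEnt e₁ e₂))),
      .loop .w r (upd (down (.reg .w) (.lit 0))),
      .loop .w j (upd (right r (.reg .w))),
      .loop .w (.sub b (.add j one)) (upd (right (.add r one) (.add (.add j one) (.reg .w)))),
      .loop .w (.sub a (.add r one)) (upd (down (.add (.add r one) (.reg .w)) b)) ]

/-- The pseudo-linearization vector, for zero linear costs, of the instance with target `(a, b)`:
the vector in reduced form that has the right cost on each critical path. The critical paths are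
visited in an order in which each of them arises from the previous one by exchanging two arcs. -/
def pseudoLin (A : Vec) (a b : NExp) : Stmt := block
  [ forArcs a b fun e => A.set e .zero,
    .setR .cost [] .zero,
    forBase a b .u fun e => forBase a b .v fun f => incr .cost [] (qEnt e f),
    .cond (.lt (.lit 0) b)
      (A.set (right (.lit 0) (.lit 0)) (.get .cost []))
      (A.set (down (.lit 0) (.lit 0)) (.get .cost [])),
    .loop .u a (block
      [ .setR .start [] (.get .cost []),
        .loop .x b (block
          [ .setN .v (.sub (.sub b one) (.reg .x)),
            flip a b (.reg .u) (.reg .v),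
            .cond (.eq (.add (.reg .u) (.reg .v)) (.lit 0))
              (A.set (down (.reg .u) (.reg .v)) (.get .cost []))
              (A.set (down (.reg .u) (.reg .v)) (.sub (.get .cost []) (.get .start []))) ]) ]) ]

/-- Redistribution at the vertex `(r, s)`: the cost of the selected outgoing arc becomes zero. -/
def redistribute (A : Vec) (a b r s : NExp) : Stmt := block
  [ .cond (.lt s b)
      (block
        [ .setR .tmp [] (A.at (right r s)),
          A.set (right r s) .zero,
          when (.lt r a) (A.set (down r s) (.sub (A.at (down r s)) (.get .tmp []))) ])
      (block
        [ .setR .tmp [] (A.at (down r s)),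
          A.set (down r s) .zero ]),
    when (.lt (.lit 0) r)
      (A.set (down (.sub r one) s) (.add (A.at (down (.sub r one) s)) (.get .tmp []))),
    when (.lt (.lit 0) s)
      (A.set (right r (.sub s one)) (.add (A.at (right r (.sub s one))) (.get .tmp []))) ]

/-- Replace the vector `A` on the subgrid by its reduced form: redistribution at all vertices
except the source and the target, in the order of decreasing `r + s = v`. -/
def reduce (A : Vec) (a b : NExp) : Stmt :=
  .loop .u (.sub (.add a b) one) (block
    [ .setN .v (.sub (.sub (.add a b) one) (.reg .u)),
      .loop .w (.sub (.add (.sub a (.sub a (.reg .v))) one) (.sub (.reg .v) b)) (block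
        [ .setN .x (.add (.sub (.reg .v) b) (.reg .w)),
          .setN .y (.sub (.reg .v) (.reg .x)),
          redistribute A a b (.reg .x) (.reg .y) ]) ])

/-- Let `h` be the arc from `(a, b)` to the target of an instance with zero linear costs for which
`A` is a cost vector. Compute in `B` the derived cost vector for the target `(a, b)`:
`B_e = A_e - 2 q_{h,e}`, plus `A_h` if `e` leaves the source. -/
def derive (A B : Vec) (a b : NExp) (h : List NExp) : Stmt :=
  forArcs a b fun e =>
    .cond (.eq (.add (.reg .x) (.reg .y)) (.lit 0))
      (B.set e (.add (.sub (A.at e) (.add (qEnt h e) (qEnt h e))) (A.at h)))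
      (B.set e (.sub (A.at e) (.add (qEnt h e) (qEnt h e))))

/-- Set `ok := 0` if the two vectors differ on the subgrid. -/
def compare (A B : Vec) (a b : NExp) : Stmt :=
  forArcs a b fun e => when (.ne (A.at e) (B.at e)) (.setN .ok (.lit 0))

/-- The test that no mismatch has been found so far. -/
def isOk : BExp := .eq (.reg .ok) one

/-- The pass of the outer loop for the row `i`. On entry `cur` is the vector for the target
`(i + 1, q - 1)`. First `chain[j]`, a vector for the target `(i + 1, j)`, is computed for
`j = q - 1, …, 0` along row `i + 1`; the vector for the target `(i, j)` is derived from it and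
reduced, and compared with the pseudo-linearization vector if `j < q - 1`. -/
def rowPass : Stmt :=
  let i : NExp := .reg .i
  let i' : NExp := .add i one
  let j : NExp := .reg .j
  let ql : NExp := .sub (.reg .q) one
  let chainAt (j : NExp) : Vec := ⟨.chain, [j]⟩
  let cHat : Vec := ⟨.cHat, []⟩
  let pc : Vec := ⟨.pc, []⟩
  let cur : Vec := ⟨.cur, []⟩
  block
    [ copy cur (chainAt ql) i' ql,
      .loop .m ql (block
        [ .setN .j (.sub (.sub ql one) (.reg .m)),
          derive (chainAt (.add j one)) (chainAt j) i' j (right i' j) ]),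
      .loop .j ql (when isOk (block
        [ pseudoLin pc i j,
          derive (chainAt j) cHat i j (down i j),
          reduce cHat i j,
          compare cHat pc i j ])),
      when isOk (block
        [ derive (chainAt ql) cHat i ql (down i ql),
          reduce cHat i ql,
          copy cHat cur i ql ]) ]

/-- The algorithm. It rejects if `ok = 0` at the end and accepts if `ok = 1`; the vector found is
then in `out`. All tests are made for zero linear costs; the linear costs of the instance are added
to the vector found, which is then brought to reduced form. -/
def linearizeGridQSPP : Stmt :=
  let pl : NExp := .sub (.reg .p) one
  let ql : NExp := .sub (.reg .q) one
  let pcHat : Vec := ⟨.pcHat, []⟩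
  let cur : Vec := ⟨.cur, []⟩
  let pc : Vec := ⟨.pc, []⟩
  let out : Vec := ⟨.out, []⟩
  let c : Vec := ⟨.c, []⟩
  block
    [ .setN .ok one,
      pseudoLin pcHat pl ql,
      copy pcHat cur pl ql,
      .loop .k (.sub pl one) (when isOk (.seq
        (.setN .i (.sub (.sub pl one) (.reg .k)))
        rowPass)),
      when isOk (block
        [ pseudoLin pc one ql,
          compare cur pc one ql ]),
      when isOk (block
        [ forArcs pl ql fun e => out.set e (.add (pcHat.at e) (c.at e)),
          reduce out pl ql ]) ]

/-! ## Input and output of the algorithm -/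

/-- The index tuple of an arc of the grid. -/
def code {p q : ℕ} (e : Arc (grid p q)) : List ℕ :=
  [if e.head.1 = e.tail.1 then 0 else 1, e.tail.1.val, e.tail.2.val]

/-- The memory `σ` holds the instance `I`; the memory that is not used for the input may hold
anything. -/
structure Holds {p q : ℕ} {hp : 2 ≤ p} {hq : 2 ≤ q} (σ : State ℝ) (I : GridInst hp hq) :
    Prop where
  p_eq : σ.reg .p = p
  q_eq : σ.reg .q = q
  c_eq : ∀ e, σ.arr .c (code e) = I.c e
  Q_eq : ∀ e f, σ.arr .Q (code e ++ code f) = I.Q e f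

/-- The final memory of the algorithm. -/
noncomputable def final (σ : State ℝ) : State ℝ := (linearizeGridQSPP.run σ).1

/-- The number of steps of the algorithm. -/
noncomputable def time (σ : State ℝ) : ℕ := (linearizeGridQSPP.run σ).2

/-- The algorithm answers that the instance is linearizable. -/
def Accepts (σ : State ℝ) : Prop := (final σ).reg .ok = 1

/-- The algorithm answers that the instance is not linearizable. -/
def Rejects (σ : State ℝ) : Prop := (final σ).reg .ok = 0

/-- The vector that the algorithm returns. -/
noncomputable def output (p q : ℕ) (σ : State ℝ) (e : Arc (grid p q)) : ℝ :=
  (final σ).arr .out (code e)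

end QSPP

set_option linter.constructorNameAsVariable false

namespace QSPP

/-! ## Execution without step counting -/

/-! Path costs are additive in the linear costs `c`, so only the interaction costs matter until the
last step. Rows and columns are numbered from `0`, and a vector `d` linearizes at `(a, b)` if it
reproduces the interaction cost of every path from `(0, 0)` to `(a, b)`.

Three facts carry the proof. Moving costs along a potential that vanishes at both ends keeps all
path costs, so every vector has an equivalent reduced one (`exists_reducedOn`). The entries of a
reduced vector are differences of its costs on critical paths, so a reduced linearization must be
the pseudo-linearization `plin` (`ReducedOn.eq_plin`); hence some vector linearizes if and only if
`plin` does (`LinearizesAt.plin`). Removing the last arc `h` of a path lowers its interaction cost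
by an amount linear in the rest, so `d` is correct on the paths ending with `h` exactly when the
derived vector linearizes at the tail of `h` (`der_path_iff`).

Every path to `(i + 1, b)` enters row `i + 1` in exactly one column. Therefore `d` linearizes there
if and only if, for each `j ≤ b`, the vector derived along row `i + 1` and then upwards in column
`j` linearizes at `(i, j)`. For `j < b` the algorithm only tests whether the reduced derived vector
equals `plin`. A mismatch refutes linearity. Agreement says that the derived vector is correct
provided that anything linearizes at `(i, j)`, and this proviso follows from linearity at `(i, b)`.
So after successful tests linearity at `(i + 1, b)` is equivalent to linearity at the single target
`(i, b)` (`linearizesAt_iff_row`). The descent ends in row `1`, where all paths are critical and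
`plin` is always a linearization (`linearizesAt_plin_one`); the final comparison thus decides the
question.

Signs do not matter: the costs of the instance are nonnegative, so a real linearization has
nonnegative path costs, and shortest path distances serve as a potential that makes it nonnegative
(`exists_nonneg`).

The programs are verified by loop invariants together with frame conditions. The running time is
bounded separately, by a syntactic bound that multiplies loop lengths and needs no information about
what the program computes. -/

/-- The final memory of a program. -/
noncomputable def Stmt.exec (s : Stmt) (σ : State ℝ) : State ℝ := (s.run σ).1

section StateLemmas

variable {R : Type} (σ : State R)

@[simp] theorem State.setReg_reg (x y : Reg) (n : ℕ) :
    (σ.setReg x n).reg y = if y = x then n else σ.reg y := by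
  simp [State.setReg, Function.update_apply]

@[simp] theorem State.setReg_arr (x : Reg) (n : ℕ) : (σ.setReg x n).arr = σ.arr := rfl

@[simp] theorem State.setArr_reg (A : Arr) (l : List ℕ) (r : R) :
    (σ.setArr A l r).reg = σ.reg := rfl

theorem State.setArr_arr (A B : Arr) (l m : List ℕ) (r : R) :
    (σ.setArr A l r).arr B m = if B = A ∧ m = l then r else σ.arr B m := by
  by_cases h : B = A
  · subst h; simp [State.setArr, Function.update_apply]
  · simp [State.setArr, h]

@[simp] theorem State.setArr_arr_of_ne {A B : Arr} (h : B ≠ A) (l : List ℕ) (r : R) :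
    (σ.setArr A l r).arr B = σ.arr B := by
  funext m; simp [State.setArr_arr, h]

@[simp] theorem State.setArr_arr_same (A : Arr) (l : List ℕ) (r : R) :
    (σ.setArr A l r).arr A = Function.update (σ.arr A) l r := by
  simp [State.setArr]

end StateLemmas

@[simp] theorem exec_skip (σ : State ℝ) : Stmt.skip.exec σ = σ := rfl

@[simp] theorem exec_setN (x : Reg) (a : NExp) (σ : State ℝ) :
    (Stmt.setN x a).exec σ = σ.setReg x (a.eval σ) := rfl

@[simp] theorem exec_setR (A : Arr) (idx : List NExp) (a : RExp) (σ : State ℝ) :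
    (Stmt.setR A idx a).exec σ = σ.setArr A (idx.map (NExp.eval σ)) (a.eval σ) := rfl

@[simp] theorem exec_seq (a b : Stmt) (σ : State ℝ) :
    (Stmt.seq a b).exec σ = b.exec (a.exec σ) := rfl

@[simp] theorem exec_cond (t : BExp) (a b : Stmt) (σ : State ℝ) :
    (Stmt.cond t a b).exec σ = if t.eval σ then a.exec σ else b.exec σ := by
  simp only [Stmt.exec, Stmt.run]; split <;> rfl

@[simp] theorem exec_when (t : BExp) (a : Stmt) (σ : State ℝ) :
    (when t a).exec σ = if t.eval σ then a.exec σ else σ := by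
  simp [when]

@[simp] theorem exec_block_nil (σ : State ℝ) : (block []).exec σ = σ := rfl

@[simp] theorem exec_block_cons (s : Stmt) (l : List Stmt) (σ : State ℝ) :
    (block (s :: l)).exec σ = (block l).exec (s.exec σ) := rfl

theorem iter_rule {f : ℕ → State ℝ → State ℝ × ℕ} (Inv : ℕ → State ℝ → Prop) {σ : State ℝ}
    (n : ℕ) (h0 : Inv 0 σ) (hs : ∀ k < n, ∀ τ, Inv k τ → Inv (k + 1) (f k τ).1) :
    Inv n (iter f n σ).1 := by
  induction n with
  | zero => exact h0
  | succ n ih =>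
    exact hs n (Nat.lt_succ_self n) _ (ih fun k hk => hs k (Nat.lt_succ_of_lt hk))

/-- The invariant rule for loops. -/
theorem loop_rule {x : Reg} {n : NExp} {b : Stmt} {σ : State ℝ} (Inv : ℕ → State ℝ → Prop)
    (h0 : Inv 0 σ)
    (hs : ∀ k < n.eval σ, ∀ τ, Inv k τ → Inv (k + 1) (b.exec (τ.setReg x k))) :
    Inv (n.eval σ) ((Stmt.loop x n b).exec σ) :=
  iter_rule Inv _ h0 hs

theorem loop_rule' {x : Reg} {n : NExp} {b : Stmt} {σ : State ℝ} {N : ℕ} (hN : n.eval σ = N)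
    (Inv : ℕ → State ℝ → Prop) (h0 : Inv 0 σ)
    (hs : ∀ k < N, ∀ τ, Inv k τ → Inv (k + 1) (b.exec (τ.setReg x k))) :
    Inv N ((Stmt.loop x n b).exec σ) := by
  subst hN; exact loop_rule Inv h0 hs

/-! ## A static bound for the number of steps -/

/-- An upper bound for the value of an index expression, given upper bounds of the registers. -/
def NExp.ub (env : Reg → ℕ) : NExp → ℕ
  | .lit n => n
  | .reg x => env x
  | .add a b => a.ub env + b.ub env
  | .sub a _ => a.ub env

/-- The registers that matter for `NExp.ub` have been assigned. -/
def NExp.Uses (D : Reg → Prop) : NExp → Prop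
  | .lit _ => True
  | .reg x => D x
  | .add a b => a.Uses D ∧ b.Uses D
  | .sub a _ => a.Uses D

theorem NExp.eval_le_ub {R : Type} {env : Reg → ℕ} {D : Reg → Prop} {σ : State R}
    (h : ∀ x, D x → σ.reg x ≤ env x) (a : NExp) (ha : a.Uses D) : a.eval σ ≤ a.ub env := by
  induction a with
  | lit n => exact le_rfl
  | reg x => exact h x ha
  | add a b iha ihb => exact Nat.add_le_add (iha ha.1) (ihb ha.2)
  | sub a b iha _ => exact (Nat.sub_le _ _).trans (iha ha)

/-- The registers that have been assigned after a program. -/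
def Stmt.defs (D : Reg → Prop) : Stmt → Reg → Prop
  | .setN x _ => fun y => y = x ∨ D y
  | .seq a b => b.defs (a.defs D)
  | _ => D

/-- All register assignments and loop counters respect the bounds `env`. -/
def Stmt.Bounded (env : Reg → ℕ) : (Reg → Prop) → Stmt → Prop
  | _, .skip => True
  | D, .setN x a => a.Uses D ∧ a.ub env ≤ env x
  | _, .setR _ _ _ => True
  | D, .seq a b => a.Bounded env D ∧ b.Bounded env (a.defs D)
  | D, .cond _ a b => a.Bounded env D ∧ b.Bounded env D
  | D, .loop x n b => n.Uses D ∧ n.ub env ≤ env x ∧ b.Bounded env (fun y => y = x ∨ D y)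

/-- An upper bound for the number of steps, given upper bounds of the registers. -/
def Stmt.stepBound (env : Reg → ℕ) : Stmt → ℕ
  | .skip => 1
  | .setN _ a => a.steps + 1
  | .setR _ idx a => (idx.map NExp.steps).sum + a.steps + 1
  | .seq a b => a.stepBound env + b.stepBound env
  | .cond t a b => t.steps + (a.stepBound env + b.stepBound env) + 1
  | .loop _ n b => n.steps + (n.ub env * (b.stepBound env + 1) + 1)

theorem Stmt.defs_mono (s : Stmt) {D : Reg → Prop} {x : Reg} (h : D x) : s.defs D x := by
  induction s generalizing D with
  | setN y a => exact Or.inr h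
  | seq a b iha ihb => exact ihb (iha h)
  | _ => exact h

/-- The initial memory is arbitrary, so only registers in `D`, those already assigned, carry a
bound. The two claims are proved together because the loop lengths of a later statement are bounded
through the registers left by an earlier one. -/
theorem Stmt.run_le_stepBound (env : Reg → ℕ) (s : Stmt) (D : Reg → Prop)
    (hs : s.Bounded env D) (σ : State ℝ) (h : ∀ x, D x → σ.reg x ≤ env x) :
    (∀ x, s.defs D x → (s.run σ).1.reg x ≤ env x) ∧ (s.run σ).2 ≤ s.stepBound env := by
  induction s generalizing D σ with
  | skip => exact ⟨h, le_rfl⟩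
  | setN y a =>
    refine ⟨fun x hx => ?_, le_rfl⟩
    have h1 := (NExp.eval_le_ub h a hs.1).trans hs.2
    simp only [Stmt.run, State.setReg_reg]
    split
    · next e => rw [e]; exact h1
    · next e => exact h x (hx.resolve_left e)
  | setR A idx a => exact ⟨h, le_rfl⟩
  | seq a b iha ihb =>
    obtain ⟨h1, h2⟩ := iha D hs.1 σ h
    obtain ⟨h3, h4⟩ := ihb _ hs.2 _ h1
    exact ⟨h3, Nat.add_le_add h2 h4⟩
  | cond t a b iha ihb =>
    obtain ⟨h1, h2⟩ := iha D hs.1 σ h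
    obtain ⟨h3, h4⟩ := ihb D hs.2 σ h
    simp only [Stmt.run, Stmt.stepBound]
    split
    · exact ⟨fun x hx => h1 x (a.defs_mono hx), by omega⟩
    · exact ⟨fun x hx => h3 x (b.defs_mono hx), by omega⟩
  | loop y n b ih =>
    have hn := NExp.eval_le_ub h n hs.1
    have key : ∀ N, N ≤ n.eval σ →
        (∀ x, D x → (iter (fun k τ => b.run (τ.setReg y k)) N σ).1.reg x ≤ env x) ∧
        (iter (fun k τ => b.run (τ.setReg y k)) N σ).2 ≤ N * (b.stepBound env + 1) + 1 := by
      intro N hN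
      induction N with
      | zero => exact ⟨h, by simp [iter]⟩
      | succ N ihN =>
        obtain ⟨g1, g2⟩ := ihN (by omega)
        have hy : ∀ x, (x = y ∨ D x) → ((iter (fun k τ => b.run (τ.setReg y k)) N σ).1.setReg
            y N).reg x ≤ env x := by
          intro x hx
          simp only [State.setReg_reg]
          split
          · next e => subst e; have := hs.2.1; omega
          · next e => exact g1 x (hx.resolve_left e)
        obtain ⟨g3, g4⟩ := ih _ hs.2.2 _ hy
        refine ⟨fun x hx => g3 x (b.defs_mono (Or.inr hx)), ?_⟩
        simp only [iter]
        have : (N + 1) * (b.stepBound env + 1) = N * (b.stepBound env + 1) + b.stepBound env + 1 := by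
          ring
        omega
    obtain ⟨k1, k2⟩ := key _ le_rfl
    refine ⟨k1, ?_⟩
    simp only [Stmt.run, Stmt.stepBound]
    have := Nat.mul_le_mul_right (b.stepBound env + 1) hn
    omega

/-- Bounds of the registers for the algorithm on the grid `G_{p,q}`. -/
def regBound (p q : ℕ) : Reg → ℕ
  | .p => p
  | .q => q
  | .k => p
  | .i => p
  | .m => q
  | .j => q
  | .ok => 1
  | .u => p + q
  | .v => p + q
  | .w => p + q
  | .x => 2 * (p + q)
  | .y => p + q

/-! ### The polynomial bound for the running time -/

section
set_option maxRecDepth 10000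

theorem linearizeGridQSPP_bounded {p q : ℕ} (hp : 2 ≤ p) (hq : 2 ≤ q) :
    linearizeGridQSPP.Bounded (regBound p q) (fun x => x = .p ∨ x = .q) := by
  simp [linearizeGridQSPP, rowPass, Stmt.Bounded, NExp.Uses, NExp.ub, Stmt.defs, pseudoLin, derive,
    reduce, compare, copy, forArcs, forBase, block, when, isOk, redistribute, flip, one, incr,
    Vec.set, regBound, right, down]
  omega

theorem linearizeGridQSPP_stepBound {p q : ℕ} (hp : 2 ≤ p) (hq : 2 ≤ q) :
    linearizeGridQSPP.stepBound (regBound p q) ≤ 10000 * (p ^ 3 * q ^ 2 + p ^ 2 * q ^ 3) := by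
  simp [linearizeGridQSPP, rowPass, Stmt.stepBound, NExp.ub, pseudoLin, derive,
    reduce, compare, copy, forArcs, forBase, block, when, isOk, redistribute, flip, one, incr,
    Vec.set, Vec.at, qEnt, regBound, right, down, NExp.steps, RExp.steps, BExp.steps]
  -- After the substitution `p = 2 + x`, `q = 2 + y` both sides are polynomials in `x` and `y` with
  -- natural coefficients, and lower order terms can be absorbed. The inequality then follows with
  -- the monomials treated as atoms.
  obtain ⟨x, rfl⟩ := Nat.exists_eq_add_of_le hp
  obtain ⟨y, rfl⟩ := Nat.exists_eq_add_of_le hq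
  ring_nf

  omega
end

/-! ## Paths in the quarter plane grid, as lists of arc codes -/

/-- The code of the arc from `(r, s)` to `(r, s + 1)`. -/
def rt (r s : ℕ) : List ℕ := [0, r, s]

/-- The code of the arc from `(r, s)` to `(r + 1, s)`. -/
def dn (r s : ℕ) : List ℕ := [1, r, s]

@[simp] theorem rt_inj {r s r' s' : ℕ} : rt r s = rt r' s' ↔ r = r' ∧ s = s' := by simp [rt]
@[simp] theorem dn_inj {r s r' s' : ℕ} : dn r s = dn r' s' ↔ r = r' ∧ s = s' := by simp [dn]
@[simp] theorem rt_ne_dn {r s r' s' : ℕ} : rt r s ≠ dn r' s' := by simp [rt, dn]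
@[simp] theorem dn_ne_rt {r s r' s' : ℕ} : dn r s ≠ rt r' s' := by simp [rt, dn]

/-- `GridPath a b P`: `P` lists the arcs of a monotone path from `(0, 0)` to `(a, b)`, the last
arc first. -/
inductive GridPath : ℕ → ℕ → List (List ℕ) → Prop
  | nil : GridPath 0 0 []
  | right {r s P} : GridPath r s P → GridPath r (s + 1) (rt r s :: P)
  | down {r s P} : GridPath r s P → GridPath (r + 1) s (dn r s :: P)

/-- The codes of the arcs of the subgrid with corners `(0, 0)` and `(a, b)`. -/
def InGrid (a b : ℕ) (e : List ℕ) : Prop :=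
  (∃ r s, r ≤ a ∧ s < b ∧ e = rt r s) ∨ (∃ r s, r < a ∧ s ≤ b ∧ e = dn r s)

@[simp] theorem inGrid_rt {a b r s : ℕ} : InGrid a b (rt r s) ↔ r ≤ a ∧ s < b := by
  constructor
  · rintro (⟨r', s', h1, h2, h3⟩ | ⟨r', s', h1, h2, h3⟩)
    · simp only [rt_inj] at h3; omega
    · simp at h3
  · exact fun h => Or.inl ⟨r, s, h.1, h.2, rfl⟩

@[simp] theorem inGrid_dn {a b r s : ℕ} : InGrid a b (dn r s) ↔ r < a ∧ s ≤ b := by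
  constructor
  · rintro (⟨r', s', h1, h2, h3⟩ | ⟨r', s', h1, h2, h3⟩)
    · simp at h3
    · simp only [dn_inj] at h3; omega
  · exact fun h => Or.inr ⟨r, s, h.1, h.2, rfl⟩

theorem InGrid.mono {a b a' b' : ℕ} {e : List ℕ} (ha : a ≤ a') (hb : b ≤ b')
    (h : InGrid a b e) : InGrid a' b' e := by
  obtain ⟨r, s, h1, h2, rfl⟩ | ⟨r, s, h1, h2, rfl⟩ := h
  · rw [inGrid_rt]; omega
  · rw [inGrid_dn]; omega

theorem GridPath.inGrid {a b : ℕ} {P : List (List ℕ)} (h : GridPath a b P) :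
    ∀ e ∈ P, InGrid a b e := by
  induction h with
  | nil => simp
  | right h ih =>
    rintro e he
    rcases List.mem_cons.1 he with rfl | he
    · simp
    · exact (ih e he).mono le_rfl (Nat.le_succ _)
  | down h ih =>
    rintro e he
    rcases List.mem_cons.1 he with rfl | he
    · simp
    · exact (ih e he).mono (Nat.le_succ _) le_rfl

/-- The linear cost of a list of arcs. -/
def lin (d : List ℕ → ℝ) (P : List (List ℕ)) : ℝ := (P.map d).sum

/-- The interaction cost of a list of arcs. -/
def quad (q : List ℕ → List ℕ → ℝ) (P : List (List ℕ)) : ℝ := (P.map fun e => lin (q e) P).sum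

/-- `d` reproduces the interaction costs of all paths to `(a, b)`. -/
def LinearizesAt (q : List ℕ → List ℕ → ℝ) (a b : ℕ) (d : List ℕ → ℝ) : Prop :=
  ∀ P, GridPath a b P → quad q P = lin d P

@[simp] theorem lin_nil (d : List ℕ → ℝ) : lin d [] = 0 := rfl

@[simp] theorem lin_cons (d : List ℕ → ℝ) (e : List ℕ) (P : List (List ℕ)) :
    lin d (e :: P) = d e + lin d P := by simp [lin]

@[simp] theorem lin_append (d : List ℕ → ℝ) (P P' : List (List ℕ)) :
    lin d (P ++ P') = lin d P + lin d P' := by simp [lin]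

theorem lin_congr {d d' : List ℕ → ℝ} {P : List (List ℕ)} (h : ∀ e ∈ P, d e = d' e) :
    lin d P = lin d' P := by
  unfold lin; rw [List.map_congr_left h]

theorem lin_perm {d : List ℕ → ℝ} {P P' : List (List ℕ)} (h : P.Perm P') :
    lin d P = lin d P' := (h.map d).sum_eq

theorem lin_add (d d' : List ℕ → ℝ) (P : List (List ℕ)) :
    lin (fun e => d e + d' e) P = lin d P + lin d' P := by
  simp [lin, List.sum_map_add]

theorem quad_perm {q : List ℕ → List ℕ → ℝ} {P P' : List (List ℕ)} (h : P.Perm P') :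
    quad q P = quad q P' := by
  unfold quad
  simp_rw [lin_perm h]
  exact (h.map _).sum_eq

/-- The interaction matrix is symmetric with zero diagonal. -/
structure SymmZeroDiag (q : List ℕ → List ℕ → ℝ) : Prop where
  symm : ∀ e f, q e f = q f e
  diag : ∀ e, q e e = 0

/-- Each interaction of `h` with `P` is counted in both orders, whence the factor `2`; the zero
diagonal removes the interaction of `h` with itself. -/
theorem quad_cons {q : List ℕ → List ℕ → ℝ} (hq : SymmZeroDiag q) (h : List ℕ)
    (P : List (List ℕ)) : quad q (h :: P) = quad q P + 2 * lin (q h) P := by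
  have : (P.map fun e => lin (q e) (h :: P)).sum = lin (q h) P + quad q P := by
    simp only [lin_cons, hq.symm _ h]
    rw [List.sum_map_add]; rfl
  simp only [quad, List.map_cons, List.sum_cons]
  rw [this, lin_cons, hq.diag, quad]; ring

/-! ### Potentials -/

/-- Redistribution of costs along a potential does not change path costs, up to the difference of
the potential at the ends. -/
theorem lin_potential {a b : ℕ} {d d' : List ℕ → ℝ} (π : ℕ → ℕ → ℝ)
    (hr : ∀ r s, r ≤ a → s < b → d' (rt r s) = d (rt r s) + π r (s + 1) - π r s)
    (hd : ∀ r s, r < a → s ≤ b → d' (dn r s) = d (dn r s) + π (r + 1) s - π r s)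
    {r s : ℕ} {P : List (List ℕ)} (h : GridPath r s P) (hra : r ≤ a) (hsb : s ≤ b) :
    lin d' P = lin d P + π r s - π 0 0 := by
  induction h with
  | nil => simp
  | @right r s P h ih => rw [lin_cons, lin_cons, ih hra (by omega), hr r s hra (by omega)]; ring
  | @down r s P h ih => rw [lin_cons, lin_cons, ih (by omega) hsb, hd r s (by omega) hsb]; ring

/-! ### Derived vectors -/

/-- The arc leaves the source. -/
def Leaves (e : List ℕ) : Prop := e = rt 0 0 ∨ e = dn 0 0

instance (e : List ℕ) : Decidable (Leaves e) := inferInstanceAs (Decidable (_ ∨ _))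

/-- The derived vector for the tail of the arc `h`. -/
def der (q : List ℕ → List ℕ → ℝ) (h : List ℕ) (d : List ℕ → ℝ) (e : List ℕ) : ℝ :=
  d e - 2 * q h e + if Leaves e then d h else 0

/-- A nonempty path uses exactly one arc out of the source. A constant can therefore be charged to
all paths by putting it on these arcs. -/
theorem lin_leaves {r s : ℕ} {P : List (List ℕ)} (h : GridPath r s P) (c : ℝ) :
    lin (fun e => if Leaves e then c else 0) P = if r + s = 0 then 0 else c := by
  induction h with
  | nil => simp
  | @right r s P h ih =>
    rw [lin_cons, ih]
    by_cases h0 : r + s = 0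
    · obtain ⟨rfl, rfl⟩ : r = 0 ∧ s = 0 := by omega
      simp [Leaves]
    · have : ¬ Leaves (rt r s) := by simp [Leaves]; omega
      rw [if_neg this, if_neg h0, if_neg (by omega), zero_add]
  | @down r s P h ih =>
    rw [lin_cons, ih]
    by_cases h0 : r + s = 0
    · obtain ⟨rfl, rfl⟩ : r = 0 ∧ s = 0 := by omega
      simp [Leaves]
    · have : ¬ Leaves (dn r s) := by simp [Leaves]; omega
      rw [if_neg this, if_neg h0, if_neg (by omega), zero_add]

theorem lin_der (q : List ℕ → List ℕ → ℝ) (h : List ℕ) (d : List ℕ → ℝ) {r s : ℕ}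
    {P : List (List ℕ)} (hP : GridPath r s P) (h0 : 0 < r + s) :
    lin (der q h d) P = lin d P - 2 * lin (q h) P + d h := by
  have h1 := lin_leaves hP (d h)
  rw [if_neg (by omega)] at h1
  rw [← h1]
  have h2 : lin (fun e => d e - 2 * q h e) P = lin d P - 2 * lin (q h) P := by
    clear h1 hP
    induction P with
    | nil => simp
    | cons e P ih => simp only [lin_cons, ih]; ring
  rw [← h2, ← lin_add]; rfl

/-- The derived vector is made for this: it subtracts the interactions with `h` and charges the
fixed cost `d h` at the source. The tail must differ from the source, since the empty path would
miss that charge. -/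
theorem der_path_iff {q : List ℕ → List ℕ → ℝ} (hq : SymmZeroDiag q) (h : List ℕ)
    (d : List ℕ → ℝ) {r s : ℕ} {P : List (List ℕ)} (hP : GridPath r s P) (h0 : 0 < r + s) :
    quad q (h :: P) = lin d (h :: P) ↔ quad q P = lin (der q h d) P := by
  rw [lin_der q h d hP h0, quad_cons hq, lin_cons]
  constructor <;> intro H <;> linarith

theorem LinearizesAt.der_down {q : List ℕ → List ℕ → ℝ} (hq : SymmZeroDiag q) {a b : ℕ}
    {d : List ℕ → ℝ} (h : LinearizesAt q (a + 1) b d) (h0 : 0 < a + b) :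
    LinearizesAt q a b (der q (dn a b) d) := fun _ hP =>
  (der_path_iff hq _ _ hP h0).1 (h _ hP.down)

theorem LinearizesAt.der_right {q : List ℕ → List ℕ → ℝ} (hq : SymmZeroDiag q) {a b : ℕ}
    {d : List ℕ → ℝ} (h : LinearizesAt q a (b + 1) d) (h0 : 0 < a + b) :
    LinearizesAt q a b (der q (rt a b) d) := fun _ hP =>
  (der_path_iff hq _ _ hP h0).1 (h _ hP.right)

/-- A path to `(a + 1, b + 1)` ends with one of two arcs, and each derived vector settles the paths
with one of these endings. -/
theorem LinearizesAt.of_der {q : List ℕ → List ℕ → ℝ} (hq : SymmZeroDiag q) {a b : ℕ}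
    {d : List ℕ → ℝ} (ha : 0 < a) (h1 : LinearizesAt q a (b + 1) (der q (dn a (b + 1)) d))
    (h2 : LinearizesAt q (a + 1) b (der q (rt (a + 1) b) d)) :
    LinearizesAt q (a + 1) (b + 1) d := by
  intro P hP
  cases hP with
  | right hP => exact (der_path_iff hq _ _ hP (by omega)).2 (h2 _ hP)
  | down hP => exact (der_path_iff hq _ _ hP (by omega)).2 (h1 _ hP)

theorem LinearizesAt.of_der_zero {q : List ℕ → List ℕ → ℝ} (hq : SymmZeroDiag q) {a : ℕ}
    {d : List ℕ → ℝ} (ha : 0 < a) (h1 : LinearizesAt q a 0 (der q (dn a 0) d)) :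
    LinearizesAt q (a + 1) 0 d := by
  intro P hP
  cases hP with
  | down hP => exact (der_path_iff hq _ _ hP (by omega)).2 (h1 _ hP)

theorem LinearizesAt.congr {q : List ℕ → List ℕ → ℝ} {a b : ℕ} {d d' : List ℕ → ℝ}
    (h : LinearizesAt q a b d) (hd : ∀ e, InGrid a b e → d e = d' e) : LinearizesAt q a b d' :=
  fun P hP => (h P hP).trans (lin_congr fun e he => hd e (hP.inGrid e he))

/-! ### Critical paths and the pseudo-linearization -/

/-- The critical path down to row `r`, right to column `j`, down to row `r + 1`, right to column
`b`, down to row `a`. For `j = b` it depends only on the row `r`. -/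
def crit (a b r j : ℕ) : List (List ℕ) :=
  ((List.range r).map fun w => dn w 0) ++ ((List.range j).map fun w => rt r w) ++ [dn r j] ++
    ((List.range (b - j)).map fun w => rt (r + 1) (j + w)) ++
    ((List.range (a - (r + 1))).map fun w => dn (r + 1 + w) b)

theorem GridPath.downs {r s : ℕ} {P : List (List ℕ)} (h : GridPath r s P) (n : ℕ) :
    GridPath (r + n) s ((((List.range n).map fun w => dn (r + w) s)).reverse ++ P) := by
  induction n with
  | zero => simpa using h
  | succ n ih => rw [List.range_succ]; simpa [← Nat.add_assoc] using ih.down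

theorem GridPath.rights {r s : ℕ} {P : List (List ℕ)} (h : GridPath r s P) (n : ℕ) :
    GridPath r (s + n) ((((List.range n).map fun w => rt r (s + w))).reverse ++ P) := by
  induction n with
  | zero => simpa using h
  | succ n ih => rw [List.range_succ]; simpa [← Nat.add_assoc] using ih.right

theorem gridPath_crit {a b r j : ℕ} (hr : r < a) (hj : j ≤ b) :
    GridPath a b (crit a b r j).reverse := by
  have h := ((((GridPath.nil.downs r).rights j).down).rights (b - j)).downs (a - (r + 1))
  have e1 : 0 + r + 1 + (a - (r + 1)) = a := by omega
  have e2 : 0 + j + (b - j) = b := by omega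
  rw [e1, e2] at h
  simpa [crit] using h

theorem LinearizesAt.crit {q : List ℕ → List ℕ → ℝ} {a b : ℕ} {d : List ℕ → ℝ}
    (h : LinearizesAt q a b d) {r j : ℕ} (hr : r < a) (hj : j ≤ b) :
    quad q (crit a b r j) = lin d (crit a b r j) := by
  have := h _ (gridPath_crit hr hj)
  rwa [quad_perm (List.reverse_perm _), lin_perm (List.reverse_perm _)] at this

/-- The last critical path visited for row `r` is the first one for row `r + 1`, so a running cost
can be carried over from row to row. -/
theorem crit_zero {a b r : ℕ} (hr : r + 1 < a) : crit a b r 0 = crit a b (r + 1) b := by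
  have h1 : a - (r + 1) = (a - (r + 2)) + 1 := by omega
  simp only [crit, h1, List.range_succ_eq_map (n := a - (r + 2)), List.range_succ (n := r)]
  simp [Function.comp_def, Nat.add_comm, Nat.add_left_comm]

/-- Reduced form on the subgrid with target `(a, b)`. -/
def ReducedOn (a b : ℕ) (d : List ℕ → ℝ) : Prop :=
  ∀ r s, r ≤ a → s ≤ b → 0 < r + s →
    (s < b → d (rt r s) = 0) ∧ (s = b → r < a → d (dn r s) = 0)

/-- The pseudo-linearization vector in closed form. -/
noncomputable def plin (q : List ℕ → List ℕ → ℝ) (a b : ℕ) : List ℕ → ℝ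
  | [0, r, s] => if r + s = 0 then quad q (crit a b 0 b) else 0
  | [1, r, s] => if s < b ∨ r + s = 0 then
      (if r + s = 0 then quad q (crit a b r s) else quad q (crit a b r s) - quad q (crit a b r b))
      else 0
  | _ => 0

theorem plin_rt (q : List ℕ → List ℕ → ℝ) (a b r s : ℕ) :
    plin q a b (rt r s) = if r + s = 0 then quad q (crit a b 0 b) else 0 := rfl

theorem plin_dn (q : List ℕ → List ℕ → ℝ) (a b r s : ℕ) :
    plin q a b (dn r s) = if s < b ∨ r + s = 0 then
      (if r + s = 0 then quad q (crit a b r s) else quad q (crit a b r s) - quad q (crit a b r b))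
      else 0 := rfl

theorem reducedOn_plin (q : List ℕ → List ℕ → ℝ) (a b : ℕ) : ReducedOn a b (plin q a b) := by
  intro r s _ _ h0
  rw [plin_rt, plin_dn]
  refine ⟨fun _ => if_neg (by omega), fun _ _ => if_neg (by omega)⟩

theorem lin_map_eq_zero {d : List ℕ → ℝ} {n : ℕ} {f : ℕ → List ℕ} (h : ∀ w < n, d (f w) = 0) :
    lin d ((List.range n).map f) = 0 := by
  unfold lin
  apply List.sum_eq_zero
  simp only [List.map_map, List.mem_map, List.mem_range, Function.comp]
  rintro x ⟨w, hw, rfl⟩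
  exact h w hw

/-- The cost of a critical path for a vector in reduced form. -/
theorem ReducedOn.lin_crit {a b : ℕ} {d : List ℕ → ℝ} (h : ReducedOn a b d) {r j : ℕ}
    (hr : r < a) (hj : j ≤ b) :
    lin d (crit a b r j) = lin d ((List.range r).map fun w => dn w 0) +
      (if r = 0 ∧ 0 < j then d (rt 0 0) else 0) + d (dn r j) := by
  have h1 : lin d ((List.range j).map fun w => rt r w) =
      if r = 0 ∧ 0 < j then d (rt 0 0) else 0 := by
    split
    · next H =>
      obtain ⟨rfl, H⟩ := H
      obtain ⟨j, rfl⟩ : ∃ j', j = j' + 1 := ⟨j - 1, by omega⟩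
      rw [List.range_succ_eq_map, List.map_cons, lin_cons, List.map_map, lin_map_eq_zero, add_zero]
      intro w hw
      exact (h 0 (w + 1) (by omega) (by omega) (by omega)).1 (by omega)
    · next H =>
      exact lin_map_eq_zero fun w hw => (h r w (by omega) (by omega) (by omega)).1 (by omega)
  have h2 : lin d ((List.range (b - j)).map fun w => rt (r + 1) (j + w)) = 0 :=
    lin_map_eq_zero fun w hw => (h _ _ (by omega) (by omega) (by omega)).1 (by omega)
  have h3 : lin d ((List.range (a - (r + 1))).map fun w => dn (r + 1 + w) b) = 0 :=
    lin_map_eq_zero fun w hw => (h _ _ (by omega) (by omega) (by omega)).2 rfl (by omega)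
  simp only [crit, lin_append, h1, h2, h3, lin_cons, lin_nil]
  ring

/-- A linearization in reduced form is the pseudo-linearization. -/
theorem ReducedOn.eq_plin {q : List ℕ → List ℕ → ℝ} {a b : ℕ} {d : List ℕ → ℝ} (ha : 0 < a)
    (h : ReducedOn a b d) (hl : LinearizesAt q a b d) {e : List ℕ} (he : InGrid a b e) :
    d e = plin q a b e := by
  -- On a critical path a reduced vector can be nonzero only in column `0`, on the first horizontal
  -- arc, and on the arc `dn r j`.
  have key : ∀ r j, r < a → j ≤ b → quad q (crit a b r j) = _ := fun r j hr hj =>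
    (hl.crit hr hj).trans (h.lin_crit hr hj)
  obtain ⟨r, s, h1, h2, rfl⟩ | ⟨r, s, h1, h2, rfl⟩ := he
  · rw [plin_rt]
    split
    · next h0 =>
      obtain ⟨rfl, rfl⟩ : r = 0 ∧ s = 0 := by omega
      rw [key 0 b ha le_rfl, (h 0 b (by omega) le_rfl (by omega)).2 rfl ha]
      simp [h2]
    · next h0 => exact (h r s h1 h2.le (by omega)).1 h2
  · rw [plin_dn]
    split
    · next hs =>
      split
      · next h0 =>
        obtain ⟨rfl, rfl⟩ : r = 0 ∧ s = 0 := by omega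
        rw [key 0 0 h1 h2]; simp
      · next h0 =>
        -- The contributions of column `0` and of the first horizontal arc cancel in the difference
        -- for the columns `s` and `b`, and `dn r b` costs nothing.
        rw [key r s h1 h2, key r b h1 le_rfl, (h r b (by omega) le_rfl (by omega)).2 rfl h1]
        by_cases hr : r = 0
        · have h3 : 0 < s := by omega
          have h4 : 0 < b := by omega
          simp [hr, h3, h4]
        · simp [hr]
    · next hs => exact (h r s h1.le h2 (by omega)).2 (by omega) h1

/-- For targets in row `1` all paths are critical. -/
theorem gridPath_zero {b : ℕ} {P : List (List ℕ)} (h : GridPath 0 b P) :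
    P.reverse = (List.range b).map fun w => rt 0 w := by
  generalize ha : 0 = a at h
  induction h with
  | nil => rfl
  | right h ih => subst ha; rw [List.range_succ]; simp [ih rfl]
  | down h ih => omega

/-- Here `j` is the column of the only downward arc: a last arc to the right prolongs the run in row
`1`, and a last arc down closes a run in row `0`. -/
theorem gridPath_one {b : ℕ} {P : List (List ℕ)} (h : GridPath 1 b P) :
    ∃ j ≤ b, P.reverse = crit 1 b 0 j := by
  generalize ha : 1 = a at h
  induction h with
  | nil => omega
  | @right r s P h ih =>
    subst ha
    obtain ⟨j, hj, hP⟩ := ih rfl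
    refine ⟨j, by omega, ?_⟩
    have h1 : s + 1 - j = (s - j) + 1 := by omega
    have h2 : j + (s - j) = s := by omega
    simp [hP, crit, h1, List.range_succ, h2]
  | @down r s P h ih =>
    obtain rfl : r = 0 := by omega
    refine ⟨s, le_rfl, ?_⟩
    simp [gridPath_zero h, crit]

/-- This is the base of the descent. No assumption on `q` is needed, because `plin` is right on
critical paths by construction and there are no other paths. -/
theorem linearizesAt_plin_one (q : List ℕ → List ℕ → ℝ) {b : ℕ} :
    LinearizesAt q 1 b (plin q 1 b) := by
  intro P hP
  obtain ⟨j, hj, h⟩ := gridPath_one hP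
  rw [← quad_perm (List.reverse_perm P), ← lin_perm (List.reverse_perm P), h,
    (reducedOn_plin q 1 b).lin_crit one_pos hj, plin_rt, plin_dn]
  by_cases h0 : j = 0
  · simp [h0]
  · by_cases h1 : j = b
    · simp [h1, show b ≠ 0 by omega, show 0 < b by omega]
    · simp [show j < b by omega, h0, show 0 < j by omega]

theorem rt_fold (r s : ℕ) : [0, r, s] = rt r s := rfl

theorem dn_fold (r s : ℕ) : [1, r, s] = dn r s := rfl

/-! ## Frames -/

/-- The two memories differ at most in the registers `rs` and the arrays `As`. -/
def Frame (rs : List Reg) (As : List Arr) (σ τ : State ℝ) : Prop :=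
  (∀ z, z ∉ rs → τ.reg z = σ.reg z) ∧ ∀ A, A ∉ As → τ.arr A = σ.arr A

theorem Frame.refl (rs : List Reg) (As : List Arr) (σ : State ℝ) : Frame rs As σ σ :=
  ⟨fun _ _ => rfl, fun _ _ => rfl⟩

theorem Frame.trans {rs : List Reg} {As : List Arr} {σ τ ρ : State ℝ} (h : Frame rs As σ τ)
    (h' : Frame rs As τ ρ) : Frame rs As σ ρ :=
  ⟨fun z hz => (h'.1 z hz).trans (h.1 z hz), fun A hA => (h'.2 A hA).trans (h.2 A hA)⟩

theorem Frame.mono {rs rs' : List Reg} {As As' : List Arr} {σ τ : State ℝ}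
    (h : Frame rs As σ τ) (hr : rs ⊆ rs') (hA : As ⊆ As') : Frame rs' As' σ τ :=
  ⟨fun z hz => h.1 z fun h => hz (hr h), fun A h' => h.2 A fun h => h' (hA h)⟩

theorem Frame.setReg {rs : List Reg} (As : List Arr) (σ : State ℝ) {z : Reg} (hz : z ∈ rs)
    (n : ℕ) : Frame rs As σ (σ.setReg z n) := by
  refine ⟨fun y hy => ?_, fun _ _ => rfl⟩
  have : y ≠ z := by rintro rfl; exact hy hz
  simp [this]

theorem Frame.setArr (rs : List Reg) {As : List Arr} (σ : State ℝ) {A : Arr} (hA : A ∈ As)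
    (l : List ℕ) (r : ℝ) : Frame rs As σ (σ.setArr A l r) := by
  refine ⟨fun _ _ => rfl, fun B hB => ?_⟩
  have : B ≠ A := by rintro rfl; exact hB hA
  simp [this]

/-- The registers written by the subroutines that work on one vector. -/
def scratch : List Reg := [.u, .v, .w, .x, .y]

/-- The expression has the value `n` in all memories that differ from `σ` in scratch registers,
in `ok` and in arrays only. -/
def Fixed (a : NExp) (σ : State ℝ) (n : ℕ) : Prop :=
  ∀ τ : State ℝ, (∀ z, z ∉ Reg.ok :: scratch → τ.reg z = σ.reg z) → a.eval τ = n

theorem Fixed.eval {a : NExp} {σ τ : State ℝ} {n : ℕ} (h : Fixed a σ n) {rs : List Reg}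
    {As : List Arr} (hf : Frame rs As σ τ) (hr : rs ⊆ Reg.ok :: scratch := by simp [scratch]) :
    a.eval τ = n :=
  h τ fun z hz => hf.1 z fun h => hz (hr h)

theorem Fixed.frame {a : NExp} {σ τ : State ℝ} {n : ℕ} (h : Fixed a σ n) {rs : List Reg}
    {As : List Arr} (hf : Frame rs As σ τ) (hr : rs ⊆ Reg.ok :: scratch := by simp [scratch]) :
    Fixed a τ n :=
  fun ρ hρ => h ρ fun z hz => (hρ z hz).trans (hf.1 z fun h => hz (hr h))

/-! ## Loops over the arcs of a subgrid -/

/-- The invariant depends only on the set of arcs already visited, which hides the two nested loops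
from all applications. The body has to preserve `x`, which the inner loop does not set again. -/
theorem forArcs_rule {a b : NExp} {body : List NExp → Stmt} {σ : State ℝ} {α β : ℕ}
    (Inv : Set (List ℕ) → State ℝ → Prop)
    (ha : ∀ S τ, Inv S τ → a.eval τ = α) (hb : ∀ S τ, Inv S τ → b.eval τ = β)
    (hx : ∀ S τ k, Inv S τ → Inv S (τ.setReg .x k))
    (hy : ∀ S τ k, Inv S τ → Inv S (τ.setReg .y k))
    (h0 : Inv ∅ σ)
    (hstep : ∀ S τ d, Inv S τ → S ⊆ {e | InGrid α β e} →
      InGrid α β [d, τ.reg .x, τ.reg .y] →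
      Inv (insert [d, τ.reg .x, τ.reg .y] S) ((body [.lit d, .reg .x, .reg .y]).exec τ) ∧
      ((body [.lit d, .reg .x, .reg .y]).exec τ).reg .x = τ.reg .x) :
    Inv {e | InGrid α β e} ((forArcs a b body).exec σ) := by
  have hsub : ∀ {S : Set (List ℕ)}, (∀ e ∈ S, InGrid α β e) → S ⊆ {e | InGrid α β e} :=
    fun h => h
  rw [forArcs, exec_seq]
  set σ₁ := (Stmt.loop .x (.add a one) (.loop .y b (body (right (.reg .x) (.reg .y))))).exec σ
    with hσ₁
  have H1 : Inv {e | ∃ r s, r < α + 1 ∧ s < β ∧ e = rt r s} σ₁ := by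
    refine loop_rule' (N := α + 1) (by simp [NExp.eval, one, ha _ _ h0])
      (fun k τ => Inv {e | ∃ r s, r < k ∧ s < β ∧ e = rt r s} τ) ?_ ?_
    · convert h0 using 1; ext e; simp
    · intro k hk τ hτ
      have hτ' := hx _ _ k hτ
      have := loop_rule' (x := .y) (b := body (right (.reg .x) (.reg .y))) (hb _ _ hτ')
        (fun m τ => Inv ({e | ∃ r s, r < k ∧ s < β ∧ e = rt r s} ∪
          {e | ∃ s, s < m ∧ e = rt k s}) τ ∧ τ.reg .x = k) (σ := τ.setReg .x k) ?_ ?_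
      · convert this.1 using 1
        ext e
        simp only [Set.mem_union, Set.mem_ofPred_eq]
        constructor
        · rintro ⟨r, s, h1, h2, rfl⟩
          by_cases h : r = k
          · subst h; exact Or.inr ⟨s, h2, rfl⟩
          · exact Or.inl ⟨r, s, by omega, h2, rfl⟩
        · rintro (⟨r, s, h1, h2, rfl⟩ | ⟨s, h2, rfl⟩)
          · exact ⟨r, s, by omega, h2, rfl⟩
          · exact ⟨k, s, by omega, h2, rfl⟩
      · refine ⟨?_, by simp⟩
        convert hτ' using 1; ext e; simp
      · rintro m hm ρ ⟨hρ, hρx⟩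
        have hxy : ((ρ.setReg .y m).reg .x) = k := by simp [hρx]
        have hyy : ((ρ.setReg .y m).reg .y) = m := by simp
        have := hstep _ (ρ.setReg .y m) 0 (hy _ _ m hρ) (hsub (by
          rintro e (⟨r, s, h1, h2, rfl⟩ | ⟨s, h2, rfl⟩)
          · rw [inGrid_rt]; omega
          · rw [inGrid_rt]; omega)) (by
            rw [hxy, hyy]; exact inGrid_rt.2 (by omega))
        rw [hxy, hyy] at this
        refine ⟨cast (congrArg (fun S => Inv S _) (Eq.symm ?_)) this.1, this.2⟩
        ext e
        simp only [Set.mem_union, Set.mem_ofPred_eq, Set.mem_insert_iff]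
        constructor
        · rintro (h | ⟨s, h2, rfl⟩)
          · exact Or.inr (Or.inl h)
          · by_cases h : s = m
            · subst h; exact Or.inl rfl
            · exact Or.inr (Or.inr ⟨s, by omega, rfl⟩)
        · rintro (rfl | h | ⟨s, h2, rfl⟩)
          · exact Or.inr ⟨m, by omega, rfl⟩
          · exact Or.inl h
          · exact Or.inr ⟨s, by omega, rfl⟩
  clear_value σ₁
  have H2 := loop_rule' (x := .x) (b := .loop .y (.add b one) (body (down (.reg .x) (.reg .y))))
    (ha _ _ H1) (fun k τ => Inv ({e | ∃ r s, r < α + 1 ∧ s < β ∧ e = rt r s} ∪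
      {e | ∃ r s, r < k ∧ s < β + 1 ∧ e = dn r s}) τ) ?_ ?_
  · convert H2 using 1
    ext e
    simp only [InGrid, Nat.lt_succ_iff, Set.mem_union, Set.mem_ofPred_eq]
  · convert H1 using 1; ext e; simp
  · intro k hk τ hτ
    have hτ' := hx _ _ k hτ
    have := loop_rule' (x := .y) (n := .add b one) (b := body (down (.reg .x) (.reg .y)))
      (N := β + 1) (by simp [NExp.eval, one, hb _ _ hτ'])
      (fun m τ => Inv ({e | ∃ r s, r < α + 1 ∧ s < β ∧ e = rt r s} ∪
      {e | ∃ r s, r < k ∧ s < β + 1 ∧ e = dn r s} ∪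
        {e | ∃ s, s < m ∧ e = dn k s}) τ ∧ τ.reg .x = k) (σ := τ.setReg .x k) ?_ ?_
    · convert this.1 using 1
      ext e
      simp only [Set.mem_union, Set.mem_ofPred_eq]
      constructor
      · rintro (h | ⟨r, s, h1, h2, rfl⟩)
        · exact Or.inl (Or.inl h)
        · by_cases h : r = k
          · subst h; exact Or.inr ⟨s, h2, rfl⟩
          · exact Or.inl (Or.inr ⟨r, s, by omega, h2, rfl⟩)
      · rintro ((h | ⟨r, s, h1, h2, rfl⟩) | ⟨s, h2, rfl⟩)
        · exact Or.inl h
        · exact Or.inr ⟨r, s, by omega, h2, rfl⟩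
        · exact Or.inr ⟨k, s, by omega, h2, rfl⟩
    · refine ⟨?_, by simp⟩
      convert hτ' using 1; ext e; simp
    · rintro m hm ρ ⟨hρ, hρx⟩
      have hxy : ((ρ.setReg .y m).reg .x) = k := by simp [hρx]
      have hyy : ((ρ.setReg .y m).reg .y) = m := by simp
      have := hstep _ (ρ.setReg .y m) 1 (hy _ _ m hρ) (hsub (by
        rintro e ((⟨r, s, h1, h2, rfl⟩ | ⟨r, s, h1, h2, rfl⟩) | ⟨s, h2, rfl⟩)
        · rw [inGrid_rt]; omega
        · rw [inGrid_dn]; omega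
        · rw [inGrid_dn]; omega)) (by
          rw [hxy, hyy]; exact inGrid_dn.2 (by omega))
      rw [hxy, hyy] at this
      refine ⟨cast (congrArg (fun S => Inv S _) (Eq.symm ?_)) this.1, this.2⟩
      ext e
      simp only [Set.mem_union, Set.mem_ofPred_eq, Set.mem_insert_iff]
      constructor
      · rintro (h | ⟨s, h2, rfl⟩)
        · exact Or.inr (Or.inl h)
        · by_cases h : s = m
          · subst h; exact Or.inl rfl
          · exact Or.inr (Or.inr ⟨s, by omega, rfl⟩)
      · rintro (rfl | h | ⟨s, h2, rfl⟩)
        · exact Or.inr ⟨m, by omega, rfl⟩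
        · exact Or.inl h
        · exact Or.inr ⟨s, by omega, rfl⟩

/-- A loop over the arcs of a subgrid that sets one entry for each arc. -/
theorem forArcs_map {a b : NExp} {body : List NExp → Stmt} {σ : State ℝ} {α β : ℕ}
    (ha : Fixed a σ α) (hb : Fixed b σ β) (N : Arr) (pre : List ℕ) (g : List ℕ → ℝ)
    (hbody : ∀ τ d, Frame [.x, .y] [N] σ τ →
      (∀ l, (∀ e, InGrid α β e → l ≠ pre ++ e) → τ.arr N l = σ.arr N l) →
      InGrid α β [d, τ.reg .x, τ.reg .y] →
      (body [.lit d, .reg .x, .reg .y]).exec τ =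
        τ.setArr N (pre ++ [d, τ.reg .x, τ.reg .y]) (g [d, τ.reg .x, τ.reg .y])) :
    Frame [.x, .y] [N] σ ((forArcs a b body).exec σ) ∧
    (∀ l, (∀ e, InGrid α β e → l ≠ pre ++ e) →
      ((forArcs a b body).exec σ).arr N l = σ.arr N l) ∧
    ∀ e, InGrid α β e → ((forArcs a b body).exec σ).arr N (pre ++ e) = g e := by
  refine forArcs_rule (α := α) (β := β) (fun S τ => Frame [.x, .y] [N] σ τ ∧
    (∀ l, (∀ e, InGrid α β e → l ≠ pre ++ e) → τ.arr N l = σ.arr N l) ∧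
    ∀ e ∈ S, τ.arr N (pre ++ e) = g e) ?_ ?_ ?_ ?_ ?_ ?_
  · exact fun S τ h => ha.eval h.1
  · exact fun S τ h => hb.eval h.1
  · exact fun S τ k h => ⟨h.1.trans (Frame.setReg _ _ (by simp) _), h.2⟩
  · exact fun S τ k h => ⟨h.1.trans (Frame.setReg _ _ (by simp) _), h.2⟩
  · exact ⟨Frame.refl _ _ _, fun _ _ => rfl, by simp⟩
  · rintro S τ d ⟨h1, h2, h3⟩ _ hd
    rw [hbody τ d h1 h2 hd]
    refine ⟨⟨h1.trans (Frame.setArr _ _ (by simp) _ _), fun l hl => ?_, fun e he => ?_⟩, rfl⟩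
    · rw [State.setArr_arr, if_neg (fun h => hl _ hd h.2), h2 l hl]
    · rw [State.setArr_arr]
      rcases Set.mem_insert_iff.1 he with rfl | he
      · simp
      · split
        · next h => rw [List.append_cancel_left h.2]
        · exact h3 e he

/-- The vector stored in an array. -/
theorem exec_copy {A B : Vec} {a b : NExp} {σ : State ℝ} {α β : ℕ}
    (ha : Fixed a σ α) (hb : Fixed b σ β) (hAB : A.name ≠ B.name) {preA preB : List ℕ}
    (hA : ∀ τ, Frame [.x, .y] [B.name] σ τ → A.pre.map (NExp.eval τ) = preA)
    (hB : ∀ τ, Frame [.x, .y] [B.name] σ τ → B.pre.map (NExp.eval τ) = preB) :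
    Frame [.x, .y] [B.name] σ ((copy A B a b).exec σ) ∧
    ∀ e, InGrid α β e →
      ((copy A B a b).exec σ).arr B.name (preB ++ e) = σ.arr A.name (preA ++ e) := by
  have := forArcs_map ha hb B.name preB (fun e => σ.arr A.name (preA ++ e))
    (body := fun e => B.set e (A.at e)) ?_
  · exact ⟨this.1, this.2.2⟩
  · intro τ d h1 h2 hd
    have h3 := h1.2 A.name (by simpa using hAB)
    simp [Vec.set, Vec.at, hA τ h1, hB τ h1, RExp.eval, NExp.eval, h3]

/-- The interaction matrix in memory is `q` for the arcs of the grid with target `(a, b)`. -/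
def HoldsQ (q : List ℕ → List ℕ → ℝ) (a b : ℕ) (σ : State ℝ) : Prop :=
  ∀ e f, InGrid a b e → InGrid a b f → σ.arr .Q (e ++ f) = q e f

theorem HoldsQ.frame {q : List ℕ → List ℕ → ℝ} {a b : ℕ} {σ τ : State ℝ} (h : HoldsQ q a b σ)
    {rs : List Reg} {As : List Arr} (hf : Frame rs As σ τ) (hA : Arr.Q ∉ As) :
    HoldsQ q a b τ := fun e f he hf' => by rw [hf.2 _ hA]; exact h e f he hf'

theorem leaves_iff {α β d x y : ℕ} (h : InGrid α β [d, x, y]) :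
    Leaves [d, x, y] ↔ x + y = 0 := by
  obtain ⟨r, s, _, _, h⟩ | ⟨r, s, _, _, h⟩ := h
  · simp only [rt, List.cons.injEq, and_true] at h
    obtain ⟨rfl, rfl, rfl⟩ := h
    simp [Leaves, rt, dn]
  · simp only [dn, List.cons.injEq, and_true] at h
    obtain ⟨rfl, rfl, rfl⟩ := h
    simp [Leaves, rt, dn]

/-- Source and result may lie in the same array, as for consecutive columns of `chain`; then their
prefixes must be incompatible, so that no entry is overwritten before it is read. The second
conclusion protects the vectors stored under other prefixes. -/
theorem exec_derive {A B : Vec} {a b : NExp} {h : List NExp} {σ : State ℝ} {α β a' b' : ℕ}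
    {q : List ℕ → List ℕ → ℝ} (hQ : HoldsQ q a' b' σ) (hBQ : B.name ≠ .Q)
    (ha : Fixed a σ α) (hb : Fixed b σ β) (hα : α ≤ a') (hβ : β ≤ b') {preA preB hc : List ℕ}
    (hA : ∀ τ, Frame [.x, .y] [B.name] σ τ → A.pre.map (NExp.eval τ) = preA)
    (hB : ∀ τ, Frame [.x, .y] [B.name] σ τ → B.pre.map (NExp.eval τ) = preB)
    (hh : ∀ τ, Frame [.x, .y] [B.name] σ τ → h.map (NExp.eval τ) = hc)
    (hhc : InGrid a' b' hc)
    (hAB : A.name ≠ B.name ∨ ∀ e e', preA ++ e ≠ preB ++ e') :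
    Frame [.x, .y] [B.name] σ ((derive A B a b h).exec σ) ∧
    (∀ l, (∀ e, l ≠ preB ++ e) →
      ((derive A B a b h).exec σ).arr B.name l = σ.arr B.name l) ∧
    ∀ e, InGrid α β e → ((derive A B a b h).exec σ).arr B.name (preB ++ e) =
      der q hc (fun e => σ.arr A.name (preA ++ e)) e := by
  have := forArcs_map ha hb B.name preB (der q hc (fun e => σ.arr A.name (preA ++ e)))
    (body := fun e => .cond (.eq (.add (.reg .x) (.reg .y)) (.lit 0))
      (B.set e (.add (.sub (A.at e) (.add (qEnt h e) (qEnt h e))) (A.at h)))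
      (B.set e (.sub (A.at e) (.add (qEnt h e) (qEnt h e))))) ?_
  · exact ⟨this.1, fun l hl => this.2.1 l fun e _ => hl e, this.2.2⟩
  · intro τ d h1 h2 hd
    have h3 : ∀ e, τ.arr A.name (preA ++ e) = σ.arr A.name (preA ++ e) := by
      intro e
      by_cases hn : A.name = B.name
      · rw [hn]
        exact h2 _ fun e' _ => (hAB.resolve_left (not_not.2 hn)) e e'
      · rw [h1.2 A.name (by simpa using hn)]
    have h4 : τ.arr .Q (hc ++ [d, τ.reg .x, τ.reg .y]) = q hc [d, τ.reg .x, τ.reg .y] :=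
      (hQ.frame h1 (by simpa using hBQ.symm)) _ _ hhc (hd.mono hα hβ)
    have h5 := leaves_iff hd
    simp only [exec_cond, BExp.eval, NExp.eval, Vec.set, Vec.at, qEnt, exec_setR, List.map_append, hA τ h1, hB τ h1, hh τ h1, RExp.eval, List.map_cons,
      List.map_nil, h3, h4, der, h5]
    by_cases hxy : τ.reg .x + τ.reg .y = 0
    · simp only [hxy, decide_true, if_true]; congr 1; ring
    · simp only [hxy, decide_false, if_false, Bool.false_eq_true]; congr 1; ring

/-- The body never writes anything but `0` into `ok`, so a mismatch, once found, is not forgotten.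
-/
theorem exec_compare {A B : Arr} {a b : NExp} {σ : State ℝ} {α β : ℕ}
    (ha : Fixed a σ α) (hb : Fixed b σ β) :
    Frame [.x, .y, .ok] [] σ ((compare ⟨A, []⟩ ⟨B, []⟩ a b).exec σ) ∧
    ((∀ e, InGrid α β e → σ.arr A e = σ.arr B e) →
      ((compare ⟨A, []⟩ ⟨B, []⟩ a b).exec σ).reg .ok = σ.reg .ok) ∧
    ((¬ ∀ e, InGrid α β e → σ.arr A e = σ.arr B e) →
      ((compare ⟨A, []⟩ ⟨B, []⟩ a b).exec σ).reg .ok = 0) := by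
  refine forArcs_rule (α := α) (β := β) (fun S τ => Frame [.x, .y, .ok] [] σ τ ∧
    ((∀ e ∈ S, σ.arr A e = σ.arr B e) → τ.reg .ok = σ.reg .ok) ∧
    ((¬ ∀ e ∈ S, σ.arr A e = σ.arr B e) → τ.reg .ok = 0)) ?_ ?_ ?_ ?_ ?_ ?_
  · exact fun S τ h => ha.eval h.1
  · exact fun S τ h => hb.eval h.1
  · exact fun S τ k h => ⟨h.1.trans (Frame.setReg _ _ (by simp) _), by simpa using h.2⟩
  · exact fun S τ k h => ⟨h.1.trans (Frame.setReg _ _ (by simp) _), by simpa using h.2⟩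
  · exact ⟨Frame.refl _ _ _, fun _ => rfl, by simp⟩
  · rintro S τ d ⟨h1, h2, h3⟩ _ hd
    have hA := h1.2 A (by simp)
    have hB := h1.2 B (by simp)
    simp only [exec_when, BExp.eval, RExp.eval, Vec.at, List.nil_append, List.map_cons,
      List.map_nil, NExp.eval, hA, hB, decide_eq_true_eq, exec_setN, Set.forall_mem_insert]
    split
    · next h =>
      refine ⟨⟨h1.trans (Frame.setReg _ _ (by simp) _), fun h' => absurd h'.1 h, by simp⟩, by simp⟩
    · next h =>
      rw [not_not] at h
      exact ⟨⟨h1, fun h' => h2 h'.2, fun h' => h3 fun h4 => h' ⟨h, h4⟩⟩, rfl⟩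

/-! ## Reduction -/

/-- Redistribution at a vertex is the change of costs along the potential with value `t` at that
vertex and `0` elsewhere; the conclusion has the form required by `lin_potential`. The bounds on `r
+ s` exclude source and target. -/
theorem exec_redistribute {N : Arr} {a b : NExp} {σ : State ℝ} {α β r s : ℕ}
    (hN : N ≠ .tmp) (ha : Fixed a σ α) (hb : Fixed b σ β) (hr : σ.reg .x = r)
    (hs : σ.reg .y = s) (hrα : r ≤ α) (hsβ : s ≤ β) (h0 : 0 < r + s) (h1 : r + s < α + β) :
    let σ' := (redistribute ⟨N, []⟩ a b (.reg .x) (.reg .y)).exec σ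
    let t := if s < β then σ.arr N (rt r s) else σ.arr N (dn r s)
    let π : ℕ → ℕ → ℝ := fun r' s' => if r' = r ∧ s' = s then t else 0
    Frame [] [N, .tmp] σ σ' ∧
    (∀ r' s', r' ≤ α → s' < β →
      σ'.arr N (rt r' s') = σ.arr N (rt r' s') + π r' (s' + 1) - π r' s') ∧
    (∀ r' s', r' < α → s' ≤ β →
      σ'.arr N (dn r' s') = σ.arr N (dn r' s') + π (r' + 1) s' - π r' s') := by
  intro σ' t π
  have hreg : ∀ {τ : State ℝ}, Frame [] [N, .tmp] σ τ → τ.reg = σ.reg := fun h =>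
    funext fun z => h.1 z (by simp)
  have hset : ∀ {τ : State ℝ} (A : Arr), A = N ∨ A = .tmp → ∀ l v, Frame [] [N, .tmp] σ τ →
      Frame [] [N, .tmp] σ (τ.setArr A l v) := fun A hA l v h =>
    h.trans (Frame.setArr _ _ (by simpa using hA) _ _)
  have hσ' : (redistribute ⟨N, []⟩ a b (.reg .x) (.reg .y)).exec σ = σ' := rfl
  clear_value σ'
  rw [redistribute, exec_block_cons, exec_block_cons, exec_block_cons, exec_block_nil] at hσ'
  generalize h₁ : Stmt.exec _ σ = σ₁ at hσ'
  -- Intermediate state: the outgoing arcs have lost `t`, the incoming arcs are still unchanged, and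
  -- `t` is kept in `tmp`. The two incoming arcs follow one at a time.
  have H₁ : Frame [] [N, .tmp] σ σ₁ ∧ σ₁.arr .tmp [] = t ∧
      (∀ r' s', r' ≤ α → s' < β → σ₁.arr N (rt r' s') = σ.arr N (rt r' s') - π r' s') ∧
      (∀ r' s', r' < α → s' ≤ β → σ₁.arr N (dn r' s') = σ.arr N (dn r' s') - π r' s') := by
    have ea : ∀ A l v, a.eval ((σ.setArr .tmp A l).setArr N (rt r s) v) = α := fun A l v =>
      ha.eval ((Frame.setArr [] (As := [N, .tmp]) σ (by simp) _ _).trans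
        (Frame.setArr [] _ (by simp) _ _))
    have eb := hb.eval (Frame.refl [] [] σ)
    simp only [exec_cond, exec_when, exec_block_cons, exec_block_nil, BExp.eval, NExp.eval,
      Vec.set, Vec.at, exec_setR, List.nil_append, right, down, List.map_cons, List.map_nil,
      RExp.eval, State.setArr_reg, hr, hs, eb, rt_fold, dn_fold, ea, decide_eq_true_eq] at h₁
    by_cases hsb : s < β
    · have ht : t = σ.arr N (rt r s) := if_pos hsb
      clear_value t
      rw [if_pos hsb] at h₁
      by_cases hra : r < α
      · rw [if_pos hra] at h₁
        subst h₁
        refine ⟨hset _ (by simp) _ _ (hset _ (by simp) _ _ (hset _ (by simp) _ _ (.refl _ _ _))),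
          ?_, fun r' s' h2 h3 => ?_, fun r' s' h2 h3 => ?_⟩
        · simp [hN.symm, ht]
        · by_cases h : r' = r ∧ s' = s <;> simp [State.setArr_arr, hN, π, h, ht]
        · by_cases h : r' = r ∧ s' = s <;> simp [State.setArr_arr, hN, hN.symm, π, h, ht]
      · rw [if_neg hra] at h₁
        subst h₁
        refine ⟨hset _ (by simp) _ _ (hset _ (by simp) _ _ (.refl _ _ _)),
          ?_, fun r' s' h2 h3 => ?_, fun r' s' h2 h3 => ?_⟩
        · simp [hN.symm, ht]
        · by_cases h : r' = r ∧ s' = s <;> simp [State.setArr_arr, hN, π, h, ht]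
        · have : r' ≠ r := by omega
          simp [State.setArr_arr, hN, π, this]
    · have ht : t = σ.arr N (dn r s) := if_neg hsb
      clear_value t
      rw [if_neg hsb] at h₁
      subst h₁
      refine ⟨hset _ (by simp) _ _ (hset _ (by simp) _ _ (.refl _ _ _)),
          ?_, fun r' s' h2 h3 => ?_, fun r' s' h2 h3 => ?_⟩
      · simp [hN.symm, ht]
      · have : s' ≠ s := by omega
        simp [State.setArr_arr, hN, π, this]
      · by_cases h : r' = r ∧ s' = s <;> simp [State.setArr_arr, hN, π, h, ht]
  clear h₁
  clear_value t
  obtain ⟨f₁, t₁, r₁, d₁⟩ := H₁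
  generalize h₂ : Stmt.exec _ σ₁ = σ₂ at hσ'
  have H₂ : Frame [] [N, .tmp] σ σ₂ ∧ σ₂.arr .tmp [] = t ∧
      (∀ r' s', r' ≤ α → s' < β → σ₂.arr N (rt r' s') = σ.arr N (rt r' s') - π r' s') ∧
      (∀ r' s', r' < α → s' ≤ β →
        σ₂.arr N (dn r' s') = σ.arr N (dn r' s') + π (r' + 1) s' - π r' s') := by
    simp only [exec_when, BExp.eval, NExp.eval,
      Vec.set, Vec.at, exec_setR, List.nil_append, down, List.map_cons, List.map_nil,
      RExp.eval, hreg f₁, hr, hs, dn_fold, decide_eq_true_eq, one, t₁] at h₂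
    by_cases hr0 : 0 < r
    · rw [if_pos hr0] at h₂
      subst h₂
      refine ⟨hset _ (by simp) _ _ f₁, by simp [hN.symm, t₁], fun r' s' h2 h3 => ?_,
        fun r' s' h2 h3 => ?_⟩
      · simp [State.setArr_arr, r₁ r' s' h2 h3]
      · by_cases h : r' + 1 = r ∧ s' = s
        · obtain ⟨rfl, rfl⟩ := h
          simp [State.setArr_arr, π, d₁ r' s' h2 h3]
        · have h' : ¬ (r' = r - 1 ∧ s' = s) := by omega
          simp [State.setArr_arr, π, d₁ r' s' h2 h3, h, h']
    · rw [if_neg hr0] at h₂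
      subst h₂
      refine ⟨f₁, t₁, r₁, fun r' s' h2 h3 => ?_⟩
      have : r' + 1 ≠ r := by omega
      simp [π, this, d₁ r' s' h2 h3]
  clear h₂ r₁ d₁ t₁ f₁
  obtain ⟨f₁, t₁, r₁, d₁⟩ := H₂
  simp only [exec_when, BExp.eval, NExp.eval,
      Vec.set, Vec.at, exec_setR, List.nil_append, right, List.map_cons, List.map_nil,
      RExp.eval, hreg f₁, hr, hs, rt_fold, decide_eq_true_eq, one, t₁] at hσ'
  by_cases hs0 : 0 < s
  · rw [if_pos hs0] at hσ'
    subst hσ'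
    refine ⟨hset _ (by simp) _ _ f₁, fun r' s' h2 h3 => ?_, fun r' s' h2 h3 => ?_⟩
    · by_cases h : r' = r ∧ s' + 1 = s
      · obtain ⟨rfl, rfl⟩ := h
        simp [State.setArr_arr, π, r₁ r' s' h2 h3]
      · have h' : ¬ (r' = r ∧ s' = s - 1) := by omega
        simp [State.setArr_arr, π, r₁ r' s' h2 h3, h, h']
    · simp [State.setArr_arr, d₁ r' s' h2 h3]
  · rw [if_neg hs0] at hσ'
    subst hσ'
    refine ⟨f₁, fun r' s' h2 h3 => ?_, d₁⟩
    have : s' + 1 ≠ s := by omega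
    simp [π, this, r₁ r' s' h2 h3]

/-- Treating vertices by decreasing `r + s` works because redistribution at a vertex raises only
arcs whose tails lie on the preceding antidiagonal and are still untreated. Thus zeros already
produced survive, and path costs persist since the potentials vanish at source and target. -/
theorem exec_reduce {N : Arr} {a b : NExp} {σ : State ℝ} {α β : ℕ} (hN : N ≠ .tmp)
    (ha : Fixed a σ α) (hb : Fixed b σ β) :
    Frame scratch [N, .tmp] σ ((reduce ⟨N, []⟩ a b).exec σ) ∧
    (∀ P, GridPath α β P → lin (((reduce ⟨N, []⟩ a b).exec σ).arr N) P = lin (σ.arr N) P) ∧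
    ReducedOn α β (((reduce ⟨N, []⟩ a b).exec σ).arr N) := by
  let Inv : (ℕ → ℕ → Prop) → State ℝ → Prop := fun S τ => Frame scratch [N, .tmp] σ τ ∧
    (∀ P, GridPath α β P → lin (τ.arr N) P = lin (σ.arr N) P) ∧
    (∀ r s, r ≤ α → s ≤ β → S r s →
      (s < β → τ.arr N (rt r s) = 0) ∧ (s = β → r < α → τ.arr N (dn r s) = 0))
  have hset : ∀ S τ z k, z ∈ scratch → Inv S τ → Inv S (τ.setReg z k) := fun S τ z k hz h =>
    ⟨h.1.trans (Frame.setReg _ _ hz _), h.2⟩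
  -- The condition is just `0 < r + s`, in the shape of the loop invariant at its last index. At
  -- index `0` it can hold only at the target, which has no outgoing arc in the subgrid.
  have main : Inv (fun r s => α + β - 1 - (α + β - 1) < r + s) ((reduce ⟨N, []⟩ a b).exec σ) := by
    refine loop_rule' (σ := σ) (N := α + β - 1)
      (by simp [NExp.eval, one, ha.eval (.refl [] [] σ), hb.eval (.refl [] [] σ)])
      (fun k τ => Inv (fun r s => α + β - 1 - k < r + s) τ) ?_ ?_
    · refine ⟨.refl _ _ _, fun _ _ => rfl, fun r s hr hs h => ⟨fun h' => ?_, fun h1 h2 => ?_⟩⟩ <;>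
        omega
    · intro k hk τ hτ
      have hτ1 := hset _ _ .u k (by simp [scratch]) hτ
      set τ₁ := τ.setReg .u k with hτ₁
      have hu : τ₁.reg .u = k := by simp [hτ₁]
      clear_value τ₁
      simp only [exec_block_cons, exec_block_nil, exec_setN, NExp.eval, one, hu,
        ha.eval hτ1.1 (by simp), hb.eval hτ1.1 (by simp)]
      set v := α + β - 1 - k with hv
      have hτ2 := hset _ _ .v v (by simp [scratch]) hτ1
      set τ₂ := τ₁.setReg .v v with hτ₂
      have hv2 : τ₂.reg .v = v := by simp [hτ₂]
      clear_value τ₂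
      -- With truncated subtraction `α - (α - v)` is the minimum of `α` and `v`, and `v - β` is the
      -- first row in which antidiagonal `v` meets the subgrid; `N` counts the rows in between, both
      -- included.
      have := loop_rule' (x := .w) (σ := τ₂)
        (n := .sub (.add (.sub a (.sub a (.reg .v))) one) (.sub (.reg .v) b))
        (N := α - (α - v) + 1 - (v - β))
        (b := block [ .setN .x (.add (.sub (.reg .v) b) (.reg .w)),
          .setN .y (.sub (.reg .v) (.reg .x)),
          redistribute ⟨N, []⟩ a b (.reg .x) (.reg .y) ])
        (by simp [NExp.eval, one, ha.eval hτ2.1, hb.eval hτ2.1, hv2])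
        (fun m τ => Inv (fun r s => v < r + s ∨ (r + s = v ∧ r < v - β + m)) τ ∧ τ.reg .v = v)
        ?_ ?_
      · refine ⟨this.1.1, this.1.2.1, fun r s hr hs h => this.1.2.2 r s hr hs ?_⟩
        omega
      · refine ⟨⟨hτ2.1, hτ2.2.1, fun r s hr hs h => hτ2.2.2 r s hr hs ?_⟩, hv2⟩
        omega
      · rintro m hm ρ ⟨hρ, hρv⟩
        have hρ1 := hset _ _ .w m (by simp [scratch]) hρ
        set ρ₁ := ρ.setReg .w m with hρ₁
        have hw : ρ₁.reg .w = m := by simp [hρ₁]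
        have hv3 : ρ₁.reg .v = v := by simp [hρ₁, hρv]
        clear_value ρ₁
        simp only [exec_block_cons, exec_block_nil, exec_setN, NExp.eval, hw, hv3,
          hb.eval hρ1.1 (by simp)]
        set x := v - β + m with hx
        have hρ2 := hset _ _ .y (v - x) (by simp [scratch])
          (hset _ _ .x x (by simp [scratch]) hρ1)
        have e1 : (ρ₁.setReg .x x).reg .v - (ρ₁.setReg .x x).reg .x = v - x := by simp [hv3]
        rw [e1]
        set ρ₂ := (ρ₁.setReg .x x).setReg .y (v - x) with hρ₂
        have hx2 : ρ₂.reg .x = x := by simp [hρ₂]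
        have hy2 : ρ₂.reg .y = v - x := by simp [hρ₂]
        have hv4 : ρ₂.reg .v = v := by simp [hρ₂, hv3]
        clear_value ρ₂
        clear e1 hρ₂
        have hxα : x ≤ α := by omega
        have hyβ : v - x ≤ β := by omega
        have hxy : x + (v - x) = v := by omega
        have hvlt : v < α + β := by omega
        have hv0 : 0 < v := by omega
        have hxs : v - β + (m + 1) = x + 1 := by omega
        clear_value x v
        generalize v - x = y at *
        obtain ⟨g1, g2, g3⟩ := exec_redistribute hN (ha.frame hρ2.1) (hb.frame hρ2.1) hx2 hy2
          hxα hyβ (by omega) (by omega)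
        generalize (redistribute ⟨N, []⟩ a b (.reg .x) (.reg .y)).exec ρ₂ = ρ₃ at *
        beta_reduce at g2 g3
        have ht1 : y < β → (if y < β then ρ₂.arr N (rt x y) else ρ₂.arr N (dn x y)) =
          ρ₂.arr N (rt x y) := fun h => if_pos h
        have ht2 : y = β → (if y < β then ρ₂.arr N (rt x y) else ρ₂.arr N (dn x y)) =
          ρ₂.arr N (dn x y) := fun h => if_neg (by omega)
        generalize (if y < β then ρ₂.arr N (rt x y) else ρ₂.arr N (dn x y)) = t at *
        refine ⟨⟨hρ2.1.trans (g1.mono (by simp) (by simp)), fun P hP => ?_,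
          fun r s hr hs h => ?_⟩, by rw [g1.1 _ (by simp), hv4]⟩
        -- The potential is zero at both ends of a path because `0 < v < α + β`.
        · rw [lin_potential (fun r' s' => if r' = x ∧ s' = y then t else 0) g2 g3 hP le_rfl le_rfl,
            hρ2.2.1 P hP, if_neg (by omega), if_neg (by omega)]
          ring
        · rw [hxs] at h
          refine ⟨fun h' => ?_, fun h1 h2 => ?_⟩
          -- An arc that enters `(x, y)` has its tail on antidiagonal `v - 1`, whose vertices are
          -- untreated; so the arc at hand receives no additional cost.
          · rw [g2 r s hr h', if_neg (by omega)]
            by_cases he : r = x ∧ s = y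
            · obtain ⟨rfl, rfl⟩ := he
              simp [ht1 h']
            · rw [if_neg he, (hρ2.2.2 r s hr hs (by omega)).1 h']; ring
          · rw [g3 r s h2 hs, if_neg (by omega)]
            by_cases he : r = x ∧ s = y
            · obtain ⟨rfl, rfl⟩ := he
              simp [ht2 h1]
            · rw [if_neg he, (hρ2.2.2 r s hr hs (by omega)).2 h1 h2]; ring
  refine ⟨main.1, main.2.1, fun r s hr hs h => main.2.2 r s hr hs (by omega)⟩

/-! ## Costs of critical paths -/

/-- The memory `τ` arises from `σ` by adding `c` to `cost`, up to the registers `rs`. -/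
def Accum (rs : List Reg) (σ τ : State ℝ) (c : ℝ) : Prop :=
  Frame rs [.cost, .tmp] σ τ ∧ τ.arr .cost [] = σ.arr .cost [] + c

theorem Accum.trans {rs : List Reg} {σ τ ρ : State ℝ} {c c' : ℝ} (h : Accum rs σ τ c)
    (h' : Accum rs τ ρ c') : Accum rs σ ρ (c + c') :=
  ⟨h.1.trans h'.1, by rw [h'.2, h.2, add_assoc]⟩

theorem Accum.congr {rs rs' : List Reg} {σ τ : State ℝ} {c c' : ℝ} (h : Accum rs σ τ c)
    (hr : rs ⊆ rs') (hc : c = c') : Accum rs' σ τ c' :=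
  ⟨h.1.mono hr (by simp), by rw [h.2, hc]⟩

/-- The accumulated amount is expressed as `lin` of a list of arcs, which matches the segments from
which critical paths are composed. -/
theorem accum_loop {rs : List Reg} {z : Reg} (hz : z ∈ rs) {n : NExp} {body : Stmt}
    {σ : State ℝ} {N : ℕ} (hn : n.eval σ = N) (D : List ℕ → ℝ) (f : ℕ → List ℕ)
    (hbody : ∀ τ, Frame rs [.cost, .tmp] σ τ → τ.reg z < N →
      Accum rs τ (body.exec τ) (D (f (τ.reg z)))) :
    Accum rs σ ((Stmt.loop z n body).exec σ) (lin D ((List.range N).map f)) := by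
  refine loop_rule' hn (fun k τ => Accum rs σ τ (lin D ((List.range k).map f))) ?_ ?_
  · exact ⟨.refl _ _ _, by simp⟩
  · intro k hk τ hτ
    have h1 : Accum rs τ (τ.setReg z k) 0 := ⟨.setReg _ _ hz _, by simp⟩
    have h2 := hbody (τ.setReg z k) (hτ.1.trans h1.1) (by simpa using hk)
    refine ((hτ.trans h1).trans h2).congr (fun _ h => h) ?_
    simp [List.range_succ]

/-- The body may rely on `e` keeping its value as long as `z` is not touched. The double sum over
pairs of arcs needs this, since its inner loop runs with the outer arc held fixed. -/
theorem accum_forBase {rs : List Reg} (hrs : rs ⊆ Reg.ok :: scratch) {z : Reg} (hz : z ∈ rs)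
    {a b : NExp} {body : List NExp → Stmt}
    {σ : State ℝ} {α β : ℕ} (ha : Fixed a σ α) (hb : Fixed b σ β) (D : List ℕ → ℝ)
    (hbody : ∀ τ (e : List NExp), Frame rs [.cost, .tmp] σ τ →
      (∀ ρ, Frame (rs.filter (· ≠ z)) [.cost, .tmp] τ ρ → e.map (NExp.eval ρ) = e.map (NExp.eval τ)) →
      InGrid α β (e.map (NExp.eval τ)) →
      Accum rs τ ((body e).exec τ) (D (e.map (NExp.eval τ)))) :
    Accum rs σ ((forBase a b z body).exec σ)
      (lin D (((List.range β).map fun w => rt 0 w) ++ ((List.range α).map fun w => dn w β))) := by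
  rw [lin_append, forBase, exec_seq]
  have h1 : Accum rs σ ((Stmt.loop z b (body (right (.lit 0) (.reg z)))).exec σ)
      (lin D ((List.range β).map fun w => rt 0 w)) := by
    refine accum_loop hz (hb.eval (.refl rs [] σ) hrs) D _ fun τ hτ hlt => ?_
    refine hbody τ (right (.lit 0) (.reg z)) hτ (fun ρ hρ => ?_) ?_
    · simp [right, NExp.eval, hρ.1 z (by simp)]
    · exact inGrid_rt.2 ⟨Nat.zero_le _, hlt⟩
  refine h1.trans ?_
  refine accum_loop hz (ha.eval h1.1 hrs) D _ fun τ hτ hlt => ?_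
  have e : (down (.reg z) b).map (NExp.eval τ) = dn (τ.reg z) β := by
    simp [down, dn, NExp.eval, hb.eval (h1.1.trans hτ) hrs]
  have := hbody τ (down (.reg z) b) (h1.1.trans hτ) (fun ρ hρ => ?_) ?_
  · rwa [e] at this
  · have h2 := h1.1.trans (hτ.trans (hρ.mono (fun _ h => List.mem_of_mem_filter h) fun _ h => h))
    simp [down, NExp.eval, hρ.1 z (by simp), hb.eval (h1.1.trans hτ) hrs, hb.eval h2 hrs]
  · rw [e]; exact inGrid_dn.2 ⟨hlt, le_rfl⟩

/-- The arcs that the critical paths for `(r, j)` and `(r, j + 1)` have in common. -/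
def critCommon (a b r j : ℕ) : List (List ℕ) :=
  ((List.range r).map fun w => dn w 0) ++ ((List.range j).map fun w => rt r w) ++
    ((List.range (b - (j + 1))).map fun w => rt (r + 1) (j + 1 + w)) ++
    ((List.range (a - (r + 1))).map fun w => dn (r + 1 + w) b)

/-- Costs depend on a path only up to permutation, so the exchanged arcs can be brought to the
front, where `quad_cons` applies. Together with `crit_succ_perm` this isolates the common part of
two consecutive critical paths. -/
theorem crit_perm {a b r j : ℕ} (hj : j < b) :
    (crit a b r j).Perm (dn r j :: rt (r + 1) j :: critCommon a b r j) := by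
  have h1 : b - j = (b - (j + 1)) + 1 := by omega
  rw [← Multiset.coe_eq_coe]
  simp only [crit, critCommon, h1, List.range_succ_eq_map (n := b - (j + 1)), List.map_cons,
    List.map_map, Function.comp_def, ← Multiset.coe_add, ← Multiset.cons_coe,
    ← Multiset.singleton_add, Multiset.coe_nil, Nat.add_zero, Nat.succ_eq_add_one]
  have : (fun w => rt (r + 1) (j + (w + 1))) = fun w => rt (r + 1) (j + 1 + w) := by
    funext w; congr 1; omega
  rw [this]
  abel

theorem crit_succ_perm {a b r j : ℕ} :
    (crit a b r (j + 1)).Perm (rt r j :: dn r (j + 1) :: critCommon a b r j) := by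
  rw [← Multiset.coe_eq_coe]
  simp only [crit, critCommon, List.range_succ, List.map_append, List.map_cons, List.map_nil,
    ← Multiset.coe_add, ← Multiset.cons_coe, ← Multiset.singleton_add, Multiset.coe_nil]
  abel

/-- The change of the cost caused by the arc `g` when the arcs `rt r j` and `dn r (j + 1)` are
exchanged for `dn r j` and `rt (r + 1) j`. -/
def flipGain (q : List ℕ → List ℕ → ℝ) (r j : ℕ) (g : List ℕ) : ℝ :=
  2 * (q (dn r j) g + q (rt (r + 1) j) g - q (rt r j) g - q (dn r (j + 1)) g)

theorem lin_flipGain (q : List ℕ → List ℕ → ℝ) (r j : ℕ) (P : List (List ℕ)) :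
    lin (flipGain q r j) P = 2 * (lin (q (dn r j)) P + lin (q (rt (r + 1) j)) P -
      lin (q (rt r j)) P - lin (q (dn r (j + 1))) P) := by
  induction P with
  | nil => simp
  | cons e P ih => simp only [lin_cons, ih, flipGain]; ring

/-- Interactions within the common part cancel. What remains is the interaction inside each
exchanged pair and the interaction of these pairs with the common arcs, a sum of `O(a + b)` terms.
-/
theorem quad_crit_sub {q : List ℕ → List ℕ → ℝ} (hq : SymmZeroDiag q) {a b r j : ℕ}
    (hj : j < b) : quad q (crit a b r j) - quad q (crit a b r (j + 1)) =
      2 * (q (dn r j) (rt (r + 1) j) - q (rt r j) (dn r (j + 1))) +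
      lin (flipGain q r j) (critCommon a b r j) := by
  rw [quad_perm (crit_perm hj), quad_perm crit_succ_perm, lin_flipGain]
  simp only [quad_cons hq, lin_cons]
  ring

theorem crit_base {a b : ℕ} (ha : 0 < a) : crit a b 0 b =
    ((List.range b).map fun w => rt 0 w) ++ ((List.range a).map fun w => dn w b) := by
  obtain ⟨a, rfl⟩ : ∃ a', a = a' + 1 := ⟨a - 1, by omega⟩
  simp [crit, List.range_succ_eq_map (n := a), Function.comp_def, Nat.add_comm]

/-! ### Execution of an exchange and of the pseudo-linearization -/

theorem accum_upd {q : List ℕ → List ℕ → ℝ} {a' b' r j : ℕ} {σ : State ℝ}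
    (hQ : HoldsQ q a' b' σ) {e₁ e₂ f₁ f₂ g : List NExp} {gc : List ℕ}
    (he₁ : e₁.map (NExp.eval σ) = rt r j) (he₂ : e₂.map (NExp.eval σ) = dn r (j + 1))
    (hf₁ : f₁.map (NExp.eval σ) = dn r j) (hf₂ : f₂.map (NExp.eval σ) = rt (r + 1) j)
    (hg : g.map (NExp.eval σ) = gc) (hr : r < a') (hj : j < b') (hgc : InGrid a' b' gc)
    (rs : List Reg) :
    Accum rs σ ((block
      [ .setR .tmp [] (.sub (.sub (.add (qEnt f₁ g) (qEnt f₂ g)) (qEnt e₁ g)) (qEnt e₂ g)),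
        incr .cost [] (.add (.get .tmp []) (.get .tmp [])) ]).exec σ) (flipGain q r j gc) := by
  refine ⟨⟨fun z _ => rfl, fun A hA => ?_⟩, ?_⟩
  · simp only [List.mem_cons, List.not_mem_nil, or_false, not_or] at hA
    simp [incr, hA]
  · have h1 := hQ (rt r j) gc (inGrid_rt.2 (by omega)) hgc
    have h2 := hQ (dn r (j + 1)) gc (inGrid_dn.2 (by omega)) hgc
    have h3 := hQ (dn r j) gc (inGrid_dn.2 (by omega)) hgc
    have h4 := hQ (rt (r + 1) j) gc (inGrid_rt.2 (by omega)) hgc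
    simp [incr, RExp.eval, qEnt, State.setArr_arr, he₁, he₂, hf₁, hf₂, hg, h1, h2, h3, h4, flipGain]
    ring

/-- The first statement accounts for the interactions inside the exchanged pairs; the four loops
then run through the four segments of `critCommon` and add up `flipGain`. -/
theorem exec_flip {q : List ℕ → List ℕ → ℝ} (hq : SymmZeroDiag q) {a' b' α β r j : ℕ}
    {a b : NExp} {σ : State ℝ} (hQ : HoldsQ q a' b' σ) (ha : Fixed a σ α) (hb : Fixed b σ β)
    (hα : α ≤ a') (hβ : β ≤ b') (hu : σ.reg .u = r) (hv : σ.reg .v = j) (hr : r < α)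
    (hj : j < β) :
    Accum [.w] σ ((flip a b (.reg .u) (.reg .v)).exec σ)
      (quad q (crit α β r j) - quad q (crit α β r (j + 1))) := by
  have reg : ∀ {τ : State ℝ}, Frame [.w] [.cost, .tmp] σ τ →
      τ.reg .u = r ∧ τ.reg .v = j := fun h => by
    rw [h.1 .u (by simp), h.1 .v (by simp)]; exact ⟨hu, hv⟩
  have E : ∀ {τ : State ℝ}, Frame [.w] [.cost, .tmp] σ τ →
      (right (.reg .u) (.reg .v)).map (NExp.eval τ) = rt r j ∧
      (down (.reg .u) (.add (.reg .v) one)).map (NExp.eval τ) = dn r (j + 1) ∧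
      (down (.reg .u) (.reg .v)).map (NExp.eval τ) = dn r j ∧
      (right (.add (.reg .u) one) (.reg .v)).map (NExp.eval τ) = rt (r + 1) j := fun h => by
    simp [right, down, NExp.eval, one, reg h, rt, dn]
  have U : ∀ {τ ρ : State ℝ} (g : List NExp) (gc : List ℕ), Frame [.w] [.cost, .tmp] σ τ →
      Frame [.w] [.cost, .tmp] τ ρ →
      g.map (NExp.eval ρ) = gc → InGrid a' b' gc → Accum [.w] ρ _ (flipGain q r j gc) :=
    fun g gc h h' hg hgc => accum_upd (hQ.frame (h.trans h') (by simp)) (E (h.trans h')).1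
      (E (h.trans h')).2.1 (E (h.trans h')).2.2.1 (E (h.trans h')).2.2.2 hg (by omega) (by omega)
      hgc [.w]
  rw [quad_crit_sub hq hj, critCommon, lin_append, lin_append, lin_append, ← add_assoc,
    ← add_assoc, ← add_assoc]
  simp only [flip, exec_block_cons, exec_block_nil]
  have A0 : Accum [.w] σ ((incr .cost [] (.sub (.add (qEnt (down (.reg .u) (.reg .v))
      (right (.add (.reg .u) one) (.reg .v))) (qEnt (down (.reg .u) (.reg .v))
      (right (.add (.reg .u) one) (.reg .v)))) (.add (qEnt (right (.reg .u) (.reg .v))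
      (down (.reg .u) (.add (.reg .v) one))) (qEnt (right (.reg .u) (.reg .v))
      (down (.reg .u) (.add (.reg .v) one)))))).exec σ)
      (2 * (q (dn r j) (rt (r + 1) j) - q (rt r j) (dn r (j + 1)))) := by
    refine ⟨Frame.setArr _ _ (by simp) _ _, ?_⟩
    obtain ⟨k1, k2, k3, k4⟩ := E (.refl _ _ σ)
    have h1 := hQ (dn r j) (rt (r + 1) j) (inGrid_dn.2 (by omega)) (inGrid_rt.2 (by omega))
    have h2 := hQ (rt r j) (dn r (j + 1)) (inGrid_rt.2 (by omega)) (inGrid_dn.2 (by omega))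
    simp only [incr, exec_setR, RExp.eval, qEnt, List.map_append, k1, k2, k3, k4, h1, h2,
      List.map_nil, State.setArr_arr, and_self, if_true]
    ring
  have S : ∀ {τ : State ℝ} {c : ℝ} {n : NExp} {N : ℕ} {g : List NExp} {f : ℕ → List ℕ},
      Accum [.w] σ τ c → (∀ ρ, Frame [.w] [.cost, .tmp] σ ρ → n.eval ρ = N) →
      (∀ ρ, Frame [.w] [.cost, .tmp] σ ρ → g.map (NExp.eval ρ) = f (ρ.reg .w)) →
      (∀ k < N, InGrid a' b' (f k)) →
      Accum [.w] σ ((Stmt.loop .w n _).exec τ)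
        (c + lin (flipGain q r j) ((List.range N).map f)) :=
    fun {τ c n N g f} h hn hg hin => h.trans (accum_loop (by simp) (hn _ h.1) _ f fun ρ hρ hlt =>
      U g _ h.1 hρ (hg ρ (h.1.trans hρ)) (hin _ hlt))
  have hwf : ∀ {τ : State ℝ}, Frame [.w] [.cost, .tmp] σ τ → a.eval τ = α ∧ b.eval τ = β :=
    fun h => ⟨ha.eval h, hb.eval h⟩
  have A1 := S (n := .reg .u) (N := r) (g := down (.reg .w) (.lit 0)) (f := fun w => dn w 0) A0
    (fun ρ hρ => by simp [NExp.eval, reg hρ]) (fun ρ hρ => by simp [down, dn, NExp.eval])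
    (fun k hk => inGrid_dn.2 (by omega))
  clear A0
  have A2 := S (n := .reg .v) (N := j) (g := right (.reg .u) (.reg .w)) (f := fun w => rt r w) A1
    (fun ρ hρ => by simp [NExp.eval, reg hρ]) (fun ρ hρ => by simp [right, rt, NExp.eval, reg hρ])
    (fun k hk => inGrid_rt.2 (by omega))
  clear A1
  have A3 := S (n := .sub b (.add (.reg .v) one)) (N := β - (j + 1))
    (g := right (.add (.reg .u) one) (.add (.add (.reg .v) one) (.reg .w)))
    (f := fun w => rt (r + 1) (j + 1 + w)) A2
    (fun ρ hρ => by simp [NExp.eval, reg hρ, hwf hρ, one])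
    (fun ρ hρ => by simp [right, rt, NExp.eval, reg hρ, one])
    (fun k hk => inGrid_rt.2 (by omega))
  clear A2
  exact S (n := .sub a (.add (.reg .u) one)) (N := α - (r + 1))
    (g := down (.add (.add (.reg .u) one) (.reg .w)) b)
    (f := fun w => dn (r + 1 + w) β) A3
    (fun ρ hρ => by simp [NExp.eval, reg hρ, hwf hρ, one])
    (fun ρ hρ => by simp [down, dn, NExp.eval, reg hρ, hwf hρ, one])
    (fun k hk => inGrid_dn.2 (by omega))

/-- The initial computation of the cost of the first critical path. -/
theorem accum_base {q : List ℕ → List ℕ → ℝ} {a' b' α β : ℕ}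
    {a b : NExp} {σ : State ℝ} (hQ : HoldsQ q a' b' σ) (ha : Fixed a σ α) (hb : Fixed b σ β)
    (hα : α ≤ a') (hβ : β ≤ b') (h0 : 0 < α) :
    Accum [.u, .v] σ ((forBase a b .u fun e => forBase a b .v fun f =>
      incr .cost [] (qEnt e f)).exec σ) (quad q (crit α β 0 β)) := by
  rw [crit_base h0]
  refine accum_forBase (by simp [scratch]) (by simp) ha hb
    (fun e => lin (q e) _) fun τ e hτ he hin => ?_
  refine Accum.congr (accum_forBase (rs := [.v]) (by simp [scratch]) (by simp)
    (ha.frame hτ) (hb.frame hτ) (q (e.map (NExp.eval τ))) fun ρ f hρ _ hf => ?_) (by simp) rfl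
  refine ⟨Frame.setArr _ _ (by simp) _ _, ?_⟩
  have h1 := he ρ (by simpa using hρ)
  have h2 := hQ.frame (hτ.trans (hρ.mono (by simp) (by simp))) (by simp) _ _ (hin.mono hα hβ)
    (hf.mono hα hβ)
  simp [incr, RExp.eval, qEnt, h1, h2, State.setArr_arr]

theorem exec_pseudoLin {q : List ℕ → List ℕ → ℝ} (hq : SymmZeroDiag q) {a' b' α β : ℕ}
    {N : Arr} (hN : N ∉ [Arr.Q, .cost, .tmp, .start])
    {a b : NExp} {σ : State ℝ} (hQ : HoldsQ q a' b' σ) (ha : Fixed a σ α) (hb : Fixed b σ β)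
    (hα : α ≤ a') (hβ : β ≤ b') (h0 : 0 < α) :
    Frame scratch [N, .cost, .tmp, .start] σ ((pseudoLin ⟨N, []⟩ a b).exec σ) ∧
    ∀ e, InGrid α β e → ((pseudoLin ⟨N, []⟩ a b).exec σ).arr N e = plin q α β e := by
  simp only [List.mem_cons, List.not_mem_nil, or_false, not_or] at hN
  obtain ⟨hNQ, hNc, hNt, hNs⟩ := hN
  simp only [pseudoLin, exec_block_cons, exec_block_nil]
  -- the zero vector
  have F₁ := forArcs_map ha hb N [] (fun _ => 0)
    (body := fun e => (⟨N, []⟩ : Vec).set e .zero) (by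
      intro τ d _ _ _
      simp [Vec.set, RExp.eval, NExp.eval])
  generalize Stmt.exec _ σ = σ₁ at F₁ ⊢
  have hF₁ : Frame scratch [N, .cost, .tmp, .start] σ σ₁ := F₁.1.mono (by simp [scratch]) (by simp)
  have hz₁ : ∀ e, InGrid α β e → σ₁.arr N e = 0 := F₁.2.2
  -- the first path
  rw [exec_setR]
  simp only [RExp.eval, List.map_nil]
  have hF₂ := hF₁.trans (Frame.setArr scratch (As := [N, .cost, .tmp, .start]) σ₁
    (A := .cost) (by simp) [] 0)
  have hc₂ : (σ₁.setArr .cost [] 0).arr .cost [] = 0 := by simp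
  have hz₂ : (σ₁.setArr .cost [] 0).arr N = σ₁.arr N := by simp [hNc]
  generalize σ₁.setArr .cost [] 0 = σ₂ at hF₂ hc₂ hz₂ ⊢
  have A := accum_base (hQ.frame hF₂ (by simp; tauto)) (ha.frame hF₂) (hb.frame hF₂) hα hβ h0
  generalize Stmt.exec _ σ₂ = σ₃ at A ⊢
  have hF₃ := hF₂.trans (A.1.mono (rs' := scratch) (As' := [N, .cost, .tmp, .start])
    (by simp [scratch]) (by simp))
  have hc₃ : σ₃.arr .cost [] = quad q (crit α β 0 β) := by rw [A.2, hc₂, zero_add]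
  have hz₃ : ∀ e, InGrid α β e → σ₃.arr N e = 0 := fun e he => by
    rw [A.1.2 N (by simp; tauto), hz₂, hz₁ e he]
  clear A hz₂ hc₂ hF₂ σ₂ hz₁ hF₁ F₁ σ₁
  -- the entry of the first arc
  have hs : Frame scratch [N, .cost, .tmp, .start] σ₃ ((Stmt.cond (.lt (.lit 0) b)
      ((⟨N, []⟩ : Vec).set (right (.lit 0) (.lit 0)) (.get .cost []))
      ((⟨N, []⟩ : Vec).set (down (.lit 0) (.lit 0)) (.get .cost []))).exec σ₃) ∧
      ((Stmt.cond (.lt (.lit 0) b)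
      ((⟨N, []⟩ : Vec).set (right (.lit 0) (.lit 0)) (.get .cost []))
      ((⟨N, []⟩ : Vec).set (down (.lit 0) (.lit 0)) (.get .cost []))).exec σ₃).arr .cost =
        σ₃.arr .cost ∧
      (∀ r s, r ≤ α → s < β → ((Stmt.cond (.lt (.lit 0) b)
      ((⟨N, []⟩ : Vec).set (right (.lit 0) (.lit 0)) (.get .cost []))
      ((⟨N, []⟩ : Vec).set (down (.lit 0) (.lit 0)) (.get .cost []))).exec σ₃).arr N (rt r s) =
        plin q α β (rt r s)) ∧
      (∀ r s, r < α → s = β → ((Stmt.cond (.lt (.lit 0) b)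
      ((⟨N, []⟩ : Vec).set (right (.lit 0) (.lit 0)) (.get .cost []))
      ((⟨N, []⟩ : Vec).set (down (.lit 0) (.lit 0)) (.get .cost []))).exec σ₃).arr N (dn r s) =
        plin q α β (dn r s)) := by
    simp only [exec_cond, BExp.eval, NExp.eval, hb.eval hF₃, Vec.set, exec_setR, RExp.eval,
      List.map_nil, List.nil_append, right, down, List.map_cons, hc₃, rt_fold, dn_fold,
      decide_eq_true_eq]
    split
    · next hβ0 =>
      refine ⟨Frame.setArr _ _ (by simp) _ _, by simp [Ne.symm hNc], fun r s hr hs => ?_,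
        fun r s hr hs => ?_⟩
      · rw [State.setArr_arr, plin_rt]
        by_cases h : r + s = 0
        · rw [if_pos h, if_pos (by simp; omega)]
        · rw [if_neg h, if_neg (by simp; omega), hz₃ _ (inGrid_rt.2 ⟨hr, hs⟩)]
      · rw [State.setArr_arr, plin_dn, if_neg (by simp), if_neg (by omega),
          hz₃ _ (inGrid_dn.2 (by omega))]
    · next hβ0 =>
      refine ⟨Frame.setArr _ _ (by simp) _ _, by simp [Ne.symm hNc], fun r s hr hs => by omega,
        fun r s hr hs => ?_⟩
      obtain rfl : s = 0 := by omega
      obtain rfl : β = 0 := by omega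
      rw [State.setArr_arr, plin_dn]
      by_cases h : r = 0
      · subst h; simp
      · rw [if_neg (by simp; omega), if_neg (by omega), hz₃ _ (inGrid_dn.2 (by omega))]
  generalize Stmt.exec _ σ₃ = σ₄ at hs ⊢
  obtain ⟨hF₄, hc₄, hr₄, hd₄⟩ := hs
  replace hF₄ := hF₃.trans hF₄
  rw [← hc₄] at hc₃
  clear hz₃ hF₃ hc₄
  -- the loop
  let As : List Arr := [N, .cost, .tmp, .start]
  -- The predicate `S` marks the downward arcs already written. Horizontal arcs and the arcs of
  -- column `β` are final before the loop starts.
  let Inv : (ℕ → ℕ → Prop) → State ℝ → Prop := fun S τ => Frame scratch As σ τ ∧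
    (∀ r s, r ≤ α → s < β → τ.arr N (rt r s) = plin q α β (rt r s)) ∧
    (∀ r s, r < α → s ≤ β → S r s ∨ s = β → τ.arr N (dn r s) = plin q α β (dn r s))
  have hInv : ∀ {S τ τ'}, Inv S τ → Frame scratch [.cost, .tmp, .start] τ τ' → Inv S τ' := by
    intro S τ τ' h h'
    have e : τ'.arr N = τ.arr N := h'.2 N (by simp; tauto)
    refine ⟨h.1.trans (h'.mono (fun _ h => h) (by simp [As])), ?_⟩
    rw [e]; exact h.2
  have key : Inv (fun r s => r < α) ((Stmt.loop .u a (block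
      [ .setR .start [] (.get .cost []),
        .loop .x b (block
          [ .setN .v (.sub (.sub b one) (.reg .x)),
            flip a b (.reg .u) (.reg .v),
            .cond (.eq (.add (.reg .u) (.reg .v)) (.lit 0))
              ((⟨N, []⟩ : Vec).set (down (.reg .u) (.reg .v)) (.get .cost []))
              ((⟨N, []⟩ : Vec).set (down (.reg .u) (.reg .v))
                (.sub (.get .cost []) (.get .start []))) ]) ])).exec σ₄) ∧ True := by
    -- On entry to row `k` the running cost is that of the path that crosses row `k` entirely. This
    -- is claimed only for `k < α`, because no critical path belongs to row `α`.
    refine ⟨(loop_rule' (ha.eval hF₄) (fun k τ => Inv (fun r s => r < k) τ ∧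
      (k < α → τ.arr .cost [] = quad q (crit α β k β))) ⟨⟨hF₄, hr₄, fun r s h1 h2 h3 =>
      hd₄ r s h1 (by omega)⟩, fun _ => hc₃⟩ ?_).1, trivial⟩
    rintro k hk τ ⟨hτ, hc⟩
    replace hc := hc hk
    have hτ1 := hInv hτ ((Frame.setReg [.cost, .tmp, .start] τ (z := .u) (rs := scratch)
      (by simp [scratch]) k))
    have hu1 : (τ.setReg .u k).reg .u = k := by simp
    have hc1 : (τ.setReg .u k).arr .cost [] = quad q (crit α β k β) := hc
    generalize τ.setReg .u k = τ₁ at hτ1 hu1 hc1 ⊢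
    simp only [exec_block_cons, exec_block_nil]
    rw [exec_setR]
    simp only [RExp.eval, List.map_nil, hc1]
    have hτ2 := hInv hτ1 (Frame.setArr scratch (As := [.cost, .tmp, .start]) τ₁ (A := .start)
      (by simp) [] (quad q (crit α β k β)))
    have hs2 : (τ₁.setArr .start [] (quad q (crit α β k β))).arr .start [] =
      quad q (crit α β k β) := by simp
    have hc2 : (τ₁.setArr .start [] (quad q (crit α β k β))).arr .cost [] =
      quad q (crit α β k β) := by simpa using hc1
    have hu2 : (τ₁.setArr .start [] (quad q (crit α β k β))).reg .u = k := hu1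
    generalize τ₁.setArr .start [] (quad q (crit α β k β)) = τ₂ at hτ2 hs2 hc2 hu2 ⊢
    have inner := loop_rule' (x := .x) (hb.eval hτ2.1) (b := block
          [ .setN .v (.sub (.sub b one) (.reg .x)),
            flip a b (.reg .u) (.reg .v),
            .cond (.eq (.add (.reg .u) (.reg .v)) (.lit 0))
              ((⟨N, []⟩ : Vec).set (down (.reg .u) (.reg .v)) (.get .cost []))
              ((⟨N, []⟩ : Vec).set (down (.reg .u) (.reg .v))
                (.sub (.get .cost []) (.get .start []))) ])
      (fun m τ => Inv (fun r s => r < k ∨ (r = k ∧ β - m ≤ s)) τ ∧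
      τ.arr .cost [] = quad q (crit α β k (β - m)) ∧
      τ.arr .start [] = quad q (crit α β k β) ∧ τ.reg .u = k) (σ := τ₂)
      ⟨⟨hτ2.1, hτ2.2.1, fun r s h1 h2 h3 => hτ2.2.2 r s h1 h2 (by omega)⟩, hc2, hs2, hu2⟩ ?_
    · refine ⟨⟨inner.1.1, inner.1.2.1, fun r s h1 h2 h3 => inner.1.2.2 r s h1 h2 (by omega)⟩,
        fun hk' => ?_⟩
      -- The columns were visited from right to left, so the row ends with the path for column `0`,
      -- which opens the next row.
      rw [inner.2.1, Nat.sub_self, crit_zero hk']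
    · rintro m hm ρ ⟨hρ, hρc, hρs, hρu⟩
      simp only [exec_block_cons, exec_block_nil]
      have hρ1 := hInv hρ ((Frame.setReg [.cost, .tmp, .start] ρ (z := .x) (rs := scratch)
        (by simp [scratch]) m))
      have ev : NExp.eval (ρ.setReg .x m) (.sub (.sub b one) (.reg .x)) = β - 1 - m := by
        simp [NExp.eval, one, hb.eval hρ1.1]
      rw [exec_setN, ev]
      set v := β - 1 - m with hv
      have hρ2 := hInv hρ1 ((Frame.setReg [.cost, .tmp, .start] (ρ.setReg .x m) (z := .v)
        (rs := scratch) (by simp [scratch]) v))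
      have hu2 : ((ρ.setReg .x m).setReg .v v).reg .u = k := by simp [hρu]
      have hv2 : ((ρ.setReg .x m).setReg .v v).reg .v = v := by simp
      have hm1 : β - m = v + 1 := by omega
      have hm2 : β - (m + 1) = v := by omega
      rw [hm1] at hρc hρ2
      rw [hm2]
      have hc2' : ((ρ.setReg .x m).setReg .v v).arr .cost [] = quad q (crit α β k (v + 1)) := hρc
      have hs2' : ((ρ.setReg .x m).setReg .v v).arr .start [] = quad q (crit α β k β) := hρs
      generalize (ρ.setReg .x m).setReg .v v = ρ₂ at hρ2 hu2 hv2 hc2' hs2' ⊢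
      have A := exec_flip hq (hQ.frame hρ2.1 (by simp [As]; tauto)) (ha.frame hρ2.1)
        (hb.frame hρ2.1) hα hβ hu2 hv2 hk (by omega)
      generalize Stmt.exec _ ρ₂ = ρ₃ at A ⊢
      have hρ3 := hInv hρ2 (A.1.mono (by simp [scratch]) (by simp))
      have hc3 : ρ₃.arr .cost [] = quad q (crit α β k v) := by rw [A.2, hc2']; ring
      have hs3 : ρ₃.arr .start [] = quad q (crit α β k β) := by rw [A.1.2 _ (by simp), hs2']
      have hu3 : ρ₃.reg .u = k := by rw [A.1.1 _ (by simp), hu2]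
      have hv3 : ρ₃.reg .v = v := by rw [A.1.1 _ (by simp), hv2]
      have hvβ : v < β := by omega
      have final : Stmt.exec (.cond (.eq (.add (.reg .u) (.reg .v)) (.lit 0))
              ((⟨N, []⟩ : Vec).set (down (.reg .u) (.reg .v)) (.get .cost []))
              ((⟨N, []⟩ : Vec).set (down (.reg .u) (.reg .v))
                (.sub (.get .cost []) (.get .start [])))) ρ₃ =
          ρ₃.setArr N (dn k v) (plin q α β (dn k v)) := by
        rw [plin_dn, if_pos (Or.inl hvβ)]
        simp only [exec_cond, BExp.eval, NExp.eval, hu3, hv3, Vec.set, exec_setR, RExp.eval,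
          List.nil_append, down, List.map_cons, List.map_nil, hc3, hs3, dn_fold, decide_eq_true_eq]
        split <;> rfl
      rw [final]
      refine ⟨⟨hρ3.1.trans (Frame.setArr _ _ (by simp [As]) _ _), fun r s h1 h2 => ?_,
        fun r s h1 h2 h3 => ?_⟩, ?_, ?_, hu3⟩
      · rw [State.setArr_arr, if_neg (by simp), hρ3.2.1 r s h1 h2]
      · rw [State.setArr_arr]
        by_cases h : r = k ∧ s = v
        · obtain ⟨rfl, rfl⟩ := h; simp
        · rw [if_neg (by simpa using h), hρ3.2.2 r s h1 h2 (by omega)]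
      · rw [State.setArr_arr, if_neg (by tauto), hc3]
      · rw [State.setArr_arr, if_neg (by tauto), hs3]
  refine ⟨key.1.1, ?_⟩
  rintro e (⟨r, s, h1, h2, rfl⟩ | ⟨r, s, h1, h2, rfl⟩)
  · exact key.1.2.1 r s h1 h2
  · exact key.1.2.2 r s h1 h2 (Or.inl h1)

/-! ## One pass of the outer loop -/

theorem ReducedOn.congr {a b : ℕ} {d d' : List ℕ → ℝ} (h : ReducedOn a b d)
    (hd : ∀ e, InGrid a b e → d' e = d e) : ReducedOn a b d' := by
  intro r s hr hs h0
  refine ⟨fun h1 => ?_, fun h1 h2 => ?_⟩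
  · rw [hd _ (inGrid_rt.2 ⟨hr, h1⟩), (h r s hr hs h0).1 h1]
  · rw [hd _ (inGrid_dn.2 ⟨h2, hs⟩), (h r s hr hs h0).2 h1 h2]

/-- Existence is read off from the verified program `reduce`, run on a memory in which every array
holds `d`. -/
theorem exists_reducedOn (a b : ℕ) (d : List ℕ → ℝ) :
    ∃ d', ReducedOn a b d' ∧ ∀ P, GridPath a b P → lin d' P = lin d P := by
  have := exec_reduce (N := .cHat) (a := .lit a) (b := .lit b) (σ := ⟨fun _ => 0, fun _ => d⟩)
    (α := a) (β := b) (by simp) (fun _ _ => rfl) (fun _ _ => rfl)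
  exact ⟨_, this.2.2, this.2.1⟩

/-- The reduced form of any linearization is again one, and uniqueness identifies it with `plin`.
Linearizability at a target thus becomes a property of one explicit vector. -/
theorem LinearizesAt.plin {q : List ℕ → List ℕ → ℝ} {a b : ℕ} (ha : 0 < a) {d : List ℕ → ℝ}
    (h : LinearizesAt q a b d) : LinearizesAt q a b (plin q a b) := by
  obtain ⟨d', h1, h2⟩ := exists_reducedOn a b d
  have h3 : LinearizesAt q a b d' := fun P hP => (h P hP).trans (h2 P hP).symm
  exact h3.congr fun e he => h1.eq_plin ha h3 he

/-- The vectors for the targets `(i + 1, b), (i + 1, b - 1), …` obtained by successive derivation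
along row `i + 1`. -/
def rowChain (q : List ℕ → List ℕ → ℝ) (i b : ℕ) (d : List ℕ → ℝ) : ℕ → List ℕ → ℝ
  | 0 => d
  | m + 1 => der q (rt (i + 1) (b - (m + 1))) (rowChain q i b d m)

/-- The vector for the target `(i, j)` derived from the vector for `(i + 1, j)`. -/
def rowDer (q : List ℕ → List ℕ → ℝ) (i b : ℕ) (d : List ℕ → ℝ) (j : ℕ) : List ℕ → ℝ :=
  der q (dn i j) (rowChain q i b d (b - j))

/-- The index `m` counts derivations from the right end, so it belongs to column `b - m`. Every tail
passed lies in row `i + 1` and hence is never the source. -/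
theorem LinearizesAt.rowChain {q : List ℕ → List ℕ → ℝ} (hq : SymmZeroDiag q) {i b : ℕ}
    {d : List ℕ → ℝ} (h : LinearizesAt q (i + 1) b d) (m : ℕ) (hm : m ≤ b) :
    LinearizesAt q (i + 1) (b - m) (rowChain q i b d m) := by
  induction m with
  | zero => exact h
  | succ m ih =>
    have h1 : b - m = b - (m + 1) + 1 := by omega
    have := ih (by omega)
    rw [h1] at this
    exact this.der_right hq (by omega)

theorem LinearizesAt.rowDer {q : List ℕ → List ℕ → ℝ} (hq : SymmZeroDiag q) {i b : ℕ}
    (hi : 0 < i) {d : List ℕ → ℝ} (h : LinearizesAt q (i + 1) b d) {j : ℕ} (hj : j ≤ b) :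
    LinearizesAt q i j (rowDer q i b d j) := by
  have := h.rowChain hq (b - j) (by omega)
  rw [Nat.sub_sub_self hj] at this
  exact this.der_down hq (by omega)

/-- Going through row `i + 1` from left to right, the paths to column `j + 1` either descend there,
which is settled by the hypothesis, or come from column `j`, which is settled by induction. In
column `0` only the descent is possible. -/
theorem LinearizesAt.of_rowDer {q : List ℕ → List ℕ → ℝ} (hq : SymmZeroDiag q) {i b : ℕ}
    (hi : 0 < i) {d : List ℕ → ℝ}
    (h : ∀ j ≤ b, LinearizesAt q i j (QSPP.rowDer q i b d j)) : LinearizesAt q (i + 1) b d := by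
  have key : ∀ j ≤ b, LinearizesAt q (i + 1) j (QSPP.rowChain q i b d (b - j)) := by
    intro j
    induction j with
    | zero => exact fun hj => .of_der_zero hq hi (h 0 hj)
    | succ j ih =>
      intro hj
      refine .of_der hq hi (h _ hj) ?_
      have := ih (by omega)
      have h1 : b - j = b - (j + 1) + 1 := by omega
      rw [h1, QSPP.rowChain] at this
      rwa [← h1, Nat.sub_sub_self (by omega)] at this
  simpa [QSPP.rowChain] using key b le_rfl

/-- If the interaction costs of the paths to `(i, b)` are linear, then so are those of the paths to
`(i, j)`, for all `j ≤ b`. -/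
theorem LinearizesAt.exists_of_le {q : List ℕ → List ℕ → ℝ} (hq : SymmZeroDiag q) {i b : ℕ}
    (hi : 0 < i) {d : List ℕ → ℝ} (h : LinearizesAt q i b d) {j : ℕ} (hj : j ≤ b) :
    ∃ d', LinearizesAt q i j d' := by
  obtain ⟨i, rfl⟩ : ∃ i', i = i' + 1 := ⟨i - 1, by omega⟩
  have := h.rowChain hq (b - j) (by omega)
  rw [Nat.sub_sub_self hj] at this
  exact ⟨_, this⟩

/-- The row pass in mathematical terms. -/
theorem linearizesAt_iff_row {q : List ℕ → List ℕ → ℝ} (hq : SymmZeroDiag q) {i b : ℕ}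
    (hi : 0 < i) {d : List ℕ → ℝ}
    (h : ∀ j < b, (∃ d', LinearizesAt q i j d') → LinearizesAt q i j (rowDer q i b d j)) :
    LinearizesAt q (i + 1) b d ↔ LinearizesAt q i b (rowDer q i b d b) := by
  refine ⟨fun h' => h'.rowDer hq hi le_rfl, fun h' => .of_rowDer hq hi fun j hj => ?_⟩
  -- For `j < b` the hypothesis `h` is only conditional; linearity at `(i, b)` provides its premise
  -- by derivation along row `i`.
  rcases hj.lt_or_eq with hj' | rfl
  · exact h j hj' (h'.exists_of_le hq hi hj)
  · exact h'

/-! ### The row pass as a program -/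

theorem der_congr {q : List ℕ → List ℕ → ℝ} {h e : List ℕ} {d d' : List ℕ → ℝ}
    (he : d e = d' e) (hh : d h = d' h) : der q h d e = der q h d' e := by
  simp only [der, he, hh]

theorem eval_isOk {τ : State ℝ} : isOk.eval τ = true ↔ τ.reg .ok = 1 := by
  simp only [isOk, BExp.eval, NExp.eval, one]
  exact decide_eq_true_iff

/-- The registers written by `rowPass`. -/
def rowRegs : List Reg := .ok :: .j :: .m :: scratch

/-- The arrays written by `rowPass`. -/
def rowArrs : List Arr := [.chain, .pc, .cHat, .cur, .cost, .start, .tmp]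

/-- The memory holds the input of a pass for row `i`. -/
structure RowInput (q : List ℕ → List ℕ → ℝ) (i a b : ℕ) (σ : State ℝ) : Prop where
  symm : SymmZeroDiag q
  holds : HoldsQ q a b σ
  reg_i : σ.reg .i = i
  reg_q : σ.reg .q = b + 1
  pos : 0 < i
  lt : i < a

theorem RowInput.frame {q : List ℕ → List ℕ → ℝ} {i a b : ℕ} {σ τ : State ℝ}
    (h : RowInput q i a b σ) (hf : Frame rowRegs rowArrs σ τ) : RowInput q i a b τ where
  symm := h.symm
  holds := h.holds.frame hf (by simp [rowArrs])
  reg_i := by rw [hf.1 _ (by simp [rowRegs, scratch]), h.reg_i]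
  reg_q := by rw [hf.1 _ (by simp [rowRegs, scratch]), h.reg_q]
  pos := h.pos
  lt := h.lt

theorem RowInput.fixed_i {q : List ℕ → List ℕ → ℝ} {i a b : ℕ} {σ : State ℝ}
    (h : RowInput q i a b σ) : Fixed (.reg .i) σ i := fun τ hτ => by
  simp [NExp.eval, hτ .i (by simp [scratch]), h.reg_i]

theorem RowInput.fixed_i' {q : List ℕ → List ℕ → ℝ} {i a b : ℕ} {σ : State ℝ}
    (h : RowInput q i a b σ) : Fixed (.add (.reg .i) one) σ (i + 1) := fun τ hτ => by
  simp [NExp.eval, one, hτ .i (by simp [scratch]), h.reg_i]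

theorem RowInput.fixed_ql {q : List ℕ → List ℕ → ℝ} {i a b : ℕ} {σ : State ℝ}
    (h : RowInput q i a b σ) : Fixed (.sub (.reg .q) one) σ b := fun τ hτ => by
  simp [NExp.eval, one, hτ .q (by simp [scratch]), h.reg_q]

theorem fixed_reg {z : Reg} (hz : z ∉ Reg.ok :: scratch) {σ : State ℝ} {n : ℕ}
    (h : σ.reg z = n) : Fixed (.reg z) σ n := fun τ hτ => by simp [NExp.eval, hτ z hz, h]

theorem fixed_reg_succ {z : Reg} (hz : z ∉ Reg.ok :: scratch) {σ : State ℝ} {n : ℕ}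
    (h : σ.reg z = n) : Fixed (.add (.reg z) one) σ (n + 1) := fun τ hτ => by
  simp [NExp.eval, one, hτ z hz, h]

/-- The entries of the array `chain` are those of `rowChain`, for the columns from `k` on. -/
def HoldsChain (q : List ℕ → List ℕ → ℝ) (i b : ℕ) (d : List ℕ → ℝ) (k : ℕ) (τ : State ℝ) : Prop :=
  ∀ j, k ≤ j → j ≤ b → ∀ e, InGrid (i + 1) j e →
    τ.arr .chain (j :: e) = rowChain q i b d (b - j) e

/-- The loop fills `chain` from the right: column `j` is derived from column `j + 1` in the same
array, and the leading index keeps the two vectors apart. -/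
theorem exec_chain {q : List ℕ → List ℕ → ℝ} {i a b : ℕ} {σ : State ℝ}
    (h : RowInput q i a b σ) :
    let σ' := (block
      [ copy ⟨.cur, []⟩ ⟨.chain, [.sub (.reg .q) one]⟩ (.add (.reg .i) one) (.sub (.reg .q) one),
        .loop .m (.sub (.reg .q) one) (block
        [ .setN .j (.sub (.sub (.sub (.reg .q) one) one) (.reg .m)),
          derive ⟨.chain, [.add (.reg .j) one]⟩ ⟨.chain, [.reg .j]⟩ (.add (.reg .i) one) (.reg .j)
            (right (.add (.reg .i) one) (.reg .j)) ]) ]).exec σ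
    Frame (.j :: .m :: scratch) [.chain] σ σ' ∧ HoldsChain q i b (σ.arr .cur) 0 σ' := by
  have hlt := h.lt
  simp only [exec_block_cons, exec_block_nil]
  have C := exec_copy (A := ⟨.cur, []⟩) (B := ⟨.chain, [.sub (.reg .q) one]⟩) h.fixed_i'
    h.fixed_ql (by simp) (preA := []) (preB := [b]) (fun τ hτ => by simp)
    (fun τ hτ => by simp [h.fixed_ql.eval hτ (by simp [scratch])])
  generalize Stmt.exec _ σ = σ₁ at C ⊢
  have hF : Frame (.j :: .m :: scratch) [.chain] σ σ₁ := C.1.mono (by simp [scratch]) (by simp)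
  have L := loop_rule' (x := .m) (σ := σ₁) (n := .sub (.reg .q) one) (N := b) (b := block
        [ .setN .j (.sub (.sub (.sub (.reg .q) one) one) (.reg .m)),
          derive ⟨.chain, [.add (.reg .j) one]⟩ ⟨.chain, [.reg .j]⟩ (.add (.reg .i) one) (.reg .j)
            (right (.add (.reg .i) one) (.reg .j)) ])
    ((h.frame (hF.mono (by simp [rowRegs, scratch]) (by simp [rowArrs]))).fixed_ql.eval
      (.refl [] [] σ₁) (by simp))
    (fun k τ => Frame (.j :: .m :: scratch) [.chain] σ τ ∧
      HoldsChain q i b (σ.arr .cur) (b - k) τ) ⟨hF, ?_⟩ ?_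
  · rwa [Nat.sub_self] at L
  · intro j hj hj' e he
    obtain rfl : j = b := by omega
    have := C.2 e he
    rw [Nat.sub_self]; exact this
  · rintro k hk τ ⟨hτ, hch⟩
    have hτ1 := hτ.trans (Frame.setReg [.chain] τ (z := .m) (rs := .j :: .m :: scratch)
      (by simp) k)
    have R1 := h.frame (hτ1.mono (rs' := rowRegs) (As' := rowArrs) (by simp [rowRegs])
      (by simp [rowArrs]))
    have ev : NExp.eval (τ.setReg .m k) (.sub (.sub (.sub (.reg .q) one) one) (.reg .m)) =
        b - (k + 1) := by
      have := R1.reg_q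
      simp only [NExp.eval, one, this]; simp; omega
    rw [exec_block_cons, exec_block_cons, exec_block_nil, exec_setN, ev]
    set j := b - (k + 1) with hj
    have hτ2 := hτ1.trans (Frame.setReg [.chain] (τ.setReg .m k) (z := .j)
      (rs := .j :: .m :: scratch) (by simp) j)
    have hj2 : ((τ.setReg .m k).setReg .j j).reg .j = j := by simp
    have hch2 : HoldsChain q i b (σ.arr .cur) (j + 1) ((τ.setReg .m k).setReg .j j) := by
      have : b - k = j + 1 := by omega
      rw [this] at hch; exact hch
    generalize (τ.setReg .m k).setReg .j j = τ₂ at hτ2 hj2 hch2 ⊢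
    have R2 := h.frame (hτ2.mono (rs' := rowRegs) (As' := rowArrs) (by simp [rowRegs])
      (by simp [rowArrs]))
    have fj := fixed_reg (z := .j) (by simp [scratch]) hj2
    have fj1 := fixed_reg_succ (z := .j) (by simp [scratch]) hj2
    have D := exec_derive (A := ⟨.chain, [.add (.reg .j) one]⟩) (B := ⟨.chain, [.reg .j]⟩)
      (h := right (.add (.reg .i) one) (.reg .j)) R2.holds (by simp) R2.fixed_i' fj
      hlt (by omega) (preA := [j + 1]) (preB := [j]) (hc := rt (i + 1) j)
      (fun ρ hρ => by simp [fj1.eval hρ (by simp [scratch])])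
      (fun ρ hρ => by simp [fj.eval hρ (by simp [scratch])])
      (fun ρ hρ => by simp [right, rt, NExp.eval, hρ.1 .i (by simp), hρ.1 .j (by simp), R2.reg_i,
        hj2, one])
      (inGrid_rt.2 (by omega)) (Or.inr (by simp))
    refine ⟨hτ2.trans (D.1.mono (by simp [scratch]) (by simp)), fun j' hj' hj'' e he => ?_⟩
    rcases hj'.eq_or_lt with rfl | hlt'
    · have hbj : b - j = (b - (j + 1)) + 1 := by omega
      refine (D.2.2 e he).trans ?_
      rw [hbj, rowChain, ← hbj, Nat.sub_sub_self (by omega)]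
      exact der_congr (hch2 (j + 1) le_rfl (by omega) e (he.mono le_rfl (by omega)))
        (hch2 (j + 1) le_rfl (by omega) _ (inGrid_rt.2 (by omega)))
    · rw [← hch2 j' hlt' hj'' e he]
      exact D.2.1 _ fun e' => by simp; omega

/-- Derivation from `chain` and reduction. -/
theorem exec_derive_reduce {q : List ℕ → List ℕ → ℝ} {i a b : ℕ} {σ : State ℝ}
    (h : RowInput q i a b σ) {d : List ℕ → ℝ} (hch : HoldsChain q i b d 0 σ) {j : ℕ}
    (hj : j ≤ b) {jE : NExp} (hjE : Fixed jE σ j) :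
    let σ' := (reduce ⟨.cHat, []⟩ (.reg .i) jE).exec
      ((derive ⟨.chain, [jE]⟩ ⟨.cHat, []⟩ (.reg .i) jE (down (.reg .i) jE)).exec σ)
    Frame scratch [.cHat, .tmp] σ σ' ∧ ReducedOn i j (σ'.arr .cHat) ∧
      (LinearizesAt q i j (σ'.arr .cHat) ↔ LinearizesAt q i j (rowDer q i b d j)) := by
  have hlt := h.lt
  have D := exec_derive (A := ⟨.chain, [jE]⟩) (B := ⟨.cHat, []⟩)
      (h := down (.reg .i) jE) h.holds (by simp) h.fixed_i hjE
      hlt.le hj (preA := [j]) (preB := []) (hc := dn i j)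
      (fun ρ hρ => by simp [hjE.eval hρ (by simp [scratch])])
      (fun ρ hρ => by simp)
      (fun ρ hρ => by simp [down, dn, NExp.eval, hρ.1 .i (by simp), h.reg_i,
        hjE.eval hρ (by simp [scratch])])
      (inGrid_dn.2 (by omega)) (Or.inl (by simp))
  generalize Stmt.exec _ σ = σ₁ at D ⊢
  have R := exec_reduce (N := .cHat) (by simp) (h.fixed_i.frame D.1) (hjE.frame D.1)
  refine ⟨(D.1.mono (by simp [scratch]) (by simp)).trans R.1, R.2.2, ?_⟩
  have e : ∀ e, InGrid i j e → σ₁.arr .cHat e = rowDer q i b d j e := fun e he =>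
    (D.2.2 e he).trans (der_congr (hch j (Nat.zero_le _) hj e (he.mono (by omega) le_rfl))
      (hch j (Nat.zero_le _) hj _ (inGrid_dn.2 (by omega))))
  have e' : ∀ P, GridPath i j P → lin (rowDer q i b d j) P =
      lin (((reduce ⟨.cHat, []⟩ (.reg .i) jE).exec σ₁).arr .cHat) P := fun P hP => by
    rw [R.2.1 P hP]
    exact lin_congr fun f hf => (e f (hP.inGrid f hf)).symm
  exact ⟨fun h' P hP => by rw [h' P hP, e' P hP], fun h' P hP => by rw [h' P hP, e' P hP]⟩

/-- The specification of a pass of the outer loop. -/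
theorem exec_rowPass {q : List ℕ → List ℕ → ℝ} {i a b : ℕ} {σ : State ℝ}
    (h : RowInput q i a b σ) (hok : σ.reg .ok = 1) :
    Frame rowRegs rowArrs σ (rowPass.exec σ) ∧
    (((rowPass.exec σ).reg .ok = 1 ∧ ReducedOn i b ((rowPass.exec σ).arr .cur) ∧
      (LinearizesAt q (i + 1) b (σ.arr .cur) ↔ LinearizesAt q i b ((rowPass.exec σ).arr .cur))) ∨
    ((rowPass.exec σ).reg .ok = 0 ∧ ¬ LinearizesAt q (i + 1) b (σ.arr .cur))) := by
  have hlt := h.lt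
  have hpos := h.pos
  set d := σ.arr .cur with hd
  have C := exec_chain h
  simp only [rowPass]
  rw [exec_block_cons, exec_block_cons]
  simp only [exec_block_cons (copy _ _ _ _), exec_block_cons (Stmt.loop .m _ _), exec_block_nil]
    at C
  generalize Stmt.exec _ (Stmt.exec _ σ) = σ₁ at C ⊢
  obtain ⟨hF, hch⟩ := C
  have hok₁ : σ₁.reg .ok = 1 := by rw [hF.1 _ (by simp [scratch]), hok]
  replace hF : Frame rowRegs rowArrs σ σ₁ := hF.mono (by simp [rowRegs, scratch]) (by simp [rowArrs])
  rw [exec_block_cons]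
  have L := loop_rule' (x := .j) (σ := σ₁) (n := .sub (.reg .q) one) (N := b)
    (b := when isOk (block
        [ pseudoLin ⟨.pc, []⟩ (.reg .i) (.reg .j),
          derive ⟨.chain, [.reg .j]⟩ ⟨.cHat, []⟩ (.reg .i) (.reg .j) (down (.reg .i) (.reg .j)),
          reduce ⟨.cHat, []⟩ (.reg .i) (.reg .j),
          compare ⟨.cHat, []⟩ ⟨.pc, []⟩ (.reg .i) (.reg .j) ]))
    ((h.frame hF).fixed_ql.eval (.refl [] [] σ₁) (by simp))
    -- A successful test does not show that the derived vector linearizes, only that it does if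
    -- anything does. A failed test, in contrast, already refutes linearity at `(i + 1, b)`.
    (fun k τ => Frame rowRegs rowArrs σ τ ∧ HoldsChain q i b d 0 τ ∧
      ((τ.reg .ok = 1 ∧ ∀ j < k, (∃ d', LinearizesAt q i j d') →
          LinearizesAt q i j (rowDer q i b d j)) ∨
        (τ.reg .ok = 0 ∧ ¬ LinearizesAt q (i + 1) b d))) ?_ ?_
  · generalize Stmt.exec _ σ₁ = σ₂ at L ⊢
    obtain ⟨hF₂, hch₂, h1 | h1⟩ := L
    · rw [exec_block_cons, exec_when, if_pos (eval_isOk.2 h1.1), exec_block_nil]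
      simp only [exec_block_cons, exec_block_nil]
      have R₂ := h.frame hF₂
      have D := exec_derive_reduce R₂ hch₂ le_rfl R₂.fixed_ql
      generalize Stmt.exec _ (Stmt.exec _ σ₂) = σ₃ at D ⊢
      have hF₃ : Frame rowRegs rowArrs σ σ₃ :=
        hF₂.trans (D.1.mono (by simp [rowRegs, scratch]) (by simp [rowArrs]))
      have hok₃ : σ₃.reg .ok = 1 := by rw [D.1.1 _ (by simp [scratch]), h1.1]
      have R₃ := h.frame hF₃
      have K := exec_copy (A := ⟨.cHat, []⟩) (B := ⟨.cur, []⟩) R₃.fixed_i R₃.fixed_ql (by simp)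
        (preA := []) (preB := []) (fun _ _ => rfl) (fun _ _ => rfl)
      generalize Stmt.exec _ σ₃ = σ₄ at K ⊢
      refine ⟨hF₃.trans (K.1.mono (by simp [rowRegs, scratch]) (by simp [rowArrs])), Or.inl
        ⟨by rw [K.1.1 _ (by simp), hok₃], D.2.1.congr K.2, ?_⟩⟩
      rw [linearizesAt_iff_row h.symm h.pos h1.2, ← D.2.2]
      exact ⟨fun h' => h'.congr fun e he => (K.2 e he).symm, fun h' => h'.congr K.2⟩
    · rw [exec_block_cons, exec_when, if_neg (by rw [eval_isOk]; omega), exec_block_nil]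
      exact ⟨hF₂, Or.inr h1⟩
  · exact ⟨hF, hch, Or.inl ⟨hok₁, by simp⟩⟩
  · rintro j hj τ ⟨hτ, hch₂, h1⟩
    have hτ1 := hτ.trans (Frame.setReg rowArrs τ (z := .j) (rs := rowRegs) (by simp [rowRegs]) j)
    have hch1 : HoldsChain q i b d 0 (τ.setReg .j j) := hch₂
    have hok1 : (τ.setReg .j j).reg .ok = τ.reg .ok := by simp
    have hj1 : (τ.setReg .j j).reg .j = j := by simp
    generalize τ.setReg .j j = τ₁ at hτ1 hch1 hok1 hj1 ⊢
    rw [← hok1] at h1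
    rw [exec_when]
    rcases h1 with h1 | h1
    swap
    · rw [if_neg (by rw [eval_isOk]; omega)]
      exact ⟨hτ1, hch1, Or.inr h1⟩
    rw [if_pos (eval_isOk.2 h1.1)]
    simp only [exec_block_cons, exec_block_nil]
    have R₁ := h.frame hτ1
    have fj := fixed_reg (z := .j) (by simp [scratch]) hj1
    have PL := exec_pseudoLin h.symm (N := .pc) (by simp) R₁.holds R₁.fixed_i fj hlt.le hj.le hpos
    generalize Stmt.exec _ τ₁ = τ₂ at PL ⊢
    have hτ2 : Frame rowRegs rowArrs σ τ₂ :=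
      hτ1.trans (PL.1.mono (by simp [rowRegs, scratch]) (by simp [rowArrs]))
    have hok2 : τ₂.reg .ok = 1 := by rw [PL.1.1 _ (by simp [scratch]), h1.1]
    have R₂ := h.frame hτ2
    have hch2 : HoldsChain q i b d 0 τ₂ := by
      intro j' h1 h2 e he; rw [PL.1.2 _ (by simp)]; exact hch1 j' h1 h2 e he
    have fj2 := fj.frame PL.1 (by simp)
    have D := exec_derive_reduce R₂ hch2 hj.le fj2
    generalize Stmt.exec _ (Stmt.exec _ τ₂) = τ₃ at D ⊢
    have hτ3 : Frame rowRegs rowArrs σ τ₃ :=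
      hτ2.trans (D.1.mono (by simp [rowRegs, scratch]) (by simp [rowArrs]))
    have hok3 : τ₃.reg .ok = 1 := by rw [D.1.1 _ (by simp [scratch]), hok2]
    have hpc : ∀ e, InGrid i j e → τ₃.arr .pc e = plin q i j e := fun e he => by
      rw [D.1.2 _ (by simp), PL.2 e he]
    have hch3 : HoldsChain q i b d 0 τ₃ := by
      intro j' h1 h2 e he; rw [D.1.2 _ (by simp)]; exact hch2 j' h1 h2 e he
    have K := exec_compare (A := .cHat) (B := .pc) (h.frame hτ3).fixed_i
      (fj2.frame D.1 (by simp))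
    generalize Stmt.exec _ τ₃ = τ₄ at K ⊢
    refine ⟨hτ3.trans (K.1.mono (by simp [rowRegs, scratch]) (by simp)), ?_, ?_⟩
    · intro j' h1 h2 e he; rw [K.1.2 _ (by simp)]; exact hch3 j' h1 h2 e he
    -- If the vectors agree, then any linearization at `(i, j)` makes `plin`, and hence the derived
    -- vector, a linearization. If they differ, linearity at `(i + 1, b)` is impossible, since it
    -- would make the reduced derived vector equal to `plin`.
    · by_cases heq : ∀ e, InGrid i j e → τ₃.arr .cHat e = τ₃.arr .pc e
      · refine Or.inl ⟨by rw [K.2.1 heq, hok3], fun j' hj' hex => ?_⟩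
        rcases (Nat.lt_succ_iff.1 hj').lt_or_eq with hlt' | rfl
        · exact h1.2 j' hlt' hex
        · obtain ⟨d', hd'⟩ := hex
          rw [← D.2.2]
          exact (hd'.plin hpos).congr fun e he => by rw [heq e he, hpc e he]
      · refine Or.inr ⟨K.2.2 heq, fun hlin => heq fun e he => ?_⟩
        rw [hpc e he]
        exact D.2.1.eq_plin hpos (D.2.2.2 (hlin.rowDer h.symm hpos hj.le)) he

/-! ## The whole algorithm -/

/-- The registers written by the algorithm. -/
def allRegs : List Reg := .k :: .i :: rowRegs

/-- The arrays written by the algorithm. -/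
def allArrs : List Arr := .pcHat :: .out :: rowArrs

/-- The memory holds the size of the grid and the interaction matrix. -/
structure GridInput (q : List ℕ → List ℕ → ℝ) (a b : ℕ) (σ : State ℝ) : Prop where
  symm : SymmZeroDiag q
  holds : HoldsQ q a b σ
  reg_p : σ.reg .p = a + 1
  reg_q : σ.reg .q = b + 1
  pos : 0 < a

theorem GridInput.frame {q : List ℕ → List ℕ → ℝ} {a b : ℕ} {σ τ : State ℝ}
    (h : GridInput q a b σ) (hf : Frame allRegs allArrs σ τ) : GridInput q a b τ where
  symm := h.symm
  holds := h.holds.frame hf (by simp [allArrs, rowArrs])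
  reg_p := by rw [hf.1 _ (by simp [allRegs, rowRegs, scratch]), h.reg_p]
  reg_q := by rw [hf.1 _ (by simp [allRegs, rowRegs, scratch]), h.reg_q]
  pos := h.pos

theorem GridInput.fixed_pl {q : List ℕ → List ℕ → ℝ} {a b : ℕ} {σ : State ℝ}
    (h : GridInput q a b σ) : Fixed (.sub (.reg .p) one) σ a := fun τ hτ => by
  simp [NExp.eval, one, hτ .p (by simp [scratch]), h.reg_p]

theorem GridInput.fixed_ql {q : List ℕ → List ℕ → ℝ} {a b : ℕ} {σ : State ℝ}
    (h : GridInput q a b σ) : Fixed (.sub (.reg .q) one) σ b := fun τ hτ => by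
  simp [NExp.eval, one, hτ .q (by simp [scratch]), h.reg_q]

/-- The outer loop. -/
theorem exec_rows {q : List ℕ → List ℕ → ℝ} {a b : ℕ} {σ : State ℝ} (h : GridInput q a b σ)
    (hok : σ.reg .ok = 1) (hred : ReducedOn a b (σ.arr .cur)) :
    let σ' := (Stmt.loop .k (.sub (.sub (.reg .p) one) one) (when isOk (.seq
        (.setN .i (.sub (.sub (.sub (.reg .p) one) one) (.reg .k))) rowPass))).exec σ
    Frame (.k :: .i :: rowRegs) rowArrs σ σ' ∧
    ((σ'.reg .ok = 1 ∧ ReducedOn 1 b (σ'.arr .cur) ∧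
      (LinearizesAt q a b (σ.arr .cur) ↔ LinearizesAt q 1 b (σ'.arr .cur))) ∨
    (σ'.reg .ok = 0 ∧ ¬ LinearizesAt q a b (σ.arr .cur))) := by
  have hpos := h.pos
  have hn : NExp.eval σ (.sub (.sub (.reg .p) one) one) = a - 1 := by
    simp only [NExp.eval, one, h.reg_p]; simp
  have L := loop_rule' (x := .k) (σ := σ) hn (b := when isOk (.seq
        (.setN .i (.sub (.sub (.sub (.reg .p) one) one) (.reg .k))) rowPass))
    -- After `k` successful passes the current target lies in row `a - k`, so `a - 1` passes lead to
    -- row `1`.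
    (fun k τ => Frame (.k :: .i :: rowRegs) rowArrs σ τ ∧
      ((τ.reg .ok = 1 ∧ ReducedOn (a - k) b (τ.arr .cur) ∧
      (LinearizesAt q a b (σ.arr .cur) ↔ LinearizesAt q (a - k) b (τ.arr .cur))) ∨
      (τ.reg .ok = 0 ∧ ¬ LinearizesAt q a b (σ.arr .cur))))
    ⟨.refl _ _ _, Or.inl ⟨hok, hred, Iff.rfl⟩⟩ ?_
  · rwa [show a - (a - 1) = 1 by omega] at L
  · rintro k hk τ ⟨hτ, h1⟩
    have hτ1 := hτ.trans (Frame.setReg rowArrs τ (z := .k) (rs := .k :: .i :: rowRegs)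
      (by simp) k)
    have hcur1 : (τ.setReg .k k).arr .cur = τ.arr .cur := rfl
    have hok1 : (τ.setReg .k k).reg .ok = τ.reg .ok := by simp
    have hk1 : (τ.setReg .k k).reg .k = k := by simp
    generalize τ.setReg .k k = τ₁ at hτ1 hcur1 hok1 hk1 ⊢
    rw [← hok1, ← hcur1] at h1
    rw [exec_when]
    rcases h1 with h1 | h1
    swap
    · rw [if_neg (by rw [eval_isOk]; omega)]
      exact ⟨hτ1, Or.inr h1⟩
    rw [if_pos (eval_isOk.2 h1.1), exec_seq, exec_setN]
    have G₁ := h.frame (hτ1.mono (fun _ h => h) (by simp [allArrs]))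
    have ev : NExp.eval τ₁ (.sub (.sub (.sub (.reg .p) one) one) (.reg .k)) = a - (k + 1) := by
      simp only [NExp.eval, one, G₁.reg_p, hk1]; omega
    rw [ev]
    set i := a - (k + 1) with hi
    have hai : a - k = i + 1 := by omega
    rw [hai] at h1
    have hτ2 := hτ1.trans (Frame.setReg rowArrs τ₁ (z := .i) (rs := .k :: .i :: rowRegs)
      (by simp) i)
    have hcur2 : (τ₁.setReg .i i).arr .cur = τ₁.arr .cur := rfl
    have hok2 : (τ₁.setReg .i i).reg .ok = 1 := by simpa using h1.1
    have hi2 : (τ₁.setReg .i i).reg .i = i := by simp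
    generalize τ₁.setReg .i i = τ₂ at hτ2 hcur2 hok2 hi2 ⊢
    have G₂ := h.frame (hτ2.mono (fun _ h => h) (by simp [allArrs]))
    have R := exec_rowPass (i := i) (a := a) (b := b) ⟨h.symm, G₂.holds, hi2, G₂.reg_q,
      by omega, by omega⟩ hok2
    generalize rowPass.exec τ₂ = τ₃ at R ⊢
    rw [hcur2, ← h1.2.2] at R
    exact ⟨hτ2.trans (R.1.mono (by simp) (fun _ h => h)), R.2⟩

theorem exec_linearizeGridQSPP {q : List ℕ → List ℕ → ℝ} {a b : ℕ} {σ : State ℝ}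
    {τ : State ℝ} (h : GridInput q a b σ) (hτ : linearizeGridQSPP.exec σ = τ) :
    (τ.reg .ok = 1 ∧ LinearizesAt q a b (plin q a b) ∧ ReducedOn a b (τ.arr .out) ∧
      ∀ P, GridPath a b P → lin (τ.arr .out) P = lin (plin q a b) P + lin (σ.arr .c) P) ∨
    (τ.reg .ok = 0 ∧ ¬ LinearizesAt q a b (plin q a b)) := by
  have hpos := h.pos
  simp only [linearizeGridQSPP, exec_block_cons, exec_block_nil] at hτ
  rw [exec_setN] at hτ
  have F₁ := Frame.setReg allArrs σ (z := .ok) (rs := allRegs) (by simp [allRegs, rowRegs])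
    (NExp.eval σ one)
  have ok₁ : (σ.setReg .ok (NExp.eval σ one)).reg .ok = 1 := by simp [one, NExp.eval]
  generalize σ.setReg .ok (NExp.eval σ one) = σ₁ at F₁ ok₁ hτ
  have G₁ := h.frame F₁
  have A₁ := exec_pseudoLin h.symm (N := .pcHat) (by simp) G₁.holds G₁.fixed_pl G₁.fixed_ql
    le_rfl le_rfl hpos
  generalize Stmt.exec _ σ₁ = σ₂ at A₁ hτ
  have F₂ := F₁.trans (A₁.1.mono (rs' := allRegs) (As' := allArrs)
    (by simp [allRegs, rowRegs, scratch]) (by simp [allArrs, rowArrs]))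
  have ok₂ : σ₂.reg .ok = 1 := by rw [A₁.1.1 _ (by simp [scratch]), ok₁]
  have hpc₂ := A₁.2
  have G₂ := h.frame F₂
  have A₂ := exec_copy (A := ⟨.pcHat, []⟩) (B := ⟨.cur, []⟩) G₂.fixed_pl G₂.fixed_ql (by simp)
    (preA := []) (preB := []) (fun _ _ => rfl) (fun _ _ => rfl)
  generalize Stmt.exec _ σ₂ = σ₃ at A₂ hτ
  have F₃ := F₂.trans (A₂.1.mono (rs' := allRegs) (As' := allArrs)
    (by simp [allRegs, rowRegs, scratch]) (by simp [allArrs, rowArrs]))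
  have ok₃ : σ₃.reg .ok = 1 := by rw [A₂.1.1 _ (by simp), ok₂]
  have hpc₃ : ∀ e, InGrid a b e → σ₃.arr .pcHat e = plin q a b e := fun e he => by
    rw [A₂.1.2 _ (by simp), hpc₂ e he]
  have hcur₃ : ∀ e, InGrid a b e → σ₃.arr .cur e = plin q a b e := fun e he =>
    (A₂.2 e he).trans (hpc₂ e he)
  clear A₁ A₂ G₁ G₂ F₁ F₂ ok₁ ok₂ hpc₂
  have G₃ := h.frame F₃
  -- The descent starts from a reduced vector, namely `plin` itself. This matters for `a = 1`, when
  -- there is no pass and the final comparison still needs a reduced vector.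
  have A₃ := exec_rows G₃ ok₃ ((reducedOn_plin q a b).congr hcur₃)
  generalize Stmt.exec _ σ₃ = σ₄ at A₃ hτ
  have F₄ := F₃.trans (A₃.1.mono (rs' := allRegs) (As' := allArrs)
    (by simp [allRegs]) (by simp [allArrs]))
  have hpc₄ : ∀ e, InGrid a b e → σ₄.arr .pcHat e = plin q a b e := fun e he => by
    rw [A₃.1.2 _ (by simp [rowArrs]), hpc₃ e he]
  have hiff : LinearizesAt q a b (σ₃.arr .cur) ↔ LinearizesAt q a b (plin q a b) :=
    ⟨fun h' => h'.congr hcur₃, fun h' => h'.congr fun e he => (hcur₃ e he).symm⟩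
  have A₄ := A₃.2
  rw [hiff] at A₄
  clear A₃ G₃ hpc₃ hcur₃ hiff
  have G₄ := h.frame F₄
  rw [exec_when isOk _ σ₄] at hτ
  rcases A₄ with A₄ | A₄
  swap
  · rw [if_neg (show ¬ isOk.eval σ₄ = true by rw [eval_isOk]; omega), exec_when,
      if_neg (show ¬ isOk.eval σ₄ = true by rw [eval_isOk]; omega)] at hτ
    exact Or.inr (hτ ▸ A₄)
  rw [if_pos (eval_isOk.2 A₄.1)] at hτ
  simp only [exec_block_cons, exec_block_nil] at hτ
  have A₅ := exec_pseudoLin h.symm (N := .pc) (a := one) (α := 1) (by simp) G₄.holds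
    (fun _ _ => rfl) G₄.fixed_ql hpos le_rfl one_pos
  generalize Stmt.exec _ σ₄ = σ₅ at A₅ hτ
  have F₅ := F₄.trans (A₅.1.mono (rs' := allRegs) (As' := allArrs)
    (by simp [allRegs, rowRegs, scratch]) (by simp [allArrs, rowArrs]))
  have ok₅ : σ₅.reg .ok = 1 := by rw [A₅.1.1 _ (by simp [scratch]), A₄.1]
  have hpc₅ : ∀ e, InGrid a b e → σ₅.arr .pcHat e = plin q a b e := fun e he => by
    rw [A₅.1.2 _ (by simp), hpc₄ e he]
  have hcur₅ : σ₅.arr .cur = σ₄.arr .cur := A₅.1.2 _ (by simp)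
  rw [← hcur₅] at A₄
  have G₅ := h.frame F₅
  have A₆ := exec_compare (A := .cur) (B := .pc) (a := one) (α := 1) (fun _ _ => rfl) G₅.fixed_ql
  generalize Stmt.exec _ σ₅ = σ₆ at A₆ hτ
  have F₆ := F₅.trans (A₆.1.mono (rs' := allRegs) (As' := allArrs)
    (by simp [allRegs, rowRegs, scratch]) (by simp))
  rw [exec_when] at hτ
  by_cases heq : ∀ e, InGrid 1 b e → σ₅.arr .cur e = σ₅.arr .pc e
  swap
  · have ok₆ := A₆.2.2 heq
    rw [if_neg (by rw [eval_isOk]; omega)] at hτ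
    subst hτ
    -- Linearity at `(a, b)` would descend to row `1` and force the reduced vector found there to be
    -- the pseudo-linearization.
    refine Or.inr ⟨ok₆, fun hlin => heq fun e he => ?_⟩
    rw [A₅.2 e he]
    exact A₄.2.1.eq_plin one_pos (A₄.2.2.1 hlin) he
  have ok₆ := (A₆.2.1 heq).trans ok₅
  -- Agreement in row `1` is conclusive, since there `plin` linearizes unconditionally; the
  -- equivalences of the passes carry this back to `(a, b)`.
  have hlin : LinearizesAt q a b (plin q a b) := A₄.2.2.2
    ((linearizesAt_plin_one q).congr fun e he => by rw [heq e he, A₅.2 e he])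
  rw [if_pos (eval_isOk.2 ok₆)] at hτ
  simp only [exec_block_cons, exec_block_nil] at hτ
  have hpc₆ : ∀ e, InGrid a b e → σ₆.arr .pcHat e = plin q a b e := fun e he => by
    rw [A₆.1.2 _ (by simp), hpc₅ e he]
  have G₆ := h.frame F₆
  have hc₆ : σ₆.arr .c = σ.arr .c := F₆.2 _ (by simp [allArrs, rowArrs])
  have A₇ := forArcs_map G₆.fixed_pl G₆.fixed_ql .out []
    (fun e => plin q a b e + σ.arr .c e)
    (body := fun e => (⟨.out, []⟩ : Vec).set e (.add ((⟨.pcHat, []⟩ : Vec).at e)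
      ((⟨.c, []⟩ : Vec).at e))) (by
      intro ρ d hρ _ hd
      have h1 := hρ.2 .pcHat (by simp)
      have h2 := hρ.2 .c (by simp)
      have h3 := hpc₆ _ hd
      simp [Vec.set, Vec.at, RExp.eval, NExp.eval, h1, h2, h3, hc₆])
  generalize Stmt.exec _ σ₆ = σ₇ at A₇ hτ
  have A₈ := exec_reduce (N := .out) (by simp) (G₆.fixed_pl.frame A₇.1) (G₆.fixed_ql.frame A₇.1)
  rw [hτ] at A₈
  refine Or.inl ⟨?_, hlin, A₈.2.2, fun P hP => ?_⟩
  · rw [A₈.1.1 _ (by simp [scratch]), A₇.1.1 _ (by simp), ok₆]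
  · rw [A₈.2.1 P hP, ← lin_add]
    exact lin_congr fun e he => A₇.2.2 e (hP.inGrid e he)

/-! ## Paths of the grid graph and lists of arc codes -/

section Bridge

variable {p q : ℕ}

theorem code_cases (e : Arc (grid p q)) :
    (code e = rt e.tail.1 e.tail.2 ∧ e.head.1.val = e.tail.1.val ∧
      e.head.2.val = e.tail.2.val + 1) ∨
    (code e = dn e.tail.1 e.tail.2 ∧ e.head.1.val = e.tail.1.val + 1 ∧
      e.head.2.val = e.tail.2.val) := by
  have h : (e.tail.1.val + 1 = e.head.1.val ∧ e.tail.2 = e.head.2) ∨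
    (e.tail.1 = e.head.1 ∧ e.tail.2.val + 1 = e.head.2.val) := e.2
  rcases h with ⟨h1, h2⟩ | ⟨h1, h2⟩
  · right
    have : e.head.1 ≠ e.tail.1 := fun h => by rw [h] at h1; omega
    exact ⟨by simp [code, this, dn], h1.symm, by rw [h2]⟩
  · left
    exact ⟨by simp [code, h1, rt], by rw [h1], h2.symm⟩

theorem code_injective : Function.Injective (code : Arc (grid p q) → List ℕ) := by
  intro e e' h
  have key : e.tail = e'.tail ∧ e.head = e'.head := by
    rcases code_cases e with ⟨h1, h2, h3⟩ | ⟨h1, h2, h3⟩ <;>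
      rcases code_cases e' with ⟨h1', h2', h3'⟩ | ⟨h1', h2', h3'⟩ <;>
      rw [h1, h1'] at h
    · rw [rt_inj] at h
      exact ⟨Prod.ext (Fin.ext h.1) (Fin.ext h.2),
        Prod.ext (Fin.ext (by omega)) (Fin.ext (by omega))⟩
    · simp at h
    · simp at h
    · rw [dn_inj] at h
      exact ⟨Prod.ext (Fin.ext h.1) (Fin.ext h.2),
        Prod.ext (Fin.ext (by omega)) (Fin.ext (by omega))⟩
  exact Subtype.ext (Prod.ext key.1 key.2)

theorem inGrid_code (e : Arc (grid p q)) : InGrid (p - 1) (q - 1) (code e) := by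
  have h1 := e.head.1.isLt
  have h2 := e.head.2.isLt
  rcases code_cases e with ⟨h, h3, h4⟩ | ⟨h, h3, h4⟩
  · rw [h, inGrid_rt]; omega
  · rw [h, inGrid_dn]; omega

theorem exists_rt {u v : Fin p × Fin q} (h1 : v.1.val = u.1.val) (h2 : v.2.val = u.2.val + 1) :
    ∃ e : Arc (grid p q), e.tail = u ∧ e.head = v ∧ code e = rt u.1 u.2 := by
  refine ⟨⟨(u, v), Or.inr ⟨Fin.ext h1.symm, h2.symm⟩⟩, rfl, rfl, ?_⟩
  have : v.1 = u.1 := Fin.ext h1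
  simp [code, Arc.head, Arc.tail, this, rt]

theorem exists_dn {u v : Fin p × Fin q} (h1 : v.1.val = u.1.val + 1) (h2 : v.2.val = u.2.val) :
    ∃ e : Arc (grid p q), e.tail = u ∧ e.head = v ∧ code e = dn u.1 u.2 := by
  refine ⟨⟨(u, v), Or.inl ⟨h1.symm, Fin.ext h2.symm⟩⟩, rfl, rfl, ?_⟩
  have : v.1 ≠ u.1 := fun h => by rw [h] at h1; omega
  simp [code, Arc.head, Arc.tail, this, dn]

theorem exists_code {l : List ℕ} (h : InGrid (p - 1) (q - 1) l) (hp : 0 < p) (hq : 0 < q) :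
    ∃ e : Arc (grid p q), code e = l := by
  obtain ⟨r, s, h1, h2, rfl⟩ | ⟨r, s, h1, h2, rfl⟩ := h
  · obtain ⟨e, _, _, he⟩ := exists_rt (p := p) (q := q) (u := (⟨r, by omega⟩, ⟨s, by omega⟩))
      (v := (⟨r, by omega⟩, ⟨s + 1, by omega⟩)) rfl rfl
    exact ⟨e, he⟩
  · obtain ⟨e, _, _, he⟩ := exists_dn (p := p) (q := q) (u := (⟨r, by omega⟩, ⟨s, by omega⟩))
      (v := (⟨r + 1, by omega⟩, ⟨s, by omega⟩)) rfl rfl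
    exact ⟨e, he⟩

theorem zip_tail_concat {V : Type} (l : List V) (u v : V) :
    (l ++ [u] ++ [v]).zip (l ++ [u] ++ [v]).tail = (l ++ [u]).zip (l ++ [u]).tail ++ [(u, v)] := by
  induction l with
  | nil => simp
  | cons x l ih => cases l with
    | nil => simp
    | cons y l => simpa using ih

/-- The last arc sticks out of the subgrid that contains all earlier arcs. -/
theorem GridPath.nodup {a b : ℕ} {P : List (List ℕ)} (h : GridPath a b P) : P.Nodup := by
  induction h with
  | nil => exact List.nodup_nil
  | right h ih => exact List.nodup_cons.2 ⟨fun h' => by simpa using h.inGrid _ h', ih⟩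
  | down h ih => exact List.nodup_cons.2 ⟨fun h' => by simpa using h.inGrid _ h', ih⟩

/-- Arc lists start with the last arc, so the induction removes the last vertex of the chain; by
`zip_tail_concat` this removes exactly one consecutive pair. -/
theorem exists_gridPath_of_chain (v : Fin p × Fin q) (l : List (Fin p × Fin q))
    (hc : (l ++ [v]).IsChain (grid p q).Adj)
    (hh : ∀ w, (l ++ [v]).head? = some w → w.1.val = 0 ∧ w.2.val = 0) :
    ∃ L : List (Arc (grid p q)), GridPath v.1 v.2 (L.map code) ∧
      ∀ e, e ∈ L ↔ (e.tail, e.head) ∈ (l ++ [v]).zip (l ++ [v]).tail := by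
  induction l using List.reverseRecOn generalizing v with
  | nil =>
    have := hh v rfl
    refine ⟨[], ?_, by simp⟩
    rw [this.1, this.2]; exact .nil
  | append_singleton l u ih =>
    obtain ⟨L, h1, h2⟩ := ih u (List.isChain_append.1 hc).1 (fun w hw => hh w (by
      rw [List.head?_append, hw]; rfl))
    have hadj : (grid p q).Adj u v := (List.isChain_append.1 hc).2.2 u (by simp) v (by simp)
    let e : Arc (grid p q) := ⟨(u, v), hadj⟩
    refine ⟨e :: L, ?_, fun e' => ?_⟩
    · rw [List.map_cons]
      rcases code_cases e with ⟨h, h3, h4⟩ | ⟨h, h3, h4⟩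
      · rw [h, show v.1.val = u.1.val from h3, show v.2.val = u.2.val + 1 from h4]
        exact h1.right
      · rw [h, show v.1.val = u.1.val + 1 from h3, show v.2.val = u.2.val from h4]
        exact h1.down
    · rw [zip_tail_concat, List.mem_append, List.mem_cons, h2, or_comm, List.mem_singleton]
      refine or_congr_right ⟨fun h => by rw [h]; rfl, fun h => Subtype.ext ?_⟩
      exact h

/-- The bound on coordinate sums is carried along to exclude repetitions: each new vertex has a
larger sum than all earlier ones. The length is recorded because a path must have at least two
vertices. -/
theorem exists_chain_of_gridPath {r s : ℕ} {P : List (List ℕ)} (h : GridPath r s P)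
    (hr : r < p) (hs : s < q) :
    ∃ l : List (Fin p × Fin q), l.length = r + s ∧
      (l ++ [((⟨r, hr⟩, ⟨s, hs⟩) : Fin p × Fin q)]).IsChain (grid p q).Adj ∧
      (l ++ [((⟨r, hr⟩, ⟨s, hs⟩) : Fin p × Fin q)]).Nodup ∧
      (∀ u ∈ l ++ [((⟨r, hr⟩, ⟨s, hs⟩) : Fin p × Fin q)], u.1.val + u.2.val ≤ r + s) ∧
      (l ++ [((⟨r, hr⟩, ⟨s, hs⟩) : Fin p × Fin q)]).head? = some (⟨0, by omega⟩, ⟨0, by omega⟩) ∧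
      ∃ L : List (Arc (grid p q)), L.map code = P ∧
      ∀ e, e ∈ L ↔ (e.tail, e.head) ∈ (l ++ [((⟨r, hr⟩, ⟨s, hs⟩) : Fin p × Fin q)]).zip
        (l ++ [((⟨r, hr⟩, ⟨s, hs⟩) : Fin p × Fin q)]).tail := by
  have step : ∀ (l : List (Fin p × Fin q)) (u v : Fin p × Fin q) (e : Arc (grid p q))
      (P : List (List ℕ)) (L : List (Arc (grid p q))),
      e.tail = u → e.head = v → u.1.val + u.2.val + 1 = v.1.val + v.2.val →
      (l.length = u.1.val + u.2.val ∧ (l ++ [u]).IsChain (grid p q).Adj ∧ (l ++ [u]).Nodup ∧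
        (∀ w ∈ l ++ [u], w.1.val + w.2.val ≤ u.1.val + u.2.val) ∧
        (l ++ [u]).head? = some (⟨0, by omega⟩, ⟨0, by omega⟩) ∧ L.map code = P ∧
        ∀ e, e ∈ L ↔ (e.tail, e.head) ∈ (l ++ [u]).zip (l ++ [u]).tail) →
      ((l ++ [u]).length = v.1.val + v.2.val ∧ (l ++ [u] ++ [v]).IsChain (grid p q).Adj ∧
        (l ++ [u] ++ [v]).Nodup ∧
        (∀ w ∈ l ++ [u] ++ [v], w.1.val + w.2.val ≤ v.1.val + v.2.val) ∧
        (l ++ [u] ++ [v]).head? = some (⟨0, by omega⟩, ⟨0, by omega⟩) ∧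
        (e :: L).map code = code e :: P ∧
        ∀ e', e' ∈ e :: L ↔ (e'.tail, e'.head) ∈ (l ++ [u] ++ [v]).zip (l ++ [u] ++ [v]).tail) := by
    rintro l u v e P L rfl rfl huv ⟨h1, h2, h3, h4, h5, h6, h7⟩
    refine ⟨by simp; omega, ?_, ?_, ?_, ?_, by simp [h6], fun e' => ?_⟩
    · refine List.isChain_append.2 ⟨h2, by simp, ?_⟩
      intro x hx y hy
      simp at hx hy
      subst hx hy
      exact e.2
    · refine List.nodup_append.2 ⟨h3, by simp, ?_⟩
      rintro x hx y hy rfl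
      rw [List.mem_singleton] at hy
      subst hy
      have := h4 _ hx
      omega
    · intro w hw
      rcases List.mem_append.1 hw with hw | hw
      · have := h4 _ hw; omega
      · rw [List.mem_singleton] at hw; rw [hw]
    · rw [List.head?_append, h5]; rfl
    · rw [zip_tail_concat, List.mem_append, List.mem_cons, h7, or_comm, List.mem_singleton]
      refine or_congr_right ⟨fun h => by rw [h], fun h => Subtype.ext ?_⟩
      exact h
  induction h with
  | nil => exact ⟨[], rfl, by simp, by simp, by simp, rfl, [], rfl, by simp⟩
  | @right r s P h ih =>
    obtain ⟨l, h1, h2, h3, h4, h5, L, h6, h7⟩ := ih hr (by omega) step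
    obtain ⟨e, he1, he2, he3⟩ := exists_rt (p := p) (q := q)
      (u := (⟨r, hr⟩, ⟨s, by omega⟩)) (v := (⟨r, hr⟩, ⟨s + 1, hs⟩)) rfl rfl
    obtain ⟨g1, g2, g3, g4, g5, g6, g7⟩ := step l _ _ e P L he1 he2 (by simp; omega)
      ⟨h1, h2, h3, h4, h5, h6, h7⟩
    exact ⟨_, g1, g2, g3, g4, g5, _, by rw [g6, he3], g7⟩
  | @down r s P h ih =>
    obtain ⟨l, h1, h2, h3, h4, h5, L, h6, h7⟩ := ih (by omega) hs step
    obtain ⟨e, he1, he2, he3⟩ := exists_dn (p := p) (q := q)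
      (u := (⟨r, by omega⟩, ⟨s, hs⟩)) (v := (⟨r + 1, hr⟩, ⟨s, hs⟩)) rfl rfl
    obtain ⟨g1, g2, g3, g4, g5, g6, g7⟩ := step l _ _ e P L he1 he2 (by simp; omega)
      ⟨h1, h2, h3, h4, h5, h6, h7⟩
    exact ⟨_, g1, g2, g3, g4, g5, _, by rw [g6, he3], g7⟩

/-! ### Transfer of path costs from the graph to arc lists -/

variable {hp : 2 ≤ p} {hq : 2 ≤ q}

/-- `L` lists the arcs of `P`. -/
def Represents (L : List (Arc (grid p q)))
    (P : STPath (grid p q) (gridSource hp hq) (gridTarget hp hq)) : Prop :=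
  GridPath (p - 1) (q - 1) (L.map code) ∧ ∀ e, e ∈ L ↔ e ∈ P.arcs

theorem exists_represents_of_path
    (P : STPath (grid p q) (gridSource hp hq) (gridTarget hp hq)) :
    ∃ L, Represents L P := by
  obtain ⟨l, hl⟩ := List.getLast?_eq_some_iff.1 P.last_eq
  obtain ⟨L, h1, h2⟩ := exists_gridPath_of_chain (gridTarget hp hq) l (hl ▸ P.chain)
    (fun w hw => by
      rw [← hl, P.head_eq] at hw
      obtain rfl := Option.some.inj hw
      exact ⟨rfl, rfl⟩)
  refine ⟨L, h1, fun e => ?_⟩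
  rw [h2, ← hl]
  simp [STPath.arcs]

theorem exists_represents_of_gridPath {L' : List (List ℕ)} (h : GridPath (p - 1) (q - 1) L') :
    ∃ (P : STPath (grid p q) (gridSource hp hq) (gridTarget hp hq)) (L : _),
      Represents L P ∧ L.map code = L' := by
  obtain ⟨l, h1, h2, h3, h4, h5, L, h6, h7⟩ := exists_chain_of_gridPath (p := p) (q := q) h
    (by omega) (by omega)
  refine ⟨⟨l ++ [gridTarget hp hq], by simp; omega, h2, h3, h5, by simp⟩, L,
    ⟨h6 ▸ h, fun e => ?_⟩, h6⟩
  rw [h7]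
  simp only [STPath.arcs, Finset.mem_filter, Finset.mem_univ, true_and]
  rfl

theorem Represents.sum_arcs {L : List (Arc (grid p q))}
    {P : STPath (grid p q) (gridSource hp hq) (gridTarget hp hq)} (h : Represents L P)
    (g : Arc (grid p q) → ℝ) : ∑ e ∈ P.arcs, g e = (L.map g).sum := by
  classical
  have : P.arcs = L.toFinset := by ext e; simp [h.2]
  rw [this, List.sum_toFinset _ h.1.nodup.of_map]

theorem Represents.linCost {L : List (Arc (grid p q))}
    {P : STPath (grid p q) (gridSource hp hq) (gridTarget hp hq)} (h : Represents L P)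
    {c : Arc (grid p q) → ℝ} {d : List ℕ → ℝ} (hd : ∀ e, d (code e) = c e) :
    QSPP.linCost P c = lin d (L.map code) := by
  rw [QSPP.linCost, h.sum_arcs, lin, List.map_map]
  congr 2
  funext e; exact (hd e).symm

theorem Represents.quadCost {L : List (Arc (grid p q))}
    {P : STPath (grid p q) (gridSource hp hq) (gridTarget hp hq)} (h : Represents L P)
    {c : Arc (grid p q) → ℝ} {d : List ℕ → ℝ} (hd : ∀ e, d (code e) = c e)
    {Q : Arc (grid p q) → Arc (grid p q) → ℝ} {m : List ℕ → List ℕ → ℝ}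
    (hm : ∀ e f, m (code e) (code f) = Q e f) :
    QSPP.quadCost P c Q = quad m (L.map code) + lin d (L.map code) := by
  rw [QSPP.quadCost, ← h.linCost hd, QSPP.linCost, h.sum_arcs]
  congr 1
  rw [quad, List.map_map]
  congr 2
  funext e
  rw [h.sum_arcs, Function.comp, lin, List.map_map]
  congr 2
  funext f; exact (hm e f).symm

/-- Paths and arc lists represent each other, so any extensions of the cost data to all codes may be
used: path costs see only the codes of actual arcs. -/
theorem linearizes_iff (I : GridInst hp hq) {d c : List ℕ → ℝ} {m : List ℕ → List ℕ → ℝ}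
    (hc : ∀ e, c (code e) = I.c e) (hm : ∀ e f, m (code e) (code f) = I.Q e f)
    {c' : Arc (grid p q) → ℝ} (hd : ∀ e, d (code e) = c' e) :
    I.Linearizes c' ↔ ∀ P, GridPath (p - 1) (q - 1) P → quad m P + lin c P = lin d P := by
  constructor
  · intro h L hL
    obtain ⟨P, L, hP, rfl⟩ := exists_represents_of_gridPath (hp := hp) (hq := hq) hL
    rw [← hP.quadCost hc hm, h P, hP.linCost hd]
  · intro h P
    obtain ⟨L, hP⟩ := exists_represents_of_path P
    rw [hP.quadCost hc hm, h _ hP.1, hP.linCost hd]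

theorem exists_extension (c : Arc (grid p q) → ℝ) : ∃ d : List ℕ → ℝ, ∀ e, d (code e) = c e :=
  ⟨Function.extend code c 0, fun e => code_injective.extend_apply _ _ e⟩

end Bridge

/-! ## Nonnegative linearizations -/

/-- Shortest path distances from `(0, 0)`. -/
noncomputable def dist (d : List ℕ → ℝ) : ℕ → ℕ → ℝ
  | 0, 0 => 0
  | 0, s + 1 => dist d 0 s + d (rt 0 s)
  | r + 1, 0 => dist d r 0 + d (dn r 0)
  | r + 1, s + 1 => min (dist d (r + 1) s + d (rt (r + 1) s)) (dist d r (s + 1) + d (dn r (s + 1)))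

theorem dist_rt_le (d : List ℕ → ℝ) (r s : ℕ) : dist d r (s + 1) ≤ dist d r s + d (rt r s) := by
  cases r with
  | zero => rw [dist]
  | succ r => rw [dist]; exact min_le_left _ _

theorem dist_dn_le (d : List ℕ → ℝ) (r s : ℕ) : dist d (r + 1) s ≤ dist d r s + d (dn r s) := by
  cases s with
  | zero => rw [dist]
  | succ s => rw [dist]; exact min_le_right _ _

theorem exists_path_dist (d : List ℕ → ℝ) (r s : ℕ) :
    ∃ P, GridPath r s P ∧ lin d P = dist d r s := by
  induction r generalizing s with
  | zero =>
    induction s with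
    | zero => exact ⟨[], .nil, by simp [dist]⟩
    | succ s ih =>
      obtain ⟨P, h1, h2⟩ := ih
      exact ⟨_, h1.right, by rw [lin_cons, h2, dist]; ring⟩
  | succ r ihr =>
    induction s with
    | zero =>
      obtain ⟨P, h1, h2⟩ := ihr 0
      exact ⟨_, h1.down, by rw [lin_cons, h2, dist]; ring⟩
    | succ s ih =>
      rw [dist]
      rcases min_choice (dist d (r + 1) s + d (rt (r + 1) s))
        (dist d r (s + 1) + d (dn r (s + 1))) with h | h
      · obtain ⟨P, h1, h2⟩ := ih
        exact ⟨_, h1.right, by rw [lin_cons, h2, h]; ring⟩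
      · obtain ⟨P, h1, h2⟩ := ihr (s + 1)
        exact ⟨_, h1.down, by rw [lin_cons, h2, h]; ring⟩

/-- A cost vector for which all paths have nonnegative costs can be replaced by a nonnegative
one. -/
theorem exists_nonneg {a b : ℕ} (h0 : 0 < a + b) {d : List ℕ → ℝ}
    (hd : ∀ P, GridPath a b P → 0 ≤ lin d P) :
    ∃ d' : List ℕ → ℝ, (∀ e, InGrid a b e → 0 ≤ d' e) ∧
      ∀ P, GridPath a b P → lin d' P = lin d P := by
  have hT : 0 ≤ dist d a b := by
    obtain ⟨P, h1, h2⟩ := exists_path_dist d a b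
    rw [← h2]; exact hd P h1
  -- Subtracting the distance makes every arc cost nonnegative by the triangle inequality. The
  -- constant `dist d a b`, charged to the arcs out of the source, restores the potential at the
  -- target to `0`; it is nonnegative because it is the cost of a path.
  let π : ℕ → ℕ → ℝ := fun r s => (if r + s = 0 then 0 else dist d a b) - dist d r s
  let d' : List ℕ → ℝ := fun l => match l with
    | [0, r, s] => d (rt r s) + π r (s + 1) - π r s
    | [1, r, s] => d (dn r s) + π (r + 1) s - π r s
    | _ => 0
  have h1 : ∀ r s, d' (rt r s) = d (rt r s) + π r (s + 1) - π r s := fun _ _ => rfl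
  have h2 : ∀ r s, d' (dn r s) = d (dn r s) + π (r + 1) s - π r s := fun _ _ => rfl
  refine ⟨d', ?_, fun P hP => ?_⟩
  · rintro e (⟨r, s, _, _, rfl⟩ | ⟨r, s, _, _, rfl⟩)
    · have := dist_rt_le d r s
      rw [h1]
      simp only [π]
      rw [if_neg (by omega)]
      split <;> linarith
    · have := dist_dn_le d r s
      rw [h2]
      simp only [π]
      rw [if_neg (by omega)]
      split <;> linarith
  · rw [lin_potential π (fun r s _ _ => h1 r s) (fun r s _ _ => h2 r s) hP le_rfl le_rfl]
    simp [π, dist, show ¬ (a = 0 ∧ b = 0) by omega]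

/-- Since `c` and `Q` are nonnegative, so are all path costs under `c'`, even if some of its entries
are negative. This is why rejection excludes linearizations of any signs. -/
theorem Inst.Linearizes.linearizable {p q : ℕ} {hp : 2 ≤ p} {hq : 2 ≤ q} {I : GridInst hp hq}
    {c' : Arc (grid p q) → ℝ} (h : I.Linearizes c') : I.Linearizable := by
  obtain ⟨d, hd⟩ := exists_extension c'
  have key : ∀ P, GridPath (p - 1) (q - 1) P → 0 ≤ lin d P := by
    intro L hL
    obtain ⟨P, L, hP, rfl⟩ := exists_represents_of_gridPath (hp := hp) (hq := hq) hL
    rw [← hP.linCost hd, ← h P, quadCost]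
    exact add_nonneg (Finset.sum_nonneg fun e _ => Finset.sum_nonneg fun f _ => I.Q_nonneg e f)
      (Finset.sum_nonneg fun e _ => I.c_nonneg e)
  obtain ⟨d', h1, h2⟩ := exists_nonneg (by omega) key
  refine ⟨fun e => d' (code e), fun e => h1 _ (inGrid_code e), fun P => ?_⟩
  obtain ⟨L, hL⟩ := exists_represents_of_path P
  rw [h P, hL.linCost hd, hL.linCost (fun _ => rfl), h2 _ hL.1]

/-! ## Correctness -/

open Classical in
/-- The interaction matrix in memory, extended by zero. -/
noncomputable def memQ (a b : ℕ) (σ : State ℝ) (e f : List ℕ) : ℝ :=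
  if InGrid a b e ∧ InGrid a b f then σ.arr .Q (e ++ f) else 0

theorem memQ_code {p q : ℕ} {hp : 2 ≤ p} {hq : 2 ≤ q} {I : GridInst hp hq} {σ : State ℝ}
    (h : Holds σ I) (e f : Arc (grid p q)) :
    memQ (p - 1) (q - 1) σ (code e) (code f) = I.Q e f := by
  rw [memQ, if_pos ⟨inGrid_code e, inGrid_code f⟩, h.Q_eq]

theorem symmZeroDiag_memQ {p q : ℕ} {hp : 2 ≤ p} {hq : 2 ≤ q} {I : GridInst hp hq} {σ : State ℝ}
    (h : Holds σ I) : SymmZeroDiag (memQ (p - 1) (q - 1) σ) := by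
  constructor
  · intro e f
    by_cases hef : InGrid (p - 1) (q - 1) e ∧ InGrid (p - 1) (q - 1) f
    · obtain ⟨e, rfl⟩ := exists_code hef.1 (by omega) (by omega)
      obtain ⟨f, rfl⟩ := exists_code hef.2 (by omega) (by omega)
      rw [memQ_code h, memQ_code h, I.Q_symm]
    · rw [memQ, memQ, if_neg hef, if_neg (fun h => hef h.symm)]
  · intro e
    by_cases he : InGrid (p - 1) (q - 1) e
    · obtain ⟨e, rfl⟩ := exists_code he (by omega) (by omega)
      rw [memQ_code h, I.Q_diag]
    · rw [memQ, if_neg (fun h => he h.1)]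

theorem gridInput {p q : ℕ} {hp : 2 ≤ p} {hq : 2 ≤ q} {I : GridInst hp hq} {σ : State ℝ}
    (h : Holds σ I) : GridInput (memQ (p - 1) (q - 1) σ) (p - 1) (q - 1) σ where
  symm := symmZeroDiag_memQ h
  holds := fun e f he hf => by rw [memQ, if_pos ⟨he, hf⟩]
  reg_p := by rw [h.p_eq]; omega
  reg_q := by rw [h.q_eq]; omega
  pos := by omega

theorem ReducedOn.isReduced {p q : ℕ} {hp : 2 ≤ p} {hq : 2 ≤ q} {d : List ℕ → ℝ}
    (h : ReducedOn (p - 1) (q - 1) d) : IsReduced hp hq fun e => d (code e) := by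
  intro e hs _ hsel
  have h1 := e.tail.1.isLt
  have h2 := e.tail.2.isLt
  have h3 := e.head.1.isLt
  have h4 := e.head.2.isLt
  have h0 : 0 < e.tail.1.val + e.tail.2.val := by
    by_contra h'
    exact hs (Prod.ext (Fin.ext (by simp [gridSource]; omega))
      (Fin.ext (by simp [gridSource]; omega)))
  have := h e.tail.1 e.tail.2 (by omega) (by omega) h0
  unfold IsSelected at hsel
  rcases code_cases e with ⟨h5, h6, h7⟩ | ⟨h5, h6, h7⟩
  · simp only [h5]
    exact this.1 (by omega)
  · simp only [h5]
    split at hsel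
    · omega
    · exact this.2 (by omega) (by omega)

theorem final_spec {p q : ℕ} {hp : 2 ≤ p} {hq : 2 ≤ q} {I : GridInst hp hq} {σ : State ℝ}
    (h : Holds σ I) :
    (Accepts σ ∧ I.Linearizes (output p q σ) ∧ IsReduced hp hq (output p q σ)) ∨
    (Rejects σ ∧ ∀ c', ¬ I.Linearizes c') := by
  have hc : ∀ e : Arc (grid p q), σ.arr .c (code e) = I.c e := h.c_eq
  rcases exec_linearizeGridQSPP (gridInput h) (τ := final σ) rfl with ⟨h1, h2, h3, h4⟩ | ⟨h1, h2⟩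
  · refine Or.inl ⟨h1, ?_, h3.isReduced⟩
    refine (linearizes_iff I hc (memQ_code h) (fun _ => rfl)).2 fun P hP => ?_
    rw [h2 P hP]
    exact (h4 P hP).symm
  · refine Or.inr ⟨h1, fun c' hc' => h2 ?_⟩
    obtain ⟨d, hd⟩ := exists_extension c'
    have := (linearizes_iff I hc (memQ_code h) hd).1 hc'
    -- A linearization of the full costs, minus the linear costs of the instance, linearizes the
    -- interaction costs.
    refine LinearizesAt.plin (d := fun e => d e + (-1) * σ.arr .c e) (by omega) fun P hP => ?_
    have h5 : lin (fun e => (-1) * σ.arr .c e) P = - lin (σ.arr .c) P := by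
      unfold lin
      rw [List.sum_map_mul_left]
      ring
    rw [lin_add, h5]
    linarith [this P hP]

end QSPP

/-! ### Correctness and running time of the algorithm -/

theorem theorem21 :
    (∀ (p q : ℕ) (hp : 2 ≤ p) (hq : 2 ≤ q) (I : QSPP.GridInst hp hq) (σ : QSPP.State ℝ),
      QSPP.Holds σ I →
        (I.Linearizable → QSPP.Accepts σ) ∧
        (¬ I.Linearizable → QSPP.Rejects σ) ∧
        (QSPP.Accepts σ →
          I.Linearizes (QSPP.output p q σ) ∧ QSPP.IsReduced hp hq (QSPP.output p q σ)) ∧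
        (QSPP.Rejects σ → ∀ c' : QSPP.Arc (QSPP.grid p q) → ℝ, ¬ I.Linearizes c')) ∧
    (∃ K : ℕ, ∀ (p q : ℕ) (hp : 2 ≤ p) (hq : 2 ≤ q) (I : QSPP.GridInst hp hq)
      (σ : QSPP.State ℝ), QSPP.Holds σ I →
        QSPP.time σ ≤ K * (p ^ 3 * q ^ 2 + p ^ 2 * q ^ 3)) := by
  refine ⟨fun p q hp hq I σ h => ?_, 10000, fun p q hp hq I σ h => ?_⟩
  · have hne : QSPP.Accepts σ → QSPP.Rejects σ → False := fun h1 h2 => by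
      rw [QSPP.Accepts, show _ = 0 from h2] at h1
      exact absurd h1 (by omega)
    rcases QSPP.final_spec h with ⟨h1, h2, h3⟩ | ⟨h1, h2⟩
    · exact ⟨fun _ => h1, fun h' => absurd h2.linearizable h', fun _ => ⟨h2, h3⟩,
        fun h' => (hne h1 h').elim⟩
    · exact ⟨fun ⟨c', _, h'⟩ => absurd h' (h2 c'), fun _ => h1, fun h' => (hne h' h1).elim,
        fun _ => h2⟩
  · refine (QSPP.Stmt.run_le_stepBound (QSPP.regBound p q) _ _
      (QSPP.linearizeGridQSPP_bounded hp hq) σ ?_).2.trans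
      (QSPP.linearizeGridQSPP_stepBound hp hq)
    rintro x (rfl | rfl)
    · exact h.p_eq.le
    · exact h.q_eq.le
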